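/- Let $A=(a_{jk})$ be a real symmetric positive-definite $3\times 3$ matrix and $D=-i\nabla$ on $\mathbb{R}^3$. For a measurable $f:\mathbb{R}^3\to\mathbb{R}$ put $$\|f\|_{\mathcal F}=\sup_{Q}\Big(\int_Q|f(x)|\,dx\Big)^{-1}\int_Q\int_Q\frac{|f(x)f(y)|}{|x-y|}\,dx\,dy\in[0,\infty],$$ where $Q$ runs over all dyadic cubes $2^m(k+[0,1)^3)$, $m\in\mathbb{Z}$, $k\in\mathbb{Z}^3$ (a cube on which $f=0$ a.e. contributes $0$). Let $\Omega=[0,2\pi)^3$, and for $V:\mathbb{R}^3\to\mathbb{R}$ and $N\in\mathbb{R}$ let $V_N=V$ where $|V|>N$ and $V_N=0$ elsewhere. There is $\varepsilon>0$, depending only on $A$, such that the following holds for every real function $V\in L^1_{\mathrm{loc}}(\mathbb{R}^3)$ that is periodic with respect to $(2\pi\mathbb{Z})^3$ and satisfies $$\limsup_{N\to\infty}\|V_N\chi_\Omega\|_{\mathcal F}<\varepsilon$$ (the limsup is the limit whenever the limit exists). For all $f,g\in H^1(\mathbb{R}^3)$ (complex valued) the function $Vf\bar g$ is integrable, so that $$q[f,g]=\int_{\mathbb{R}^3}\langle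 (Df)A,Dg\rangle+\langle Vf,g\rangle\,dx,\qquad f,g\in H^1(\mathbb{R}^3),$$ is well defined, where $\langle u,v\rangle=\sum_k u_k\overline{v_k}$. There exists a unique self-adjoint operator $T$ in $L^2(\mathbb{R}^3)$ with $\mathrm{Dom}[T]\subset H^1(\mathbb{R}^3)$ and $$q[f,g]=\int_{\mathbb{R}^3}\langle Tf,g\rangle\,dx\qquad\text{for all } f\in\mathrm{Dom}[T],\ g\in H^1(\mathbb{R}^3).$$ It acts as $Tf=(DAD^T+V)f$, where $(DAD^T+V)f=\sum_{j,k}D_ja_{jk}D_kf+Vf$ is understood in the sense of distributions (with $Vf\in L^1_{\mathrm{loc}}$), and its domain is $$\mathrm{Dom}[T]=\{f\in H^1(\mathbb{R}^3):(DAD^T+V)f\in L^2(\mathbb{R}^3)\}.$$ -/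

import Mathlib

open MeasureTheory Filter Topology
open scoped ENNReal ContDiff ComplexConjugate

namespace PeriodicSchrodinger

noncomputable section

/-- Euclidean three-dimensional space. -/
abbrev E3 : Type := EuclideanSpace ℝ (Fin 3)

/-- The complex Hilbert space `L²(ℝ³)`. -/
abbrev L2 : Type := Lp ℂ 2 (volume : Measure E3)

/-- The standard basis vectors of `ℝ³`. -/
def basisVec (j : Fin 3) : E3 := EuclideanSpace.single j (1 : ℝ)

/-! ### The Kerman–Sawyer class and the smallness condition -/

/-- The dyadic cube `2^m (k + [0,1)³)`. -/
def dyadicCube (m : ℤ) (k : Fin 3 → ℤ) : Set E3 :=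
  {x | ∀ i, (2 : ℝ) ^ m * (k i : ℝ) ≤ x i ∧ x i < (2 : ℝ) ^ m * ((k i : ℝ) + 1)}

/-- The norm of the class `𝓕`: the supremum over all dyadic cubes `Q` of
`(∫_Q |f|)⁻¹ ∫_Q ∫_Q |f(x) f(y)| / |x - y| dx dy`, with values in `[0, ∞]`.
A cube on which `f` vanishes almost everywhere contributes `∞ * 0 = 0`. -/
def kermanSawyerNorm (f : E3 → ℝ) : ℝ≥0∞ :=
  ⨆ (m : ℤ) (k : Fin 3 → ℤ),
    (∫⁻ x in dyadicCube m k, ‖f x‖ₑ)⁻¹ *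
      ∫⁻ x in dyadicCube m k, ∫⁻ y in dyadicCube m k, ‖f x * f y‖ₑ / ‖x - y‖ₑ

/-- The period cell `Ω = [0, 2π)³`. -/
def cell : Set E3 := {x | ∀ i, 0 ≤ x i ∧ x i < 2 * Real.pi}

/-- The large part `V_N` of `V`: equal to `V` where `|V| > N` and to `0` elsewhere. -/
def largePart (V : E3 → ℝ) (N : ℝ) : E3 → ℝ := Set.indicator {x | N < |V x|} V

/-- Periodicity with respect to the lattice `(2πℤ)³`. -/
def IsLatticePeriodic (V : E3 → ℝ) : Prop :=
  ∀ (j : Fin 3) (x : E3), V (x + (2 * Real.pi) • basisVec j) = V x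

/-- The smallness condition: `limsup_{N → ∞} ‖V_N χ_Ω‖_𝓕 < ε`. -/
def SmallLargeParts (V : E3 → ℝ) (ε : ℝ) : Prop :=
  limsup (fun N : ℝ => kermanSawyerNorm (cell.indicator (largePart V N))) atTop
    < ENNReal.ofReal ε

/-! ### Test functions, weak derivatives, and the Sobolev space `H¹(ℝ³)` -/

/-- Complex test functions: smooth with compact support. -/
def IsTest (φ : E3 → ℂ) : Prop := ContDiff ℝ ∞ φ ∧ HasCompactSupport φ

/-- The classical partial derivative `∂_j φ`. -/
def classicalPartial (j : Fin 3) (φ : E3 → ℂ) (x : E3) : ℂ := fderiv ℝ φ x (basisVec j)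

/-- `g` is the weak partial derivative `∂_j f`. -/
def IsWeakPartial (j : Fin 3) (f g : L2) : Prop :=
  ∀ φ : E3 → ℂ, IsTest φ →
    ∫ x, f x * classicalPartial j φ x = - ∫ x, g x * φ x

/-- The Sobolev space `H¹(ℝ³)`, as a subset of `L²(ℝ³)`. -/
def H1 : Set L2 := {f | ∀ j : Fin 3, ∃ g : L2, IsWeakPartial j f g}

/-- Weak partial derivatives are unique. -/
theorem IsWeakPartial.unique {j : Fin 3} {f g g' : L2}
    (h : IsWeakPartial j f g) (h' : IsWeakPartial j f g') : g = g' := by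
  have hl : ∀ u : L2, LocallyIntegrable u volume := fun u =>
    (Lp.memLp u).locallyIntegrable (by norm_num)
  apply Lp.ext
  have key : ∀ᵐ x ∂(volume : Measure E3), (g : E3 → ℂ) x - g' x = 0 := by
    refine ae_eq_zero_of_integral_contDiff_smul_eq_zero ((hl g).sub (hl g')) ?_
    intro ρ hρ hc
    have ht : IsTest (fun x => (ρ x : ℂ)) :=
      ⟨Complex.ofRealCLM.contDiff.comp hρ, hc.comp_left (g := fun r : ℝ => (r : ℂ)) rfl⟩
    have e := neg_injective ((h _ ht).symm.trans (h' _ ht))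
    have i : ∀ u : L2, Integrable (fun x => ρ x • (u : E3 → ℂ) x) volume := fun u =>
      (hl u).integrable_smul_left_of_hasCompactSupport hρ.continuous hc
    have s : ∀ u : L2, ∫ x, (u : E3 → ℂ) x * (ρ x : ℂ) = ∫ x, ρ x • (u : E3 → ℂ) x :=
      fun u => integral_congr_ae (ae_of_all _ fun x => by simp [mul_comm])
    simp only [s] at e
    simp only [smul_sub]
    rw [integral_sub (i g) (i g'), e, sub_self]
  filter_upwards [key] with x hx using sub_eq_zero.mp hx

open Classical in
/-- The weak partial derivative `∂_j f ∈ L²(ℝ³)` (zero if there is none). -/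
def weakPartial (j : Fin 3) (f : L2) : L2 :=
  if h : ∃ g : L2, IsWeakPartial j f g then h.choose else 0

/-- For `f` in `H¹(ℝ³)` the function `weakPartial j f` is the weak partial derivative. -/
theorem isWeakPartial_weakPartial {f : L2} (hf : f ∈ H1) (j : Fin 3) :
    IsWeakPartial j f (weakPartial j f) := by
  unfold weakPartial
  rw [dif_pos (hf j)]
  exact (hf j).choose_spec

/-- `D_j f = -i ∂_j f` for `f` in `H¹(ℝ³)`. -/
def weakD (j : Fin 3) (f : L2) : L2 := (-Complex.I) • weakPartial j f

/-- `D_j φ = -i ∂_j φ` for differentiable `φ`. -/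
def classicalD (j : Fin 3) (φ : E3 → ℂ) (x : E3) : ℂ := -Complex.I * classicalPartial j φ x

/-! ### The quadratic form and the differential expression -/

/-- The form `q[f,g] = ∫ ⟨(Df)A, Dg⟩ + ⟨V f, g⟩ dx` on `H¹(ℝ³)`; the pairings
`⟨u, v⟩ = ∑ u_k conj(v_k)` are linear in the first argument. -/
def form (A : Matrix (Fin 3) (Fin 3) ℝ) (V : E3 → ℝ) (f g : L2) : ℂ :=
  ∫ x, ((∑ k, (∑ j, weakD j f x * (A j k : ℂ)) * conj (weakD k g x))
    + (V x : ℂ) * f x * conj (g x))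

/-- `(D A Dᵀ + V) f = h` in the sense of distributions: `V f` is locally integrable and
`∑ a_jk D_j D_k f + V f = h` when tested against all test functions. -/
def DistributionalEq (A : Matrix (Fin 3) (Fin 3) ℝ) (V : E3 → ℝ) (f h : L2) : Prop :=
  LocallyIntegrable (fun x => (V x : ℂ) * f x) volume ∧
  ∀ φ : E3 → ℂ, IsTest φ →
    (∑ j, ∑ k, (A j k : ℂ) * ∫ x, f x * classicalD k (classicalD j φ) x)
      + ∫ x, (V x : ℂ) * f x * φ x = ∫ x, h x * φ x

/-- `T` is a self-adjoint operator in `L²(ℝ³)` with domain in `H¹(ℝ³)`, and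
`q[f,g] = ∫ ⟨T f, g⟩ dx` for all `f` in its domain and all `g` in `H¹(ℝ³)`. -/
def IsSelfAdjointOperatorOfForm (A : Matrix (Fin 3) (Fin 3) ℝ) (V : E3 → ℝ)
    (T : L2 →ₗ.[ℂ] L2) : Prop :=
  IsSelfAdjoint T ∧ (T.domain : Set L2) ⊆ H1 ∧
  ∀ f : T.domain, ∀ g ∈ H1, form A V f g = ∫ x, T f x * conj (g x)

end

end PeriodicSchrodinger

open MeasureTheory Filter Topology
open scoped ENNReal ContDiff ComplexConjugate

namespace PeriodicSchrodinger

/-! Everything rests on a form bound ∫|V||f|² ≤ a‖f‖²_{H¹} + N‖f‖² with a below the smallest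
eigenvalue c of A. Since |V| ≤ |V_N| + N, only the large part V_N has to be controlled, and it
contributes a = const·ε.

The bound for w = |V_N χ_Ω| is a trace inequality. The kernel 1/|x - y| dominates, up to the factor
4, the dyadic kernel ∑ ℓ(Q)⁻¹ over the cubes Q containing x and y, so the testing condition yields
the Carleson condition ∑_{Q ⊆ R} ℓ(Q)⁻¹ w(Q)² ≤ 4ε w(R) (`Node.treeSum_sq_lintegral_le`). A Bellman
function argument (`treeSum_carleson`) upgrades it to ∑ ℓ(Q)⁻¹ (∫_Q |f| w)² ≤ 16ε F with F = ∫_R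
|f|² w. In F one factor f is replaced by its mean over R plus telescoping differences of dyadic
means, which the L¹ Poincaré inequality bounds by ℓ(Q)⁻² ∫_Q |∇f|. By duality ∇f is then paired with
the dyadic potential ∑ 1_Q ℓ(Q)⁻² ∫_Q |f| w, whose L² norm is at most const·(εF)^{1/2} by a dyadic
Wolff inequality (`Node.lintegral_sq_treeSum_le`) and the embedding. Thus F ≤ const·(εF)^{1/2}
‖f‖_{H¹(R)}, and F cancels (`Node.trace_le`). Summation over lattice translates gives the bound on
ℝ³ for smooth f, and mollification with Fatou's lemma gives it on H¹.

The operator is the relation of all (f, h) with q[f, v] = ⟨h, v⟩ for every v in H¹. It is symmetric,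
and by Lax–Milgram a real shift of it is onto, hence it is self-adjoint. Any competitor is a
restriction of it, and self-adjoint operators have no proper symmetric extensions, which gives
uniqueness. Density of test functions in H¹ makes the weak equation equivalent to the distributional
one, which gives the action and the domain. -/

/-- The sum of `a` over the first `n` generations of the tree below the node `q`, where `c q`
lists the children of `q`. -/
def treeSum {N ι M : Type*} [Fintype ι] [AddCommMonoid M] (c : N → ι → N) (a : N → M) :
    ℕ → N → M
  | 0, _ => 0
  | n + 1, q => a q + ∑ i, treeSum c a n (c q i)

/-! ### Carleson embedding on a tree. -/

section Tree

variable {N ι : Type*} [Fintype ι] {c : N → ι → N}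

theorem treeSum_map {M M' : Type*} [AddCommMonoid M] [AddCommMonoid M'] (φ : M →+ M')
    (a : N → M) (n : ℕ) (q : N) :
    φ (treeSum c a n q) = treeSum c (fun q => φ (a q)) n q := by
  induction n generalizing q with
  | zero => simp [treeSum]
  | succ n ih => simp [treeSum, ih]

theorem treeSum_nonneg {a : N → ℝ} (h : ∀ q, 0 ≤ a q) (n : ℕ) (q : N) :
    0 ≤ treeSum c a n q := by
  induction n generalizing q with
  | zero => simp [treeSum]
  | succ n ih => exact add_nonneg (h q) (Finset.sum_nonneg fun i _ => ih _)

theorem ofReal_treeSum {a : N → ℝ} (h : ∀ q, 0 ≤ a q) (n : ℕ) (q : N) :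
    ENNReal.ofReal (treeSum c a n q) = treeSum c (fun q => ENNReal.ofReal (a q)) n q := by
  induction n generalizing q with
  | zero => simp [treeSum]
  | succ n ih =>
    simp only [treeSum]
    rw [ENNReal.ofReal_add (h q) (Finset.sum_nonneg fun i _ => treeSum_nonneg h n _),
      ENNReal.ofReal_sum_of_nonneg (fun i _ => treeSum_nonneg h n _)]
    simp [ih]

/-- Carleson embedding on a tree, in the sharpened form that is proved by induction. -/
theorem treeSum_carleson_aux {w x F b : N → ℝ} (hb : ∀ q, 0 ≤ b q) (hw : ∀ q, 0 ≤ w q)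
    (wadd : ∀ q, w q = ∑ i, w (c q i)) (xadd : ∀ q, x q = ∑ i, x (c q i))
    (Fadd : ∀ q, F q = ∑ i, F (c q i)) (hxF : ∀ q, x q ^ 2 ≤ F q * w q)
    (hF : ∀ q, 0 ≤ F q)
    (car : ∀ n q, treeSum c (fun q => b q * w q ^ 2) n q ≤ w q) (n : ℕ) (q : N) :
    treeSum c (fun q => b q * x q ^ 2) n q ≤
      4 * (F q - x q ^ 2 / (w q + treeSum c (fun q => b q * w q ^ 2) n q)) := by
  have hx0 : ∀ q, w q = 0 → x q = 0 := fun q h => by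
    have := hxF q
    rw [h, mul_zero] at this
    exact pow_eq_zero_iff (two_ne_zero) |>.1 (le_antisymm this (sq_nonneg _))
  have hm : ∀ n q, 0 ≤ treeSum c (fun q => b q * w q ^ 2) n q :=
    treeSum_nonneg fun q => mul_nonneg (hb q) (sq_nonneg _)
  -- F - x²/(w + M), with M the truncated Carleson sum, is a Bellman function: its value at a node
  -- exceeds the sum of its values at the children by at least b x²/4.
  induction n generalizing q with
  | zero =>
    simp only [treeSum, add_zero]
    rcases (hw q).eq_or_lt with h | h
    · simp [← h, hF q]
    · have : x q ^ 2 / w q ≤ F q := by rw [div_le_iff₀ h]; exact hxF q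
      linarith
  | succ n ih =>
    set m : N → ℝ := treeSum c (fun q => b q * w q ^ 2) n with hmdef
    have car' := car (n + 1) q
    simp only [treeSum] at car' ⊢
    rw [← hmdef] at car' ⊢
    have h1 : ∑ i, treeSum c (fun q => b q * x q ^ 2) n (c q i) ≤
        4 * (F q - ∑ i, x (c q i) ^ 2 / (w (c q i) + m (c q i))) := by
      rw [Fadd q, ← Finset.sum_sub_distrib, Finset.mul_sum]
      exact Finset.sum_le_sum fun i _ => ih _
    rcases (hw q).eq_or_lt with h | h
    · have hxq := hx0 q h.symm
      have : 0 ≤ ∑ i, x (c q i) ^ 2 / (w (c q i) + m (c q i)) :=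
        Finset.sum_nonneg fun i _ => div_nonneg (sq_nonneg _) (add_nonneg (hw _) (hm _ _))
      simp only [hxq]
      norm_num
      linarith
    · set D := w q + ∑ i, m (c q i) with hD
      have hms : 0 ≤ ∑ i, m (c q i) := Finset.sum_nonneg fun i _ => hm _ _
      have hDpos : 0 < D := by positivity
      -- Joint convexity of x²/s, in the form of the Cauchy–Schwarz inequality over the children; D
      -- is the sum of their denominators.
      have titu : x q ^ 2 / D ≤ ∑ i, x (c q i) ^ 2 / (w (c q i) + m (c q i)) := by
        rw [div_le_iff₀ hDpos, hD, xadd q, wadd q, ← Finset.sum_add_distrib]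
        refine Finset.sum_sq_le_sum_mul_sum_of_sq_le_mul _
          (fun i _ => div_nonneg (sq_nonneg _) (add_nonneg (hw _) (hm _ _)))
          (fun i _ => add_nonneg (hw _) (hm _ _)) (fun i _ => le_of_eq ?_)
        rcases (hw (c q i)).eq_or_lt with h' | h'
        · simp [hx0 _ h'.symm]
        · have : 0 < w (c q i) + m (c q i) := add_pos_of_pos_of_nonneg h' (hm _ _)
          field_simp
      have hbw : 0 ≤ b q * w q ^ 2 := mul_nonneg (hb q) (sq_nonneg _)
      -- Adding b w² to the denominator D lowers x²/D by b w² x² / (D (D + b w²)). The Carleson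
      -- condition bounds both factors of the denominator by 2w, so the loss is at least b x²/4;
      -- this is the source of the constant 4.
      have key : b q * x q ^ 2 ≤ 4 * (x q ^ 2 / D - x q ^ 2 / (w q + (b q * w q ^ 2 +
          ∑ i, m (c q i)))) := by
        have e : w q + (b q * w q ^ 2 + ∑ i, m (c q i)) = D + b q * w q ^ 2 := by rw [hD]; ring
        rw [e]
        have hD' : 0 < D + b q * w q ^ 2 := by positivity
        have hle : D + b q * w q ^ 2 ≤ 2 * w q := by rw [hD]; linarith
        rw [div_sub_div _ _ hDpos.ne' hD'.ne', mul_div_assoc', le_div_iff₀ (by positivity)]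
        have h4 : D * (D + b q * w q ^ 2) ≤ 4 * w q ^ 2 := by nlinarith
        have h5 : 0 ≤ b q * x q ^ 2 := mul_nonneg (hb q) (sq_nonneg _)
        nlinarith [mul_le_mul_of_nonneg_left h4 h5]
      linarith

/-- Carleson embedding on a tree. -/
theorem treeSum_carleson {w x F b : N → ℝ} (hb : ∀ q, 0 ≤ b q) (hw : ∀ q, 0 ≤ w q)
    (wadd : ∀ q, w q = ∑ i, w (c q i)) (xadd : ∀ q, x q = ∑ i, x (c q i))
    (Fadd : ∀ q, F q = ∑ i, F (c q i)) (hxF : ∀ q, x q ^ 2 ≤ F q * w q)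
    (hF : ∀ q, 0 ≤ F q)
    (car : ∀ n q, treeSum c (fun q => b q * w q ^ 2) n q ≤ w q) (n : ℕ) (q : N) :
    treeSum c (fun q => b q * x q ^ 2) n q ≤ 4 * F q := by
  have h := treeSum_carleson_aux hb hw wadd xadd Fadd hxF hF car n q
  have : 0 ≤ x q ^ 2 / (w q + treeSum c (fun q => b q * w q ^ 2) n q) :=
    div_nonneg (sq_nonneg _) (add_nonneg (hw q)
      (treeSum_nonneg (fun q => mul_nonneg (hb q) (sq_nonneg _)) n q))
  linarith

end Tree

end PeriodicSchrodinger

/-! ### Geometry of dyadic cubes. -/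

namespace PeriodicSchrodinger

/-- The cube `s (k + [0,1)³)` of the grid of mesh `s`. -/
def gridCube (s : ℝ) (k : Fin 3 → ℤ) : Set E3 :=
  {x | ∀ i, s * (k i : ℝ) ≤ x i ∧ x i < s * ((k i : ℝ) + 1)}

theorem mem_gridCube_iff {s : ℝ} (hs : 0 < s) {k : Fin 3 → ℤ} {x : E3} :
    x ∈ gridCube s k ↔ ∀ i, ⌊x i / s⌋ = k i := by
  refine forall_congr' fun i => ?_
  rw [Int.floor_eq_iff, le_div_iff₀ hs, div_lt_iff₀ hs, mul_comm s, mul_comm s]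

theorem measurableSet_gridCube (s : ℝ) (k : Fin 3 → ℤ) : MeasurableSet (gridCube s k) := by
  have : gridCube s k = ⋂ i, (fun x : E3 => x i) ⁻¹' Set.Ico (s * (k i : ℝ)) (s * ((k i : ℝ) + 1)) := by
    ext x; simp [gridCube]
  rw [this]
  exact MeasurableSet.iInter fun i => (by fun_prop : Measurable fun x : E3 => x i) measurableSet_Ico

theorem convex_gridCube (s : ℝ) (k : Fin 3 → ℤ) : Convex ℝ (gridCube s k) := by
  intro x hx y hy a b ha hb hab i
  have h := (convex_Ico (𝕜 := ℝ) (s * (k i : ℝ)) (s * ((k i : ℝ) + 1))) (hx i) (hy i) ha hb hab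
  simpa using h

theorem volume_gridCube {s : ℝ} (hs : 0 ≤ s) (k : Fin 3 → ℤ) :
    volume (gridCube s k) = ENNReal.ofReal (s ^ 3) := by
  have h : gridCube s k = (WithLp.ofLp : E3 → Fin 3 → ℝ) ⁻¹'
      Set.univ.pi fun i => Set.Ico (s * (k i : ℝ)) (s * ((k i : ℝ) + 1)) := by
    ext x; simp [gridCube]
  rw [h, (PiLp.volume_preserving_ofLp (ι := Fin 3)).measure_preimage
    (MeasurableSet.univ_pi fun i => measurableSet_Ico).nullMeasurableSet, Real.volume_pi_Ico]
  have : ∀ i, s * ((k i : ℝ) + 1) - s * k i = s := fun i => by ring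
  simp [this, ENNReal.ofReal_pow hs]

theorem norm_sub_le_of_mem_gridCube {s : ℝ} (hs : 0 ≤ s) {k : Fin 3 → ℤ} {x y : E3}
    (hx : x ∈ gridCube s k) (hy : y ∈ gridCube s k) : ‖x - y‖ ≤ 2 * s := by
  rw [EuclideanSpace.norm_eq, Real.sqrt_le_left (by positivity)]
  have h : ∀ i, ‖(x - y) i‖ ^ 2 ≤ s ^ 2 := fun i => by
    have h1 := hx i
    have h2 := hy i
    have : |(x - y) i| ≤ s := by
      rw [abs_le]; simp only [PiLp.sub_apply]; constructor <;> linarith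
    rw [Real.norm_eq_abs]
    exact pow_le_pow_left₀ (abs_nonneg _) this 2
  calc ∑ i, ‖(x - y) i‖ ^ 2 ≤ ∑ _i : Fin 3, s ^ 2 := Finset.sum_le_sum fun i _ => h i
    _ ≤ (2 * s) ^ 2 := by simp; nlinarith [sq_nonneg s]

theorem pairwise_disjoint_gridCube {s : ℝ} (hs : 0 < s) :
    Pairwise (Function.onFun Disjoint (gridCube s)) := by
  intro k k' h
  rw [Function.onFun, Set.disjoint_left]
  intro x hx hx'
  rw [mem_gridCube_iff hs] at hx hx'
  exact h (funext fun i => (hx i).symm.trans (hx' i))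

theorem iUnion_gridCube {s : ℝ} (hs : 0 < s) : ⋃ k, gridCube s k = Set.univ := by
  refine Set.eq_univ_of_forall fun x => Set.mem_iUnion.2 ⟨fun i => ⌊x i / s⌋, ?_⟩
  rw [mem_gridCube_iff hs]
  exact fun i => rfl

/-- The index of the child cube in the position `e`. -/
def childIndex (k : Fin 3 → ℤ) (e : Fin 3 → Fin 2) : Fin 3 → ℤ := fun i => 2 * k i + (e i : ℕ)

theorem childIndex_injective (k : Fin 3 → ℤ) : Function.Injective (childIndex k) := by
  intro e e' h
  funext i
  have := congrFun h i
  simp only [childIndex] at this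
  omega

/-- The floor of x/(2s) is the integer half of the floor of x/s, and the parities of the finer
indices tell in which child a point lies. -/
theorem gridCube_eq_iUnion_child (s : ℝ) (hs : 0 < s) (k : Fin 3 → ℤ) :
    gridCube (2 * s) k = ⋃ e, gridCube s (childIndex k e) := by
  ext x
  simp only [Set.mem_iUnion, mem_gridCube_iff hs, mem_gridCube_iff (by positivity : 0 < 2 * s)]
  have key : ∀ i, ⌊x i / (2 * s)⌋ = ⌊x i / s⌋ / 2 := fun i => by
    have := Int.floor_div_natCast (x i / s) 2
    rw [mul_comm, ← div_div]
    exact_mod_cast this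
  simp only [key]
  constructor
  · intro h
    refine ⟨fun i => ⟨(⌊x i / s⌋ % 2).toNat, by omega⟩, fun i => ?_⟩
    have := h i
    simp only [childIndex]
    omega
  · rintro ⟨e, h⟩ i
    have := h i
    simp only [childIndex] at this
    omega

/-- The nodes of the tree of dyadic cubes. -/
abbrev Node : Type := ℤ × (Fin 3 → ℤ)

namespace Node

/-- The dyadic cube of a node. -/
def cube (q : Node) : Set E3 := dyadicCube q.1 q.2

/-- The side length of the dyadic cube of a node. -/
noncomputable def side (q : Node) : ℝ := 2 ^ q.1

/-- The children of a dyadic cube. -/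
def child (q : Node) (e : Fin 3 → Fin 2) : Node := (q.1 - 1, childIndex q.2 e)

theorem side_pos (q : Node) : 0 < q.side := by unfold side; positivity

theorem cube_eq (q : Node) : q.cube = gridCube q.side q.2 := rfl

theorem side_child (q : Node) (e : Fin 3 → Fin 2) : (q.child e).side = q.side / 2 := by
  simp [side, child, zpow_sub₀]

theorem measurableSet_cube (q : Node) : MeasurableSet q.cube := measurableSet_gridCube _ _

theorem convex_cube (q : Node) : Convex ℝ q.cube := convex_gridCube _ _

theorem volume_cube (q : Node) : volume q.cube = ENNReal.ofReal (q.side ^ 3) :=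
  volume_gridCube q.side_pos.le _

theorem norm_sub_le {q : Node} {x y : E3} (hx : x ∈ q.cube) (hy : y ∈ q.cube) :
    ‖x - y‖ ≤ 2 * q.side := norm_sub_le_of_mem_gridCube q.side_pos.le hx hy

theorem cube_eq_iUnion_child (q : Node) : q.cube = ⋃ e, (q.child e).cube := by
  have := gridCube_eq_iUnion_child (q.side / 2) (half_pos q.side_pos) q.2
  rw [mul_div_cancel₀ _ (two_ne_zero)] at this
  simp only [cube_eq, this, side_child]
  rfl

theorem child_cube_subset (q : Node) (e : Fin 3 → Fin 2) : (q.child e).cube ⊆ q.cube := by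
  rw [cube_eq_iUnion_child q]
  exact Set.subset_iUnion (fun e => (q.child e).cube) e

theorem disjoint_child (q : Node) :
    Pairwise (Function.onFun Disjoint fun e => (q.child e).cube) := by
  intro e e' h
  have := pairwise_disjoint_gridCube (half_pos q.side_pos)
    (fun h' => h (childIndex_injective q.2 h') : childIndex q.2 e ≠ childIndex q.2 e')
  simp only [Function.onFun, cube_eq, side_child]
  exact this

theorem isBounded_cube (q : Node) : Bornology.IsBounded q.cube := by
  rw [Metric.isBounded_iff]
  exact ⟨2 * q.side, fun x hx y hy => by rw [dist_eq_norm]; exact norm_sub_le hx hy⟩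

end Node

end PeriodicSchrodinger

/-! ### From the testing condition to the Carleson condition. -/

namespace PeriodicSchrodinger

section

variable {α N ι : Type*} [Fintype ι] [MeasurableSpace α] {c : N → ι → N}

theorem measurable_treeSum {a : N → α → ℝ≥0∞} (ha : ∀ q, Measurable (a q)) (n : ℕ) (q : N) :
    Measurable fun z => treeSum c (fun q => a q z) n q := by
  induction n generalizing q with
  | zero => simp [treeSum]
  | succ n ih => exact (ha q).add (Finset.measurable_sum _ fun i _ => ih _)

theorem lintegral_treeSum {μ : Measure α} {a : N → α → ℝ≥0∞} (ha : ∀ q, Measurable (a q))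
    (n : ℕ) (q : N) :
    ∫⁻ z, treeSum c (fun q => a q z) n q ∂μ = treeSum c (fun q => ∫⁻ z, a q z ∂μ) n q := by
  induction n generalizing q with
  | zero => simp [treeSum]
  | succ n ih =>
    simp only [treeSum]
    rw [lintegral_add_left (ha q),
      lintegral_finsetSum _ fun i _ => measurable_treeSum ha n (c q i)]
    simp [ih]

theorem mul_treeSum (r : ℝ≥0∞) (a : N → ℝ≥0∞) (n : ℕ) (q : N) :
    r * treeSum c a n q = treeSum c (fun q => r * a q) n q :=
  treeSum_map (AddMonoidHom.mulLeft r) a n q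

end

namespace Node

theorem treeSum_eq_zero {M : Type*} [AddCommMonoid M] {a : Node → M} {x : E3}
    (h : ∀ q : Node, x ∉ q.cube → a q = 0) (n : ℕ) {q : Node} (hq : x ∉ q.cube) :
    treeSum child a n q = 0 := by
  induction n generalizing q with
  | zero => rfl
  | succ n ih =>
    simp only [treeSum, h q hq, zero_add]
    exact Finset.sum_eq_zero fun e _ => ih fun h' => hq (q.child_cube_subset e h')

theorem exists_mem_child {q : Node} {x : E3} (hx : x ∈ q.cube) :
    ∃ e, x ∈ (q.child e).cube := by
  rw [cube_eq_iUnion_child] at hx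
  exact Set.mem_iUnion.1 hx

/-- Siblings are disjoint, so a summand supported on the cubes containing x is summed along a single
branch of the tree. -/
theorem treeSum_succ_of_mem {M : Type*} [AddCommMonoid M] {a : Node → M} {x : E3}
    (h : ∀ q : Node, x ∉ q.cube → a q = 0) (n : ℕ) {q : Node} {e : Fin 3 → Fin 2}
    (hx : x ∈ (q.child e).cube) :
    treeSum child a (n + 1) q = a q + treeSum child a n (q.child e) := by
  simp only [treeSum]
  rw [Finset.sum_eq_single e]
  · intro e' _ he
    exact treeSum_eq_zero h n fun h' => Set.disjoint_left.1 (q.disjoint_child he) h' hx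
  · simp

theorem inv_side_add_inv_side (q : Node) (e : Fin 3 → Fin 2) :
    ENNReal.ofReal (q.side⁻¹) + ENNReal.ofReal (q.side⁻¹) =
      ENNReal.ofReal ((q.child e).side⁻¹) := by
  have := q.side_pos
  rw [← ENNReal.ofReal_add (by positivity) (by positivity), side_child]
  congr 1
  field_simp
  norm_num

theorem inv_side_le {q : Node} {x y : E3} (hx : x ∈ q.cube) (hy : y ∈ q.cube) :
    ENNReal.ofReal (q.side⁻¹) + ENNReal.ofReal (q.side⁻¹) ≤ 4 / ‖x - y‖ₑ := by
  have h0 := q.side_pos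
  rw [← ENNReal.ofReal_add (by positivity) (by positivity)]
  rw [ENNReal.le_div_iff_mul_le (Or.inr (by simp)) (Or.inl (by simp)), ← ofReal_norm,
    ← ENNReal.ofReal_mul (by positivity), ← ENNReal.ofReal_ofNat 4]
  refine ENNReal.ofReal_le_ofReal ?_
  have := norm_sub_le hx hy
  calc (q.side⁻¹ + q.side⁻¹) * ‖x - y‖ ≤ (q.side⁻¹ + q.side⁻¹) * (2 * q.side) := by gcongr
    _ = 4 := by field_simp; norm_num

open Classical in
/-- The dyadic model of the kernel `1 / |x - y|` is dominated by it. -/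
theorem treeSum_kernel_le (n : ℕ) {q : Node} {x y : E3} (hx : x ∈ q.cube) (hy : y ∈ q.cube) :
    treeSum child (fun q => if x ∈ q.cube ∧ y ∈ q.cube then ENNReal.ofReal q.side⁻¹ else 0) n q
      + ENNReal.ofReal q.side⁻¹ ≤ 4 / ‖x - y‖ₑ := by
  -- The extra term 1/side makes the induction close: two copies of it are exactly 1/side of a
  -- child. The recursion runs while x and y share a child; once they separate, 2/side ≤ 4/|x - y|
  -- ends it.
  induction n generalizing q with
  | zero =>
    simp only [treeSum, zero_add]
    exact le_self_add.trans (inv_side_le hx hy)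
  | succ n ih =>
    obtain ⟨e, he⟩ := exists_mem_child hx
    rw [treeSum_succ_of_mem (x := x) (fun q hq => if_neg fun h => hq h.1) n he, if_pos ⟨hx, hy⟩]
    by_cases hye : y ∈ (q.child e).cube
    · rw [add_comm (ENNReal.ofReal _), add_assoc, inv_side_add_inv_side q e]
      exact ih he hye
    · rw [treeSum_eq_zero (x := y) (fun q hq => if_neg fun h => hq h.2) n hye, add_zero]
      exact inv_side_le hx hy

open Classical in
/-- The testing condition of Kerman and Sawyer implies the dyadic Carleson condition. -/
theorem treeSum_sq_lintegral_le {w : E3 → ℝ≥0∞} (hw : Measurable w) {K : ℝ≥0∞}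
    (hK : ∀ q : Node, ∫⁻ x in q.cube, ∫⁻ y in q.cube, w x * w y / ‖x - y‖ₑ ≤
      K * ∫⁻ x in q.cube, w x) (n : ℕ) (q : Node) :
    treeSum child (fun q => ENNReal.ofReal q.side⁻¹ * (∫⁻ x in q.cube, w x) ^ 2) n q ≤
      4 * K * ∫⁻ x in q.cube, w x := by
  -- Squares of integrals become double integrals, so the tree sum is one double integral of w(x)
  -- w(y) against the dyadic kernel.
  set a : Node → E3 × E3 → ℝ≥0∞ := fun q z =>
    if z.1 ∈ q.cube ∧ z.2 ∈ q.cube then ENNReal.ofReal q.side⁻¹ else 0 with ha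
  have haw : ∀ q z, w z.1 * w z.2 * a q z =
      (q.cube.indicator w z.1 * q.cube.indicator w z.2) * ENNReal.ofReal q.side⁻¹ := by
    intro q z
    simp only [ha]
    by_cases h1 : z.1 ∈ q.cube <;> by_cases h2 : z.2 ∈ q.cube <;> simp [h1, h2]
  have hiw : ∀ q : Node, Measurable (q.cube.indicator w) := fun q =>
    hw.indicator q.measurableSet_cube
  have hm : ∀ q, Measurable fun z : E3 × E3 => w z.1 * w z.2 * a q z := fun q => by
    simp only [haw]
    have := hiw q
    fun_prop
  have hint : ∀ q : Node, ENNReal.ofReal q.side⁻¹ * (∫⁻ x in q.cube, w x) ^ 2 =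
      ∫⁻ z, w z.1 * w z.2 * a q z ∂((volume : Measure E3).prod volume) := by
    intro q
    simp only [haw]
    rw [lintegral_mul_const, lintegral_prod_mul (hiw q).aemeasurable (hiw q).aemeasurable,
      lintegral_indicator q.measurableSet_cube]
    · ring
    · have := hiw q
      fun_prop
  simp only [hint]
  rw [← lintegral_treeSum hm]
  have hk : Measurable fun z : E3 × E3 => w z.1 * w z.2 / ‖z.1 - z.2‖ₑ := by fun_prop
  have hS : MeasurableSet (q.cube ×ˢ q.cube) := q.measurableSet_cube.prod q.measurableSet_cube
  calc ∫⁻ z, treeSum child (fun q => w z.1 * w z.2 * a q z) n q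
          ∂((volume : Measure E3).prod volume)
      ≤ ∫⁻ z, (q.cube ×ˢ q.cube).indicator
          (fun z => 4 * (w z.1 * w z.2 / ‖z.1 - z.2‖ₑ)) z
          ∂((volume : Measure E3).prod volume) := by
        refine lintegral_mono fun z => ?_
        simp only
        rw [← mul_treeSum]
        by_cases hz : z ∈ q.cube ×ˢ q.cube
        · rw [Set.indicator_of_mem hz, mul_div_assoc', mul_comm 4, mul_div_assoc]
          gcongr
          exact le_self_add.trans (treeSum_kernel_le n hz.1 hz.2)
        · rw [Set.indicator_of_notMem hz]
          by_cases h1 : z.1 ∈ q.cube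
          · have h2 : z.2 ∉ q.cube := fun h2 => hz ⟨h1, h2⟩
            rw [treeSum_eq_zero (x := z.2) (fun q hq => if_neg fun h => hq h.2) n h2, mul_zero]
          · rw [treeSum_eq_zero (x := z.1) (fun q hq => if_neg fun h => hq h.1) n h1, mul_zero]
    _ = 4 * ∫⁻ x in q.cube, ∫⁻ y in q.cube, w x * w y / ‖x - y‖ₑ := by
        rw [lintegral_indicator hS, lintegral_const_mul _ hk, ← Measure.prod_restrict,
          lintegral_prod _ hk.aemeasurable]
    _ ≤ 4 * K * ∫⁻ x in q.cube, w x := by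
        rw [mul_assoc]
        gcongr
        exact hK q

end Node

end PeriodicSchrodinger

/-! ### The L¹ Poincaré inequality and telescoping of dyadic means. -/

namespace PeriodicSchrodinger

theorem lintegral_comp_smul_add (g : E3 → ℝ≥0∞) {r : ℝ} (hr : 0 < r) (v : E3) :
    ∫⁻ y, g (r • y + v) = ENNReal.ofReal ((r ^ 3)⁻¹) * ∫⁻ y, g y := by
  have h1 : ∫⁻ y, g (r • y + v) = ∫⁻ y, (fun z => g (z + v)) y
      ∂(Measure.map (fun y : E3 => r • y) volume) := by
    have := (Homeomorph.smul (Units.mk0 r hr.ne') : E3 ≃ₜ E3).toMeasurableEquiv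
    exact (lintegral_map_equiv (fun z => g (z + v))
      (Homeomorph.smul (Units.mk0 r hr.ne') : E3 ≃ₜ E3).toMeasurableEquiv).symm
  rw [h1, Measure.map_addHaar_smul _ hr.ne', lintegral_smul_measure,
    lintegral_add_right_eq_self]
  simp [abs_of_pos hr]

/-- The averaged values of `g` on the segments with one end in a convex set. -/
theorem setLIntegral_segment_le {C : Set E3} (hC : MeasurableSet C) (hconv : Convex ℝ C)
    (g : E3 → ℝ≥0∞) {t : ℝ} (h0 : 0 ≤ t) (h1 : t ≤ 1 / 2) :
    ∫⁻ x in C, ∫⁻ y in C, g (y + t • (x - y)) ≤ 8 * volume C * ∫⁻ z in C, g z := by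
  -- For fixed x the map y ↦ (1 - t) y + t x sends C into C and has Jacobian (1 - t)³ ≥ 1/8.
  have key : ∀ x ∈ C, ∫⁻ y in C, g (y + t • (x - y)) ≤ 8 * ∫⁻ z in C, g z := by
    intro x hx
    have e : ∀ y, y + t • (x - y) = (1 - t) • y + t • x := fun y => by module
    calc ∫⁻ y in C, g (y + t • (x - y))
        ≤ ∫⁻ y, C.indicator g ((1 - t) • y + t • x) := by
          rw [← lintegral_indicator hC]
          refine lintegral_mono fun y => ?_
          by_cases hy : y ∈ C
          · have : (1 - t) • y + t • x ∈ C := hconv hy hx (by linarith) h0 (by ring)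
            simp [hy, this, e]
          · simp [hy]
      _ = ENNReal.ofReal (((1 - t) ^ 3)⁻¹) * ∫⁻ z in C, g z := by
          rw [lintegral_comp_smul_add _ (by linarith), lintegral_indicator hC]
      _ ≤ 8 * ∫⁻ z in C, g z := by
          gcongr
          rw [← ENNReal.ofReal_ofNat 8]
          refine ENNReal.ofReal_le_ofReal ?_
          rw [inv_le_comm₀ (by have : 0 < 1 - t := by linarith
                               positivity) (by norm_num)]
          calc (8 : ℝ)⁻¹ = (1 / 2) ^ 3 := by norm_num
            _ ≤ (1 - t) ^ 3 := by gcongr; linarith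
  calc ∫⁻ x in C, ∫⁻ y in C, g (y + t • (x - y)) ≤ ∫⁻ _ in C, 8 * ∫⁻ z in C, g z :=
        setLIntegral_mono' hC key
    _ = _ := by rw [setLIntegral_const]; ring

/-- For t > 1/2 the Jacobian in y degenerates, so the two endpoints exchange roles. -/
theorem setLIntegral_segment_le' {C : Set E3} (hC : MeasurableSet C) (hconv : Convex ℝ C)
    {g : E3 → ℝ≥0∞} (hg : Measurable g) {t : ℝ} (h0 : 0 ≤ t) (h1 : t ≤ 1) :
    ∫⁻ x in C, ∫⁻ y in C, g (y + t • (x - y)) ≤ 8 * volume C * ∫⁻ z in C, g z := by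
  rcases le_total t (1 / 2) with h | h
  · exact setLIntegral_segment_le hC hconv g h0 h
  · rw [lintegral_lintegral_swap (Measurable.aemeasurable (by
      simp only [Function.uncurry_def]; fun_prop))]
    have e : ∀ x y : E3, y + t • (x - y) = x + (1 - t) • (y - x) := fun x y => by module
    simp only [e]
    exact setLIntegral_segment_le hC hconv g (by linarith) (by linarith)

theorem enorm_sub_le_lintegral_fderiv {f : E3 → ℂ} (hf : ContDiff ℝ 1 f) (x y : E3) :
    ‖f x - f y‖ₑ ≤ ‖x - y‖ₑ * ∫⁻ t in Set.Icc (0 : ℝ) 1, ‖fderiv ℝ f (y + t • (x - y))‖ₑ := by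
  have hd : ∀ t : ℝ, HasDerivAt (fun t : ℝ => f (y + t • (x - y)))
      (fderiv ℝ f (y + t • (x - y)) (x - y)) t := fun t => by
    have h1 : HasDerivAt (fun t : ℝ => y + t • (x - y)) (x - y) t := by
      simpa using ((hasDerivAt_id t).smul_const (x - y)).const_add y
    exact ((hf.differentiable (by norm_num)) _).hasFDerivAt.comp_hasDerivAt t h1
  have hc : Continuous fun z => fderiv ℝ f z := hf.continuous_fderiv (by norm_num)
  have hcont : Continuous fun t : ℝ => fderiv ℝ f (y + t • (x - y)) (x - y) := by fun_prop
  have h := intervalIntegral.integral_eq_sub_of_hasDerivAt (fun t _ => hd t)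
    (hcont.intervalIntegrable 0 1)
  simp only [one_smul, zero_smul, add_zero, add_sub_cancel] at h
  rw [← h, intervalIntegral.integral_of_le zero_le_one, ← integral_Icc_eq_integral_Ioc]
  refine (enorm_integral_le_lintegral_enorm _).trans ?_
  rw [← lintegral_const_mul _ (by fun_prop)]
  refine lintegral_mono fun t => ?_
  rw [mul_comm]
  exact ContinuousLinearMap.le_opENorm _ _

theorem lintegral_lintegral_segment_le {C : Set E3} (hC : MeasurableSet C) (hconv : Convex ℝ C)
    {g : E3 → ℝ≥0∞} (hg : Measurable g) :
    ∫⁻ x in C, ∫⁻ y in C, ∫⁻ t in Set.Icc (0 : ℝ) 1, g (y + t • (x - y)) ≤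
      8 * volume C * ∫⁻ z in C, g z := by
  have e1 : ∀ x : E3, ∫⁻ y in C, ∫⁻ t in Set.Icc (0 : ℝ) 1, g (y + t • (x - y)) =
      ∫⁻ t in Set.Icc (0 : ℝ) 1, ∫⁻ y in C, g (y + t • (x - y)) := fun x =>
    lintegral_lintegral_swap
      (Measurable.aemeasurable (by simp only [Function.uncurry_def]; fun_prop))
  have h3 : Measurable fun p : (E3 × ℝ) × E3 => g (p.2 + p.1.2 • (p.1.1 - p.2)) := by
    fun_prop
  simp only [e1]
  rw [lintegral_lintegral_swap (h3.lintegral_prod_right'.aemeasurable)]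
  calc ∫⁻ t in Set.Icc (0 : ℝ) 1, ∫⁻ x in C, ∫⁻ y in C, g (y + t • (x - y))
      ≤ ∫⁻ t in Set.Icc (0 : ℝ) 1, 8 * volume C * ∫⁻ z in C, g z :=
        setLIntegral_mono' measurableSet_Icc fun t ht =>
          setLIntegral_segment_le' hC hconv hg ht.1 ht.2
    _ = _ := by rw [setLIntegral_const]; simp

/-- The Poincaré inequality on a bounded convex set, in `L¹`. -/
theorem lintegral_enorm_sub_le {C : Set E3} (hC : MeasurableSet C) (hconv : Convex ℝ C)
    {d : ℝ≥0∞} (hdt : d ≠ ⊤) (hd : ∀ x ∈ C, ∀ y ∈ C, ‖x - y‖ₑ ≤ d) {f : E3 → ℂ}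
    (hf : ContDiff ℝ 1 f) :
    ∫⁻ x in C, ∫⁻ y in C, ‖f x - f y‖ₑ ≤
      d * (8 * volume C * ∫⁻ z in C, ‖fderiv ℝ f z‖ₑ) := by
  have hc : Continuous fun z => fderiv ℝ f z := hf.continuous_fderiv (by norm_num)
  have hg : Measurable fun z => ‖fderiv ℝ f z‖ₑ := hc.enorm.measurable
  calc ∫⁻ x in C, ∫⁻ y in C, ‖f x - f y‖ₑ
      ≤ ∫⁻ x in C, ∫⁻ y in C, d * ∫⁻ t in Set.Icc (0 : ℝ) 1,
          ‖fderiv ℝ f (y + t • (x - y))‖ₑ := by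
        refine setLIntegral_mono' hC fun x hx => setLIntegral_mono' hC fun y hy => ?_
        refine (enorm_sub_le_lintegral_fderiv hf x y).trans ?_
        gcongr
        exact hd x hx y hy
    _ = d * ∫⁻ x in C, ∫⁻ y in C, ∫⁻ t in Set.Icc (0 : ℝ) 1,
          ‖fderiv ℝ f (y + t • (x - y))‖ₑ := by
        simp only [lintegral_const_mul' _ _ hdt]
    _ ≤ _ := by
        gcongr
        exact lintegral_lintegral_segment_le hC hconv hg

/-- The difference of two means is the mean of f x - f y under the product measure. -/
theorem enorm_integral_sub_integral_le {ν ν' : Measure E3} [IsProbabilityMeasure ν]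
    [IsProbabilityMeasure ν'] {f : E3 → ℂ} (h : Integrable f ν) (h' : Integrable f ν') :
    ‖(∫ x, f x ∂ν) - ∫ x, f x ∂ν'‖ₑ ≤ ∫⁻ x, ∫⁻ y, ‖f x - f y‖ₑ ∂ν' ∂ν := by
  have e : (∫ x, f x ∂ν) - ∫ x, f x ∂ν' = ∫ x, ∫ y, (f x - f y) ∂ν' ∂ν := by
    have : ∀ x, ∫ y, (f x - f y) ∂ν' = f x - ∫ y, f y ∂ν' := fun x => by
      rw [integral_sub (integrable_const _) h']; simp
    simp only [this]
    rw [integral_sub h (integrable_const _)]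
    simp
  rw [e]
  refine (enorm_integral_le_lintegral_enorm _).trans (lintegral_mono fun x => ?_)
  exact enorm_integral_le_lintegral_enorm _

namespace Node

/-- The mean value of `f` over the cube of a node. -/
noncomputable def mean (q : Node) (f : E3 → ℂ) : ℂ :=
  ∫ x, f x ∂(ProbabilityTheory.cond volume q.cube)

theorem volume_cube_ne_zero (q : Node) : volume q.cube ≠ 0 := by
  rw [volume_cube]; simpa using pow_pos q.side_pos 3

theorem volume_cube_ne_top (q : Node) : volume q.cube ≠ ⊤ := by
  rw [volume_cube]; simp

instance (q : Node) : IsProbabilityMeasure (ProbabilityTheory.cond volume q.cube) :=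
  ProbabilityTheory.cond_isProbabilityMeasure_of_finite q.volume_cube_ne_zero q.volume_cube_ne_top

theorem lintegral_cond (q : Node) (f : E3 → ℝ≥0∞) :
    ∫⁻ x, f x ∂(ProbabilityTheory.cond volume q.cube) =
      (volume q.cube)⁻¹ * ∫⁻ x in q.cube, f x := by
  rw [ProbabilityTheory.cond, lintegral_smul_measure, smul_eq_mul]

theorem integrable_cond (q : Node) {f : E3 → ℂ} (hf : Continuous f) :
    Integrable f (ProbabilityTheory.cond volume q.cube) := by
  refine Integrable.smul_measure ?_ (ENNReal.inv_ne_top.2 q.volume_cube_ne_zero)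
  exact (hf.locallyIntegrable.integrableOn_isCompact
    q.isBounded_cube.isCompact_closure).mono_set subset_closure

/-- Poincaré on the parent, after enlarging the child to the parent in the outer integral. In 128 =
8 · 8 · 2 the factors come from the ratio of volumes, the segment averages and the diameter bound 2
· side. -/
theorem enorm_mean_child_sub_mean_le {f : E3 → ℂ} (hf : ContDiff ℝ 1 f) (q : Node)
    (e : Fin 3 → Fin 2) :
    ‖(q.child e).mean f - q.mean f‖ₑ ≤
      128 * (ENNReal.ofReal (q.side ^ 2)⁻¹ * ∫⁻ x in q.cube, ‖fderiv ℝ f x‖ₑ) := by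
  have hs := q.side_pos
  refine (enorm_integral_sub_integral_le (integrable_cond _ hf.continuous)
    (integrable_cond _ hf.continuous)).trans ?_
  simp only [lintegral_cond]
  have hd : ∀ x ∈ q.cube, ∀ y ∈ q.cube, ‖x - y‖ₑ ≤ ENNReal.ofReal (2 * q.side) :=
    fun x hx y hy => by
      rw [← ofReal_norm]; exact ENNReal.ofReal_le_ofReal (norm_sub_le hx hy)
  have hP := lintegral_enorm_sub_le q.measurableSet_cube q.convex_cube ENNReal.ofReal_ne_top hd hf
  calc (volume (q.child e).cube)⁻¹ * ∫⁻ x in (q.child e).cube,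
        (volume q.cube)⁻¹ * ∫⁻ y in q.cube, ‖f x - f y‖ₑ
      ≤ (volume (q.child e).cube)⁻¹ * ∫⁻ x in q.cube,
        (volume q.cube)⁻¹ * ∫⁻ y in q.cube, ‖f x - f y‖ₑ := by
        gcongr
        exact q.child_cube_subset e
    _ = (volume (q.child e).cube)⁻¹ * ((volume q.cube)⁻¹ *
          ∫⁻ x in q.cube, ∫⁻ y in q.cube, ‖f x - f y‖ₑ) := by
        rw [lintegral_const_mul' _ _ (ENNReal.inv_ne_top.2 q.volume_cube_ne_zero)]
    _ ≤ (volume (q.child e).cube)⁻¹ * ((volume q.cube)⁻¹ *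
          (ENNReal.ofReal (2 * q.side) * (8 * volume q.cube *
            ∫⁻ x in q.cube, ‖fderiv ℝ f x‖ₑ))) := by gcongr
    _ = 128 * (ENNReal.ofReal (q.side ^ 2)⁻¹ * ∫⁻ x in q.cube, ‖fderiv ℝ f x‖ₑ) := by
        rw [← mul_assoc 128, ← mul_assoc, ← mul_assoc, ← mul_assoc, ← mul_assoc]
        congr 1
        rw [volume_cube, volume_cube, side_child, ← ENNReal.ofReal_inv_of_pos (by positivity),
          ← ENNReal.ofReal_inv_of_pos (by positivity), ← ENNReal.ofReal_ofNat 8,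
          ← ENNReal.ofReal_ofNat 128]
        rw [← ENNReal.ofReal_mul (by positivity), ← ENNReal.ofReal_mul (by positivity),
          ← ENNReal.ofReal_mul (by positivity), ← ENNReal.ofReal_mul (by positivity),
          ← ENNReal.ofReal_mul (by positivity)]
        congr 1
        field_simp
        norm_num

open Classical in
/-- Telescoping of the dyadic mean values along the cubes that contain `x`. -/
theorem enorm_mean_sub_le {f : E3 → ℂ} (hf : ContDiff ℝ 1 f) {L : ℝ} (n : ℕ) {q : Node}
    (hL : ∀ y ∈ q.cube, ‖fderiv ℝ f y‖ ≤ L) {x : E3} (hx : x ∈ q.cube) :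
    ‖q.mean f - f x‖ₑ ≤ 128 * treeSum child (fun q => if x ∈ q.cube then
        ENNReal.ofReal (q.side ^ 2)⁻¹ * ∫⁻ x in q.cube, ‖fderiv ℝ f x‖ₑ else 0) n q
      + ENNReal.ofReal (2 * L * q.side / 2 ^ n) := by
  -- After n generations the remainder is the oscillation of f on a cube of side `q.side / 2 ^ n`,
  -- bounded by L times its diameter.
  induction n generalizing q with
  | zero =>
    simp only [treeSum, mul_zero, zero_add, pow_zero, div_one]
    have e : f x = ∫ _, f x ∂(ProbabilityTheory.cond volume q.cube) := by simp
    rw [mean, e, ← integral_sub (integrable_cond _ hf.continuous) (integrable_const _)]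
    refine (enorm_integral_le_lintegral_enorm _).trans ?_
    have hL0 : 0 ≤ L := (norm_nonneg _).trans (hL x hx)
    have hle : ∀ y ∈ q.cube, ‖f y - f x‖ₑ ≤ ENNReal.ofReal (2 * L * q.side) := fun y hy => by
      rw [← ofReal_norm]
      refine ENNReal.ofReal_le_ofReal ?_
      have := q.convex_cube.norm_image_sub_le_of_norm_fderiv_le
        (fun z _ => (hf.differentiable (by norm_num)) z) hL hx hy
      calc ‖f y - f x‖ ≤ L * ‖y - x‖ := this
        _ ≤ L * (2 * q.side) := by gcongr; exact norm_sub_le hy hx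
        _ = 2 * L * q.side := by ring
    rw [lintegral_cond]
    calc (volume q.cube)⁻¹ * ∫⁻ y in q.cube, ‖f y - f x‖ₑ
        ≤ (volume q.cube)⁻¹ * ∫⁻ y in q.cube, ENNReal.ofReal (2 * L * q.side) := by
          gcongr 1
          exact setLIntegral_mono' q.measurableSet_cube hle
      _ = ENNReal.ofReal (2 * L * q.side) := by
          rw [setLIntegral_const, ← mul_assoc, mul_comm _ (volume q.cube), ← mul_assoc,
            ENNReal.mul_inv_cancel q.volume_cube_ne_zero q.volume_cube_ne_top, one_mul]
  | succ n ih =>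
    obtain ⟨e, he⟩ := exists_mem_child hx
    rw [treeSum_succ_of_mem (x := x) (fun q hq => if_neg hq) n he, if_pos hx, mul_add]
    have h1 := ih (fun y hy => hL y (q.child_cube_subset e hy)) he
    have h2 := enorm_mean_child_sub_mean_le hf q e
    have e1 : 2 * L * (q.child e).side / 2 ^ n = 2 * L * q.side / 2 ^ (n + 1) := by
      rw [side_child, pow_succ]; field_simp
    rw [e1] at h1
    calc ‖q.mean f - f x‖ₑ
        = ‖(q.mean f - (q.child e).mean f) + ((q.child e).mean f - f x)‖ₑ := by congr 1; ring
      _ ≤ ‖q.mean f - (q.child e).mean f‖ₑ + ‖(q.child e).mean f - f x‖ₑ := enorm_add_le _ _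
      _ ≤ _ := by
          rw [← enorm_neg, neg_sub, add_assoc]
          exact add_le_add h2 h1

end Node

end PeriodicSchrodinger

/-! ### The trace inequality on a dyadic cube. -/

namespace PeriodicSchrodinger

theorem sq_lintegral_mul_le {α : Type*} [MeasurableSpace α] {μ : Measure α} {f g : α → ℝ≥0∞}
    (hf : AEMeasurable f μ) (hg : AEMeasurable g μ) :
    (∫⁻ x, f x * g x ∂μ) ^ 2 ≤ (∫⁻ x, f x ^ 2 ∂μ) * ∫⁻ x, g x ^ 2 ∂μ := by
  have h := ENNReal.lintegral_mul_le_Lp_mul_Lq μ (Real.HolderConjugate.two_two) hf hg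
  calc (∫⁻ x, f x * g x ∂μ) ^ 2 ≤ ((∫⁻ x, f x ^ (2 : ℝ) ∂μ) ^ (1 / 2 : ℝ) *
        (∫⁻ x, g x ^ (2 : ℝ) ∂μ) ^ (1 / 2 : ℝ)) ^ 2 := by gcongr; exact h
    _ = _ := by
      rw [mul_pow, ← ENNReal.rpow_natCast, ← ENNReal.rpow_natCast, ← ENNReal.rpow_mul,
        ← ENNReal.rpow_mul]
      norm_num

theorem ENNReal_add_sq_le (a b : ℝ≥0∞) : (a + b) ^ 2 ≤ 4 * (a ^ 2 + b ^ 2) := by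
  rcases le_total a b with h | h
  · calc (a + b) ^ 2 ≤ (b + b) ^ 2 := by gcongr
      _ = 4 * b ^ 2 := by ring
      _ ≤ _ := by gcongr; exact le_add_self
  · calc (a + b) ^ 2 ≤ (a + a) ^ 2 := by gcongr
      _ = 4 * a ^ 2 := by ring
      _ ≤ _ := by gcongr; exact le_self_add

namespace Node

/-- Carleson embedding for the dyadic cubes and a measure. -/
theorem treeSum_sq_setLIntegral_le {ν : Measure E3} {C : ℝ} (hC : 0 < C)
    (hν : ∀ q : Node, ν q.cube ≠ ⊤)
    (car : ∀ n (q : Node), treeSum child (fun q => ENNReal.ofReal q.side⁻¹ * ν q.cube ^ 2) n q ≤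
      ENNReal.ofReal C * ν q.cube)
    {h : E3 → ℝ≥0∞} (hm : Measurable h) (hF : ∀ q : Node, ∫⁻ x in q.cube, h x ^ 2 ∂ν ≠ ⊤)
    (n : ℕ) (q : Node) :
    treeSum child (fun q => ENNReal.ofReal q.side⁻¹ * (∫⁻ x in q.cube, h x ∂ν) ^ 2) n q ≤
      ENNReal.ofReal (4 * C) * ∫⁻ x in q.cube, h x ^ 2 ∂ν := by
  have cs : ∀ q : Node, (∫⁻ x in q.cube, h x ∂ν) ^ 2 ≤
      (∫⁻ x in q.cube, h x ^ 2 ∂ν) * ν q.cube := fun q => by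
    simpa using sq_lintegral_mul_le (μ := ν.restrict q.cube) hm.aemeasurable
      (aemeasurable_const (b := (1 : ℝ≥0∞)))
  have hX : ∀ q : Node, ∫⁻ x in q.cube, h x ∂ν ≠ ⊤ := fun q hq => by
    have := cs q
    rw [hq] at this
    exact ENNReal.mul_ne_top (hF q) (hν q) (top_le_iff.1 (by simpa using this))
  have addi : ∀ (f : E3 → ℝ≥0∞) (q : Node), ∫⁻ x in q.cube, f x ∂ν =
      ∑ e, ∫⁻ x in (q.child e).cube, f x ∂ν := fun f q => by
    rw [cube_eq_iUnion_child q, lintegral_iUnion (fun e => measurableSet_cube _) q.disjoint_child,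
      tsum_fintype]
  have addν : ∀ q : Node, ν q.cube = ∑ e, ν (q.child e).cube := fun q => by
    simpa using addi (fun _ => 1) q
  -- Dividing the weights by C normalizes the Carleson constant to 1, as the real-valued embedding
  -- on the tree requires; `conv` translates between the two forms.
  have hb : ∀ q : Node, 0 ≤ (C * q.side)⁻¹ := fun q => by
    have := q.side_pos; positivity
  have conv : ∀ (Y : Node → ℝ≥0∞), (∀ q, Y q ≠ ⊤) → ∀ n q,
      treeSum child (fun q => ENNReal.ofReal q.side⁻¹ * Y q ^ 2) n q = ENNReal.ofReal
        (C * treeSum child (fun q => (C * q.side)⁻¹ * (Y q).toReal ^ 2) n q) := by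
    intro Y hY n q
    rw [ENNReal.ofReal_mul hC.le, ofReal_treeSum (fun q => mul_nonneg (hb q) (sq_nonneg _)),
      mul_treeSum]
    congr 1
    funext q
    have := q.side_pos
    rw [← ENNReal.ofReal_mul hC.le, ← mul_assoc, ENNReal.ofReal_mul (by positivity),
      ENNReal.ofReal_pow ENNReal.toReal_nonneg, ENNReal.ofReal_toReal (hY q)]
    congr 2
    field_simp
  have main := treeSum_carleson (c := child) (w := fun q => (ν q.cube).toReal)
    (x := fun q => (∫⁻ x in q.cube, h x ∂ν).toReal)
    (F := fun q => (∫⁻ x in q.cube, h x ^ 2 ∂ν).toReal) hb (fun q => ENNReal.toReal_nonneg)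
    (fun q => by rw [addν q, ENNReal.toReal_sum fun e _ => hν _])
    (fun q => by rw [addi h q, ENNReal.toReal_sum fun e _ => hX _])
    (fun q => by rw [addi (fun x => h x ^ 2) q, ENNReal.toReal_sum fun e _ => hF _])
    (fun q => by
      rw [← ENNReal.toReal_pow, ← ENNReal.toReal_mul]
      exact ENNReal.toReal_mono (ENNReal.mul_ne_top (hF q) (hν q)) (cs q))
    (fun q => ENNReal.toReal_nonneg)
    (fun n q => by
      have := car n q
      rw [conv _ hν, ← ENNReal.ofReal_toReal (hν q), ← ENNReal.ofReal_mul hC.le,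
        ENNReal.ofReal_le_ofReal_iff (mul_nonneg hC.le ENNReal.toReal_nonneg)] at this
      exact le_of_mul_le_mul_left (by simpa using this) hC) n q
  rw [conv _ hX, ← ENNReal.ofReal_toReal (hF q), ← ENNReal.ofReal_mul (by positivity)]
  refine ENNReal.ofReal_le_ofReal ?_
  nlinarith [mul_le_mul_of_nonneg_left main hC.le]

section

variable {X : Node → ℝ≥0∞}

open Classical in
theorem measurable_ite_mem (r : ℝ≥0∞) (q : Node) :
    Measurable fun y : E3 => if y ∈ q.cube then r else 0 :=
  Measurable.ite q.measurableSet_cube measurable_const measurable_const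

open Classical in
theorem lintegral_ite_mem (ν : Measure E3) (r : ℝ≥0∞) (q : Node) :
    ∫⁻ y : E3, (if y ∈ q.cube then r else 0) ∂ν = r * ν q.cube := by
  have : (fun y : E3 => if y ∈ q.cube then r else 0) = q.cube.indicator fun _ => r := by
    ext y; simp [Set.indicator]
  rw [this, lintegral_indicator q.measurableSet_cube, setLIntegral_const]

theorem ofReal_inv_sq_mul (q : Node) :
    ENNReal.ofReal (q.side ^ 2)⁻¹ * ENNReal.ofReal q.side = ENNReal.ofReal q.side⁻¹ := by
  have := q.side_pos
  rw [← ENNReal.ofReal_mul (by positivity)]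
  congr 1
  field_simp

/-- The masses of the children add up to that of the parent while the side halves, so the
generations form a geometric series of ratio 1/2. -/
theorem treeSum_side_mul_le (hX : ∀ q : Node, X q = ∑ e, X (q.child e)) (n : ℕ) (q : Node) :
    treeSum child (fun q => ENNReal.ofReal q.side * X q) n q ≤
      2 * (ENNReal.ofReal q.side * X q) := by
  induction n generalizing q with
  | zero => simp [treeSum]
  | succ n ih =>
    simp only [treeSum]
    calc ENNReal.ofReal q.side * X q + ∑ e, treeSum child _ n (q.child e)
        ≤ ENNReal.ofReal q.side * X q + ∑ e, 2 * (ENNReal.ofReal (q.side / 2) * X (q.child e)) := by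
          gcongr with e
          rw [← side_child q e]
          exact ih _
      _ = 2 * (ENNReal.ofReal q.side * X q) := by
          have : 2 * ENNReal.ofReal (q.side / 2) = ENNReal.ofReal q.side := by
            rw [← ENNReal.ofReal_ofNat 2, ← ENNReal.ofReal_mul (by norm_num)]
            congr 1; ring
          simp only [← mul_assoc, this]
          rw [← Finset.mul_sum, ← hX q]
          ring

open Classical in
theorem lintegral_treeSum_inv_sq_le (hX : ∀ q : Node, X q = ∑ e, X (q.child e)) (n : ℕ)
    (q : Node) :
    ∫⁻ y, treeSum child (fun q => if y ∈ q.cube then ENNReal.ofReal (q.side ^ 2)⁻¹ * X q else 0)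
      n q ≤ 2 * (ENNReal.ofReal q.side * X q) := by
  rw [lintegral_treeSum (fun q => measurable_ite_mem _ q)]
  refine le_trans (le_of_eq ?_) (treeSum_side_mul_le hX n q)
  congr 1
  funext q
  have := q.side_pos
  rw [lintegral_ite_mem, volume_cube, mul_right_comm, ← ENNReal.ofReal_mul (by positivity)]
  congr 2
  field_simp

open Classical in
-- A dyadic Wolff inequality for the Riesz potential of order one. Write the potential as A + R,
-- with A from the top cube. Then ∫A² = X²/side, and 2A∫R ≤ 2X²/side by the bound on the first
-- moment in each child. At every point at most one child contributes to R, so R² is the sum of the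
-- squares over the children, handled by induction.
theorem lintegral_sq_treeSum_le (hX : ∀ q : Node, X q = ∑ e, X (q.child e)) (n : ℕ)
    (q : Node) :
    ∫⁻ y, treeSum child (fun q => if y ∈ q.cube then ENNReal.ofReal (q.side ^ 2)⁻¹ * X q else 0)
      n q ^ 2 ≤ 3 * treeSum child (fun q => ENNReal.ofReal q.side⁻¹ * X q ^ 2) n q := by
  induction n generalizing q with
  | zero => simp [treeSum]
  | succ n ih =>
    set a : E3 → Node → ℝ≥0∞ := fun y q =>
      if y ∈ q.cube then ENNReal.ofReal (q.side ^ 2)⁻¹ * X q else 0 with ha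
    have hm : ∀ q, Measurable fun y => treeSum child (a y) n q :=
      measurable_treeSum (fun q => measurable_ite_mem _ q) n
    set A := ENNReal.ofReal (q.side ^ 2)⁻¹ * X q with hA
    have hR2 : ∀ y, (∑ e, treeSum child (a y) n (q.child e)) ^ 2 =
        ∑ e, treeSum child (a y) n (q.child e) ^ 2 := by
      intro y
      by_cases hy : y ∈ q.cube
      · obtain ⟨e, he⟩ := exists_mem_child hy
        have h0 : ∀ e' ≠ e, treeSum child (a y) n (q.child e') = 0 := fun e' he' =>
          treeSum_eq_zero (x := y) (fun q hq => if_neg hq) n fun h' =>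
            Set.disjoint_left.1 (q.disjoint_child he') h' he
        rw [Finset.sum_eq_single e (fun e' _ h => h0 e' h) (by simp),
          Finset.sum_eq_single e (fun e' _ h => by rw [h0 e' h]; simp) (by simp)]
      · have h0 : ∀ e, treeSum child (a y) n (q.child e) = 0 := fun e =>
          treeSum_eq_zero (x := y) (fun q hq => if_neg hq) n fun h' =>
            hy (q.child_cube_subset e h')
        simp [h0]
    have hpt : ∀ y, treeSum child (a y) (n + 1) q ^ 2 ≤
        (if y ∈ q.cube then A ^ 2 else 0) + (2 * A * ∑ e, treeSum child (a y) n (q.child e) +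
          ∑ e, treeSum child (a y) n (q.child e) ^ 2) := by
      intro y
      rw [← hR2]
      simp only [treeSum]
      by_cases hy : y ∈ q.cube
      · simp only [ha, if_pos hy]
        rw [← hA]
        exact le_of_eq (by ring)
      · simp only [ha, if_neg hy, zero_add]
        exact le_add_self
    calc ∫⁻ y, treeSum child (a y) (n + 1) q ^ 2
        ≤ ∫⁻ y, ((if y ∈ q.cube then A ^ 2 else 0) +
          (2 * A * ∑ e, treeSum child (a y) n (q.child e) +
          ∑ e, treeSum child (a y) n (q.child e) ^ 2)) := lintegral_mono hpt
      _ = A ^ 2 * volume q.cube + (2 * A * (∑ e, ∫⁻ y, treeSum child (a y) n (q.child e)) +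
            ∑ e, ∫⁻ y, treeSum child (a y) n (q.child e) ^ 2) := by
          rw [lintegral_add_left (measurable_ite_mem (A ^ 2) q), lintegral_ite_mem,
            lintegral_add_left ((Finset.measurable_sum _ fun e _ => hm _).const_mul _),
            lintegral_const_mul _ (Finset.measurable_sum _ fun e _ => hm _),
            lintegral_finsetSum _ (fun e _ => hm _),
            lintegral_finsetSum _ (fun e _ => (hm _).pow_const 2)]
      _ ≤ A ^ 2 * volume q.cube + (2 * A * ∑ e, 2 * (ENNReal.ofReal (q.side / 2) * X (q.child e)) +
            ∑ e, 3 * treeSum child (fun q => ENNReal.ofReal q.side⁻¹ * X q ^ 2) n (q.child e)) := by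
          gcongr with e he e he
          · rw [← side_child q e]
            exact lintegral_treeSum_inv_sq_le hX n (q.child e)
          · exact ih _
      _ = 3 * treeSum child (fun q => ENNReal.ofReal q.side⁻¹ * X q ^ 2) (n + 1) q := by
          have h2 : 2 * ENNReal.ofReal (q.side / 2) = ENNReal.ofReal q.side := by
            rw [← ENNReal.ofReal_ofNat 2, ← ENNReal.ofReal_mul (by norm_num)]
            congr 1; ring
          have h3 : ENNReal.ofReal (q.side ^ 2)⁻¹ ^ 2 * volume q.cube =
              ENNReal.ofReal q.side⁻¹ := by
            have := q.side_pos
            rw [volume_cube, ← ENNReal.ofReal_pow (by positivity),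
              ← ENNReal.ofReal_mul (by positivity)]
            congr 1
            field_simp
          simp only [← mul_assoc, h2, treeSum]
          rw [← Finset.mul_sum, ← Finset.mul_sum, ← hX q, hA, mul_pow, mul_right_comm, h3,
            show 2 * (ENNReal.ofReal (q.side ^ 2)⁻¹ * X q) * (ENNReal.ofReal q.side * X q) =
              2 * (ENNReal.ofReal (q.side ^ 2)⁻¹ * ENNReal.ofReal q.side) * X q ^ 2 by ring,
            ofReal_inv_sq_mul]
          ring

end

theorem enorm_mean_sq_le (q : Node) {f : E3 → ℂ} (hf : Continuous f) :
    ‖q.mean f‖ₑ ^ 2 ≤ ENNReal.ofReal (q.side ^ 3)⁻¹ * ∫⁻ x in q.cube, ‖f x‖ₑ ^ 2 := by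
  have h1 : ‖q.mean f‖ₑ ≤ ∫⁻ x, ‖f x‖ₑ ∂(ProbabilityTheory.cond volume q.cube) :=
    enorm_integral_le_lintegral_enorm _
  calc ‖q.mean f‖ₑ ^ 2 ≤ (∫⁻ x, ‖f x‖ₑ * 1 ∂(ProbabilityTheory.cond volume q.cube)) ^ 2 := by
        simp only [mul_one]; gcongr
    _ ≤ (∫⁻ x, ‖f x‖ₑ ^ 2 ∂(ProbabilityTheory.cond volume q.cube)) *
          ∫⁻ x, 1 ^ 2 ∂(ProbabilityTheory.cond volume q.cube) :=
        sq_lintegral_mul_le hf.enorm.measurable.aemeasurable aemeasurable_const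
    _ = _ := by
        rw [lintegral_cond, volume_cube, ← ENNReal.ofReal_inv_of_pos (pow_pos q.side_pos 3)]
        simp

theorem setLIntegral_enorm_sq_ne_top {ν : Measure E3} (hν : ∀ q : Node, ν q.cube ≠ ⊤)
    {f : E3 → ℂ} (hf : Continuous f) (q : Node) : ∫⁻ x in q.cube, ‖f x‖ₑ ^ 2 ∂ν ≠ ⊤ := by
  obtain ⟨B, hB⟩ := q.isBounded_cube.isCompact_closure.exists_bound_of_continuousOn
    hf.continuousOn
  have hle : ∀ x ∈ q.cube, ‖f x‖ₑ ^ 2 ≤ ENNReal.ofReal B ^ 2 := fun x hx => by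
    rw [← ofReal_norm]
    gcongr
    exact hB x (subset_closure hx)
  refine ne_top_of_le_ne_top ?_ (setLIntegral_mono' q.measurableSet_cube hle)
  rw [setLIntegral_const]
  exact ENNReal.mul_ne_top (by simp) (hν q)

open Classical in
/-- The trace inequality on a dyadic cube for a measure that satisfies the Carleson condition. -/
theorem trace_le {ν : Measure E3} {C : ℝ} (hC : 0 < C) (hν : ∀ q : Node, ν q.cube ≠ ⊤)
    (car : ∀ n (q : Node), treeSum child (fun q => ENNReal.ofReal q.side⁻¹ * ν q.cube ^ 2) n q ≤
      ENNReal.ofReal C * ν q.cube)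
    {f : E3 → ℂ} (hf : ContDiff ℝ 1 f) {q : Node} (hq : 1 ≤ q.side) :
    ∫⁻ x in q.cube, ‖f x‖ₑ ^ 2 ∂ν ≤ ENNReal.ofReal (786432 * C) *
      ((∫⁻ x in q.cube, ‖f x‖ₑ ^ 2) + ∫⁻ x in q.cube, ‖fderiv ℝ f x‖ₑ ^ 2) := by
  have hfc : Continuous f := hf.continuous
  have hdc : Continuous fun z => fderiv ℝ f z := hf.continuous_fderiv (by norm_num)
  have hfm : Measurable fun x => ‖f x‖ₑ := hfc.enorm.measurable
  have hdm : Measurable fun x => ‖fderiv ℝ f x‖ₑ := hdc.enorm.measurable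
  have hF := setLIntegral_enorm_sq_ne_top hν hfc
  have carl := treeSum_sq_setLIntegral_le hC hν car hfm hF
  set X : Node → ℝ≥0∞ := fun q => ∫⁻ x in q.cube, ‖f x‖ₑ ∂ν with hX
  set F := ∫⁻ x in q.cube, ‖f x‖ₑ ^ 2 ∂ν with hFdef
  set D := ∫⁻ x in q.cube, ‖fderiv ℝ f x‖ₑ ^ 2 with hD
  set S := ∫⁻ x in q.cube, ‖f x‖ₑ ^ 2 with hS
  have hXadd : ∀ q : Node, X q = ∑ e, X (q.child e) := fun q => by
    simp only [hX]
    rw [cube_eq_iUnion_child q, lintegral_iUnion (fun e => measurableSet_cube _) q.disjoint_child,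
      tsum_fintype]
  -- The one-generation case of the embedding keeps only the top cube.
  have hX2 : ENNReal.ofReal q.side⁻¹ * X q ^ 2 ≤ ENNReal.ofReal (4 * C) * F := by
    simpa [treeSum] using carl 1 q
  have hXtop : X q ≠ ⊤ := by
    intro h
    rw [h] at hX2
    have h1 : ENNReal.ofReal q.side⁻¹ ≠ 0 := by simpa using q.side_pos
    rw [ENNReal.top_pow two_ne_zero, ENNReal.mul_top h1, top_le_iff] at hX2
    exact ENNReal.mul_ne_top ENNReal.ofReal_ne_top (hF q) hX2
  set G : Node → ℝ≥0∞ := fun q => ENNReal.ofReal (q.side ^ 2)⁻¹ *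
    ∫⁻ x in q.cube, ‖fderiv ℝ f x‖ₑ with hG
  -- the pairing of the gradient with the dyadic potential
  have hT : ∀ n, treeSum child (fun q => X q * G q) n q ^ 2 ≤
      ENNReal.ofReal (12 * C) * D * F := by
    intro n
    have e1 : treeSum child (fun q => X q * G q) n q =
        ∫⁻ y in q.cube, ‖fderiv ℝ f y‖ₑ * treeSum child
          (fun q => if y ∈ q.cube then ENNReal.ofReal (q.side ^ 2)⁻¹ * X q else 0) n q := by
      have e2 : ∀ q' : Node, X q' * G q' = ∫⁻ y, ‖fderiv ℝ f y‖ₑ *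
          (if y ∈ q'.cube then ENNReal.ofReal (q'.side ^ 2)⁻¹ * X q' else 0) := by
        intro q'
        have : ∀ y, ‖fderiv ℝ f y‖ₑ *
            (if y ∈ q'.cube then ENNReal.ofReal (q'.side ^ 2)⁻¹ * X q' else 0) =
            q'.cube.indicator (fun y => ‖fderiv ℝ f y‖ₑ *
              (ENNReal.ofReal (q'.side ^ 2)⁻¹ * X q')) y := fun y => by
          by_cases hy : y ∈ q'.cube <;> simp [hy]
        simp only [this]
        rw [lintegral_indicator q'.measurableSet_cube, lintegral_mul_const _ hdm, hG]
        ring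
      simp only [e2]
      rw [← lintegral_treeSum (a := fun q' y => ‖fderiv ℝ f y‖ₑ *
          (if y ∈ q'.cube then ENNReal.ofReal (q'.side ^ 2)⁻¹ * X q' else 0))
          (fun q' => hdm.mul (measurable_ite_mem _ q')),
        ← lintegral_indicator q.measurableSet_cube]
      refine lintegral_congr fun y => ?_
      rw [← mul_treeSum]
      by_cases hy : y ∈ q.cube
      · simp [hy]
      · rw [Set.indicator_of_notMem hy, treeSum_eq_zero (x := y) (fun q hq => if_neg hq) n hy,
          mul_zero]
    rw [e1]
    calc _ ≤ D * ∫⁻ y in q.cube, treeSum child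
          (fun q => if y ∈ q.cube then ENNReal.ofReal (q.side ^ 2)⁻¹ * X q else 0) n q ^ 2 :=
          sq_lintegral_mul_le hdm.aemeasurable
            (measurable_treeSum (fun q => measurable_ite_mem _ q) n q).aemeasurable
      _ ≤ D * (3 * (ENNReal.ofReal (4 * C) * F)) := by
          gcongr
          refine (setLIntegral_le_lintegral _ _).trans ?_
          refine (lintegral_sq_treeSum_le hXadd n q).trans ?_
          gcongr
          exact carl n q
      _ = ENNReal.ofReal (12 * C) * D * F := by
          have : ENNReal.ofReal (12 * C) = 3 * ENNReal.ofReal (4 * C) := by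
            rw [← ENNReal.ofReal_ofNat 3, ← ENNReal.ofReal_mul (by norm_num)]
            congr 1; ring
          rw [this]; ring
  set B := (ENNReal.ofReal (12 * C) * D * F) ^ (1 / 2 : ℝ) with hB
  have hB2 : B ^ 2 = ENNReal.ofReal (12 * C) * D * F := by
    rw [hB, ← ENNReal.rpow_natCast, ← ENNReal.rpow_mul]; norm_num
  have hTB : ∀ n, treeSum child (fun q => X q * G q) n q ≤ B := fun n => by
    have := hT n
    rw [← hB2] at this
    exact (ENNReal.pow_le_pow_left_iff two_ne_zero).1 this
  obtain ⟨L, hL⟩ := q.isBounded_cube.isCompact_closure.exists_bound_of_continuousOn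
    hdc.continuousOn
  have hL' : ∀ y ∈ q.cube, ‖fderiv ℝ f y‖ ≤ L := fun y hy => hL y (subset_closure hy)
  -- In ∫|f|² dν one factor |f| is expanded by the telescoping estimate; integrating the other
  -- factor against ν turns the indicators of the cubes into the integrals X.
  have step : ∀ n : ℕ, F ≤ ‖q.mean f‖ₑ * X q + 128 * B +
      ENNReal.ofReal (2 * L * q.side / 2 ^ n) * X q := by
    intro n
    set t : E3 → ℝ≥0∞ := fun x => treeSum child
      (fun q => if x ∈ q.cube then G q else 0) n q with ht
    have htm : Measurable t := measurable_treeSum (fun q => measurable_ite_mem _ q) n q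
    have hft : Measurable fun x => ‖f x‖ₑ * t x := hfm.mul htm
    calc F ≤ ∫⁻ x in q.cube, (‖q.mean f‖ₑ * ‖f x‖ₑ + (128 * (‖f x‖ₑ * t x) +
            ENNReal.ofReal (2 * L * q.side / 2 ^ n) * ‖f x‖ₑ)) ∂ν := by
          refine setLIntegral_mono' q.measurableSet_cube fun x hx => ?_
          have h1 := enorm_mean_sub_le hf n hL' hx
          have h2 : ‖f x‖ₑ ≤ ‖q.mean f‖ₑ + ‖q.mean f - f x‖ₑ := by
            calc ‖f x‖ₑ = ‖q.mean f - (q.mean f - f x)‖ₑ := by congr 1; ring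
              _ ≤ _ := enorm_sub_le
          calc ‖f x‖ₑ ^ 2 = ‖f x‖ₑ * ‖f x‖ₑ := sq _
            _ ≤ ‖f x‖ₑ * (‖q.mean f‖ₑ + (128 * t x + ENNReal.ofReal (2 * L * q.side / 2 ^ n))) := by
                gcongr
                exact h2.trans (by gcongr)
            _ = _ := by ring
      _ = ‖q.mean f‖ₑ * X q + (128 * ∫⁻ x in q.cube, ‖f x‖ₑ * t x ∂ν) +
            ENNReal.ofReal (2 * L * q.side / 2 ^ n) * X q := by
          rw [lintegral_add_left (hfm.const_mul _), lintegral_add_left (hft.const_mul _),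
            lintegral_const_mul _ hfm, lintegral_const_mul _ hft,
            lintegral_const_mul _ hfm, add_assoc]
      _ ≤ _ := by
          gcongr
          refine le_trans ?_ (hTB n)
          have e2 : ∀ q' : Node, X q' * G q' =
              ∫⁻ x, ‖f x‖ₑ * (if x ∈ q'.cube then G q' else 0) ∂ν := by
            intro q'
            have : ∀ x, ‖f x‖ₑ * (if x ∈ q'.cube then G q' else 0) =
                q'.cube.indicator (fun x => ‖f x‖ₑ * G q') x := fun x => by
              by_cases hx : x ∈ q'.cube <;> simp [hx]
            simp only [this]
            rw [lintegral_indicator q'.measurableSet_cube, lintegral_mul_const _ hfm]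
          simp only [e2]
          rw [← lintegral_treeSum (a := fun q' x => ‖f x‖ₑ * (if x ∈ q'.cube then G q' else 0))
            (fun q' => hfm.mul (measurable_ite_mem _ q'))]
          refine (setLIntegral_le_lintegral _ _).trans (le_of_eq ?_)
          refine lintegral_congr fun x => ?_
          simp only [ht]
          rw [mul_treeSum]
  have lim : F ≤ ‖q.mean f‖ₑ * X q + 128 * B := by
    have h0 : Tendsto (fun n : ℕ => ENNReal.ofReal (2 * L * q.side / 2 ^ n) * X q) atTop
        (𝓝 0) := by
      have : Tendsto (fun n : ℕ => 2 * L * q.side / 2 ^ n) atTop (𝓝 0) :=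
        tendsto_const_nhds.div_atTop (tendsto_pow_atTop_atTop_of_one_lt (by norm_num))
      have h1 := ENNReal.tendsto_ofReal this
      rw [ENNReal.ofReal_zero] at h1
      simpa using ENNReal.Tendsto.mul_const h1 (Or.inr hXtop)
    have h1 := tendsto_const_nhds (x := ‖q.mean f‖ₑ * X q + 128 * B) |>.add h0
    rw [add_zero] at h1
    exact ge_of_tendsto' h1 step
  have hX2' : X q ^ 2 ≤ ENNReal.ofReal q.side * (ENNReal.ofReal (4 * C) * F) := by
    calc X q ^ 2 = ENNReal.ofReal q.side * (ENNReal.ofReal q.side⁻¹ * X q ^ 2) := by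
          rw [← mul_assoc, ← ENNReal.ofReal_mul q.side_pos.le, mul_inv_cancel₀ q.side_pos.ne']
          simp
      _ ≤ _ := by gcongr
  -- Both terms carry a factor F after squaring. The bound 1 ≤ `q.side` absorbs the power side⁻²
  -- left by the mean term, and 786432 = 4 · 128² · 12.
  have hsq : F * F ≤ (ENNReal.ofReal (786432 * C) * (S + D)) * F := by
    calc F * F = F ^ 2 := (sq F).symm
      _ ≤ (‖q.mean f‖ₑ * X q + 128 * B) ^ 2 := by gcongr
      _ ≤ 4 * ((‖q.mean f‖ₑ * X q) ^ 2 + (128 * B) ^ 2) := ENNReal_add_sq_le _ _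
      _ = 4 * (‖q.mean f‖ₑ ^ 2 * X q ^ 2 + 16384 * B ^ 2) := by ring
      _ ≤ 4 * ((ENNReal.ofReal (q.side ^ 3)⁻¹ * S) *
            (ENNReal.ofReal q.side * (ENNReal.ofReal (4 * C) * F)) +
            16384 * (ENNReal.ofReal (12 * C) * D * F)) := by
          rw [hB2]
          gcongr
          exact enorm_mean_sq_le q hfc
      _ ≤ 4 * ((S * (ENNReal.ofReal (4 * C) * F)) +
            16384 * (ENNReal.ofReal (12 * C) * D * F)) := by
          have : ENNReal.ofReal (q.side ^ 3)⁻¹ * ENNReal.ofReal q.side ≤ 1 := by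
            rw [← ENNReal.ofReal_mul (by have := q.side_pos; positivity), ← ENNReal.ofReal_one]
            refine ENNReal.ofReal_le_ofReal ?_
            have := q.side_pos
            rw [inv_mul_le_iff₀ (by positivity), mul_one]
            exact le_self_pow₀ hq three_ne_zero
          refine mul_le_mul_right (add_le_add_left ?_ _) 4
          calc _ = (ENNReal.ofReal (q.side ^ 3)⁻¹ * ENNReal.ofReal q.side) *
                (S * (ENNReal.ofReal (4 * C) * F)) := by ring
            _ ≤ 1 * (S * (ENNReal.ofReal (4 * C) * F)) := by gcongr
            _ = _ := one_mul _
      _ ≤ _ := by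
          have h1 : ENNReal.ofReal (786432 * C) = 786432 * ENNReal.ofReal C := by
            rw [ENNReal.ofReal_mul (by norm_num)]; simp
          have h2 : ENNReal.ofReal (4 * C) = 4 * ENNReal.ofReal C := by
            rw [ENNReal.ofReal_mul (by norm_num)]; simp
          have h3 : ENNReal.ofReal (12 * C) = 12 * ENNReal.ofReal C := by
            rw [ENNReal.ofReal_mul (by norm_num)]; simp
          rw [h1, h2, h3]
          calc _ = 16 * (ENNReal.ofReal C * S * F) + 786432 * (ENNReal.ofReal C * D * F) := by ring
            _ ≤ 786432 * (ENNReal.ofReal C * S * F) + 786432 * (ENNReal.ofReal C * D * F) := by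
                gcongr; norm_num
            _ = _ := by ring
  -- F can be cancelled because it is finite: f is bounded on the cube, and the cube has finite
  -- ν-measure.
  rcases eq_or_ne F 0 with h0 | h0
  · rw [h0]; exact zero_le
  · exact (ENNReal.mul_le_mul_iff_left h0 (hF q)).1 hsq

end Node

end PeriodicSchrodinger

/-! ### Periodic potentials: summation over lattice translates. -/

namespace PeriodicSchrodinger

/-- Clears the denominator in the quotient defining the norm. On a cube of zero mass both sides
vanish, and integrability of W excludes infinite mass. -/
theorem setLIntegral_le_of_kermanSawyerNorm_le {W : E3 → ℝ} (hW : Integrable W volume) {K : ℝ≥0∞}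
    (hK : kermanSawyerNorm W ≤ K) (q : Node) :
    ∫⁻ x in q.cube, ∫⁻ y in q.cube, ‖W x * W y‖ₑ / ‖x - y‖ₑ ≤ K * ∫⁻ x in q.cube, ‖W x‖ₑ := by
  have h := (le_iSup₂ (f := fun (m : ℤ) (k : Fin 3 → ℤ) =>
    (∫⁻ x in dyadicCube m k, ‖W x‖ₑ)⁻¹ *
      ∫⁻ x in dyadicCube m k, ∫⁻ y in dyadicCube m k, ‖W x * W y‖ₑ / ‖x - y‖ₑ) q.1 q.2).trans hK
  change (∫⁻ x in q.cube, ‖W x‖ₑ)⁻¹ *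
    ∫⁻ x in q.cube, ∫⁻ y in q.cube, ‖W x * W y‖ₑ / ‖x - y‖ₑ ≤ K at h
  rcases eq_or_ne (∫⁻ x in q.cube, ‖W x‖ₑ) 0 with h0 | h0
  · rw [lintegral_eq_zero_iff' hW.aestronglyMeasurable.enorm.restrict] at h0
    have : ∀ᵐ x ∂(volume.restrict q.cube),
        ∫⁻ y in q.cube, ‖W x * W y‖ₑ / ‖x - y‖ₑ = 0 := by
      filter_upwards [h0] with x hx
      have : W x = 0 := by simpa using hx
      simp [this]
    rw [lintegral_congr_ae this]
    simp
  · have ht : ∫⁻ x in q.cube, ‖W x‖ₑ ≠ ⊤ := hW.integrableOn.2.ne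
    rwa [ENNReal.inv_mul_le_iff h0 ht, mul_comm] at h

/-- The trace inequality on a dyadic cube for a density in the class of Kerman and Sawyer. -/
theorem setLIntegral_enorm_mul_sq_le {W : E3 → ℝ} (hW : Integrable W volume) {ε : ℝ} (hε : 0 < ε)
    (hK : kermanSawyerNorm W ≤ ENNReal.ofReal ε) {f : E3 → ℂ} (hf : ContDiff ℝ 1 f) {q : Node}
    (hq : 1 ≤ q.side) :
    ∫⁻ x in q.cube, ‖W x‖ₑ * ‖f x‖ₑ ^ 2 ≤ ENNReal.ofReal (3145728 * ε) *
      ((∫⁻ x in q.cube, ‖f x‖ₑ ^ 2) + ∫⁻ x in q.cube, ‖fderiv ℝ f x‖ₑ ^ 2) := by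
  have hWm : AEMeasurable (fun x => ‖W x‖ₑ) volume := hW.aestronglyMeasurable.enorm
  set w := hWm.mk _ with hwdef
  have hw : Measurable w := hWm.measurable_mk
  have hwae : (fun x => ‖W x‖ₑ) =ᵐ[volume] w := hWm.ae_eq_mk
  have hwr : ∀ S : Set E3, ∀ᵐ x ∂(volume.restrict S), ‖W x‖ₑ = w x := fun S =>
    ae_restrict_of_ae hwae
  have hint : ∀ S : Set E3, ∫⁻ x in S, ‖W x‖ₑ = ∫⁻ x in S, w x := fun S =>
    lintegral_congr_ae (hwr S)
  have hKw : ∀ q : Node, ∫⁻ x in q.cube, ∫⁻ y in q.cube, w x * w y / ‖x - y‖ₑ ≤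
      ENNReal.ofReal ε * ∫⁻ x in q.cube, w x := by
    intro q
    rw [← hint]
    refine le_trans (le_of_eq ?_) (setLIntegral_le_of_kermanSawyerNorm_le hW hK q)
    refine lintegral_congr_ae ?_
    filter_upwards [hwr q.cube] with x hx
    refine lintegral_congr_ae ?_
    filter_upwards [hwr q.cube] with y hy
    rw [enorm_mul, hx, hy]
  have hνcube : ∀ q : Node, volume.withDensity w q.cube = ∫⁻ x in q.cube, w x := fun q =>
    withDensity_apply w q.measurableSet_cube
  -- The Carleson constant 4ε contains the factor 4 of the kernel comparison, so the final constant
  -- is 4 · 786432 = 3145728.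
  have h := Node.trace_le (ν := volume.withDensity w) (C := 4 * ε) (by positivity)
    (fun q => by rw [hνcube, ← hint]; exact hW.integrableOn.2.ne)
    (fun n q => by
      simp only [hνcube]
      refine (Node.treeSum_sq_lintegral_le hw hKw n q).trans (le_of_eq ?_)
      rw [ENNReal.ofReal_mul (by norm_num)]; simp) hf hq
  rw [restrict_withDensity q.measurableSet_cube, lintegral_withDensity_eq_lintegral_mul _ hw
    (hf.continuous.enorm.measurable.pow_const 2)] at h
  refine le_trans (le_of_eq ?_) (h.trans (le_of_eq ?_))
  · refine lintegral_congr_ae ?_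
    filter_upwards [hwr q.cube] with x hx
    rw [hx]; rfl
  · congr 2; ring

/-- The vector `2π k` of the period lattice. -/
noncomputable def latticeVec (k : Fin 3 → ℤ) : E3 := WithLp.toLp 2 fun i => 2 * Real.pi * k i

theorem cell_eq : cell = gridCube (2 * Real.pi) 0 := by
  ext x; simp [cell, gridCube]

theorem IsLatticePeriodic.add_latticeVec {V : E3 → ℝ} (hV : IsLatticePeriodic V)
    (k : Fin 3 → ℤ) (x : E3) : V (x + latticeVec k) = V x := by
  have h : ∀ j (n : ℤ), Function.Periodic V (n • ((2 * Real.pi) • basisVec j)) := fun j n =>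
    Function.Periodic.zsmul (hV j) n
  have e : latticeVec k = k 0 • ((2 * Real.pi) • basisVec 0) + k 1 • ((2 * Real.pi) • basisVec 1)
      + k 2 • ((2 * Real.pi) • basisVec 2) := by
    ext i
    fin_cases i <;> simp [latticeVec, basisVec, mul_comm]
  rw [e]
  exact (((h 0 _).add_period (h 1 _)).add_period (h 2 _)) x

theorem add_latticeVec_mem_gridCube {j k : Fin 3 → ℤ} {x : E3} :
    x + latticeVec k ∈ gridCube (2 * Real.pi) (j + k) ↔ x ∈ gridCube (2 * Real.pi) j := by
  refine forall_congr' fun i => ?_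
  simp only [latticeVec, PiLp.add_apply, Pi.add_apply, Int.cast_add]
  constructor <;> rintro ⟨h1, h2⟩ <;> constructor <;> linarith

theorem setLIntegral_gridCube_add (H : E3 → ℝ≥0∞) (j k : Fin 3 → ℤ) :
    ∫⁻ x in gridCube (2 * Real.pi) j, H (x + latticeVec k) =
      ∫⁻ x in gridCube (2 * Real.pi) (j + k), H x := by
  rw [← lintegral_indicator (measurableSet_gridCube _ _),
    ← lintegral_indicator (measurableSet_gridCube _ _),
    ← lintegral_add_right_eq_self ((gridCube _ (j + k)).indicator H) (latticeVec k)]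
  refine lintegral_congr fun x => ?_
  by_cases hx : x ∈ gridCube (2 * Real.pi) j
  · rw [Set.indicator_of_mem hx, Set.indicator_of_mem (add_latticeVec_mem_gridCube.2 hx)]
  · rw [Set.indicator_of_notMem hx,
      Set.indicator_of_notMem (mt add_latticeVec_mem_gridCube.1 hx)]

theorem lintegral_eq_tsum_gridCube (H : E3 → ℝ≥0∞) :
    ∫⁻ x, H x = ∑' k, ∫⁻ x in gridCube (2 * Real.pi) k, H x := by
  have h2 : 0 < 2 * Real.pi := by positivity
  rw [← lintegral_iUnion (fun k => measurableSet_gridCube _ k) (pairwise_disjoint_gridCube h2),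
    iUnion_gridCube h2, setLIntegral_univ]

/-- The dyadic cube `[0,8)³`, which contains the period cell. -/
def bigNode : Node := (3, 0)

theorem side_bigNode : bigNode.side = 8 := by norm_num [bigNode, Node.side]

theorem cell_subset_cube : cell ⊆ bigNode.cube := by
  intro x hx i
  have h := hx i
  have := Real.pi_lt_four
  have e : (2 : ℝ) ^ bigNode.1 = 8 := side_bigNode
  rw [e]
  simp only [bigNode, Pi.zero_apply, Int.cast_zero]
  constructor <;> linarith

/-- Since 8 < 4π, two periods along each axis suffice. -/
theorem cube_subset_iUnion :
    bigNode.cube ⊆ ⋃ e : Fin 3 → Fin 2, gridCube (2 * Real.pi) fun i => ((e i : ℕ) : ℤ) := by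
  classical
  intro x hx
  have e : (2 : ℝ) ^ bigNode.1 = 8 := side_bigNode
  have h : ∀ i, 0 ≤ x i ∧ x i < 8 := fun i => by
    have := hx i
    rw [e] at this
    simpa [bigNode] using this
  have h3 := Real.pi_gt_three
  refine Set.mem_iUnion.2 ⟨fun i => if x i < 2 * Real.pi then 0 else 1, fun i => ?_⟩
  have := h i
  by_cases hi : x i < 2 * Real.pi
  · simp only [hi, if_true]
    constructor <;> norm_num <;> linarith
  · simp only [hi, if_false]
    constructor <;> norm_num <;> linarith

/-- The period cell is not dyadic, so estimates are made on the larger cube. Its lattice translates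
overlap, but each is covered by eight cells, and each of the eight positions runs through every cell
exactly once. -/
theorem tsum_setLIntegral_cube_add_le (H : E3 → ℝ≥0∞) :
    ∑' k, ∫⁻ x in bigNode.cube, H (x + latticeVec k) ≤ 8 * ∫⁻ x, H x := by
  calc ∑' k, ∫⁻ x in bigNode.cube, H (x + latticeVec k)
      ≤ ∑' k, ∑ e : Fin 3 → Fin 2,
          ∫⁻ x in gridCube (2 * Real.pi) ((fun i => ((e i : ℕ) : ℤ)) + k), H x := by
        refine ENNReal.tsum_le_tsum fun k => ?_
        simp only [← setLIntegral_gridCube_add]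
        rw [← tsum_fintype (L := .unconditional _)]
        exact (lintegral_mono_set cube_subset_iUnion).trans (lintegral_iUnion_le _ _)
    _ = ∑ e : Fin 3 → Fin 2, ∑' k,
          ∫⁻ x in gridCube (2 * Real.pi) ((fun i => ((e i : ℕ) : ℤ)) + k), H x :=
        Summable.tsum_finsetSum (L := .unconditional _) fun e _ => ENNReal.summable
    _ = ∑ e : Fin 3 → Fin 2, ∫⁻ x, H x := by
        refine Finset.sum_congr rfl fun e _ => ?_
        rw [lintegral_eq_tsum_gridCube H]
        exact (Equiv.addLeft (fun i => ((e i : ℕ) : ℤ))).tsum_eq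
          (fun k => ∫⁻ x in gridCube (2 * Real.pi) k, H x)
    _ = 8 * ∫⁻ x, H x := by simp

theorem measurableSet_cell : MeasurableSet cell := by
  rw [cell_eq]; exact measurableSet_gridCube _ _

theorem integrable_indicator_largePart {V : E3 → ℝ} (hV : LocallyIntegrable V volume) (N : ℝ) :
    Integrable (cell.indicator (largePart V N)) volume := by
  have h1 : IntegrableOn V cell volume :=
    (hV.integrableOn_isCompact bigNode.isBounded_cube.isCompact_closure).mono_set
      (cell_subset_cube.trans subset_closure)
  rw [integrable_indicator_iff measurableSet_cell]
  have hS : NullMeasurableSet {x | N < |V x|} volume := by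
    have := hV.aestronglyMeasurable.aemeasurable
    exact nullMeasurableSet_lt aemeasurable_const (this.norm)
  refine Integrable.mono h1 ?_ (ae_of_all _ fun x => norm_indicator_le_norm_self _ _)
  exact (hV.aestronglyMeasurable.indicator₀ hS).restrict

/-- The form bound for the large part of a periodic potential, on smooth functions. -/
theorem lintegral_largePart_mul_sq_le {V : E3 → ℝ} (hV : LocallyIntegrable V volume)
    (hper : IsLatticePeriodic V) {N ε : ℝ} (hε : 0 < ε)
    (hK : kermanSawyerNorm (cell.indicator (largePart V N)) ≤ ENNReal.ofReal ε)
    {f : E3 → ℂ} (hf : ContDiff ℝ 1 f) :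
    ∫⁻ x, ‖largePart V N x‖ₑ * ‖f x‖ₑ ^ 2 ≤ ENNReal.ofReal (25165824 * ε) *
      ((∫⁻ x, ‖f x‖ₑ ^ 2) + ∫⁻ x, ‖fderiv ℝ f x‖ₑ ^ 2) := by
  have hlp : ∀ k x, largePart V N (x + latticeVec k) = largePart V N x := fun k x => by
    simp only [largePart, Set.indicator, Set.mem_ofPred_eq, hper.add_latticeVec]
  have hfd : Continuous fun x => fderiv ℝ f x := hf.continuous_fderiv (by norm_num)
  have hfm : Measurable fun x => ‖f x‖ₑ ^ 2 := hf.continuous.enorm.measurable.pow_const 2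
  set H : E3 → ℝ≥0∞ := fun x => ‖f x‖ₑ ^ 2 + ‖fderiv ℝ f x‖ₑ ^ 2 with hH
  calc ∫⁻ x, ‖largePart V N x‖ₑ * ‖f x‖ₑ ^ 2
      = ∑' k, ∫⁻ x in cell, ‖largePart V N x‖ₑ * ‖f (x + latticeVec k)‖ₑ ^ 2 := by
        rw [lintegral_eq_tsum_gridCube]
        congr 1
        funext k
        rw [← zero_add k, ← setLIntegral_gridCube_add, cell_eq]
        simp only [hlp, zero_add]
    -- By periodicity the weight is the same on every cell, so the trace inequality on [0,8)³ is
    -- applied to every translate of f.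
    _ ≤ ∑' k, ENNReal.ofReal (3145728 * ε) * ∫⁻ x in bigNode.cube, H (x + latticeVec k) := by
        refine ENNReal.tsum_le_tsum fun k => ?_
        have hfk : ContDiff ℝ 1 fun x => f (x + latticeVec k) :=
          hf.comp (contDiff_id.add contDiff_const)
        have h := setLIntegral_enorm_mul_sq_le (integrable_indicator_largePart hV N) hε hK hfk
          (q := bigNode) (by rw [side_bigNode]; norm_num)
        rw [← lintegral_add_left (hfk.continuous.enorm.measurable.pow_const 2)] at h
        simp only [fderiv_comp_add_right] at h
        refine le_trans ?_ h
        calc ∫⁻ x in cell, ‖largePart V N x‖ₑ * ‖f (x + latticeVec k)‖ₑ ^ 2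
            = ∫⁻ x in cell, ‖cell.indicator (largePart V N) x‖ₑ * ‖f (x + latticeVec k)‖ₑ ^ 2 :=
              setLIntegral_congr_fun measurableSet_cell fun x hx => by
                simp only [Set.indicator_of_mem hx]
          _ ≤ _ := lintegral_mono_set cell_subset_cube
    _ ≤ ENNReal.ofReal (3145728 * ε) * (8 * ∫⁻ x, H x) := by
        rw [ENNReal.tsum_mul_left]
        gcongr
        exact tsum_setLIntegral_cube_add_le H
    _ = _ := by
        rw [hH, lintegral_add_left hfm, ← mul_assoc]
        congr 1
        rw [← ENNReal.ofReal_ofNat 8, ← ENNReal.ofReal_mul (by positivity)]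
        congr 1; ring

end PeriodicSchrodinger

/-! ### Mollification and the form bound on H¹. -/

namespace PeriodicSchrodinger

noncomputable section

/-- The bump functions used for mollification. -/
def mollifierBump (n : ℕ) : ContDiffBump (0 : E3) where
  rIn := 1 / (2 * ((n : ℝ) + 1))
  rOut := 1 / ((n : ℝ) + 1)
  rIn_pos := by positivity
  rIn_lt_rOut := by
    have : 0 < (n : ℝ) + 1 := by positivity
    exact one_div_lt_one_div_of_lt this (by linarith)

/-- The mollifier with support of size `1 / (n + 1)`. -/
def mollifier (n : ℕ) : E3 → ℝ := (mollifierBump n).normed volume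

/-- The mollification of a function. -/
def mollify (n : ℕ) (u : E3 → ℂ) : E3 → ℂ :=
  convolution (mollifier n) u (ContinuousLinearMap.lsmul ℝ ℝ) volume

theorem contDiff_mollifier (n : ℕ) : ContDiff ℝ ∞ (mollifier n) :=
  (mollifierBump n).contDiff_normed

theorem hasCompactSupport_mollifier (n : ℕ) : HasCompactSupport (mollifier n) :=
  (mollifierBump n).hasCompactSupport_normed

theorem mollifier_nonneg (n : ℕ) (x : E3) : 0 ≤ mollifier n x :=
  (mollifierBump n).nonneg_normed x

theorem lintegral_ofReal_mollifier (n : ℕ) : ∫⁻ x, ENNReal.ofReal (mollifier n x) = 1 := by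
  simp only [mollifier]
  rw [← ofReal_integral_eq_lintegral_ofReal (mollifierBump n).integrable_normed
    (ae_of_all _ (mollifier_nonneg n))]
  simp [(mollifierBump n).integral_normed]

theorem contDiff_mollify (n : ℕ) {u : E3 → ℂ} (hu : LocallyIntegrable u volume) :
    ContDiff ℝ ∞ (mollify n u) :=
  (hasCompactSupport_mollifier n).contDiff_convolution_left _ (contDiff_mollifier n) hu

theorem ae_tendsto_mollify {u : E3 → ℂ} (hu : LocallyIntegrable u volume) :
    ∀ᵐ x, Tendsto (fun n => mollify n u x) atTop (𝓝 (u x)) := by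
  refine ContDiffBump.ae_convolution_tendsto_right_of_locallyIntegrable (K := 2) ?_ ?_ hu
  · exact tendsto_one_div_add_atTop_nhds_zero_nat
  · refine Eventually.of_forall fun n => le_of_eq ?_
    simp only [mollifierBump]
    have : (n : ℝ) + 1 ≠ 0 := by positivity
    field_simp

/-- The mollifier is a probability density: Cauchy–Schwarz under it, then Tonelli and translation
invariance. -/
theorem lintegral_mollify_sq_le (n : ℕ) {u : E3 → ℂ} (hu : Measurable u) :
    ∫⁻ x, ‖mollify n u x‖ₑ ^ 2 ≤ ∫⁻ x, ‖u x‖ₑ ^ 2 := by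
  have hρ : Measurable fun x => ENNReal.ofReal (mollifier n x) :=
    (contDiff_mollifier n).continuous.measurable.ennreal_ofReal
  set m : Measure E3 := volume.withDensity fun x => ENNReal.ofReal (mollifier n x) with hm
  have hm1 : m Set.univ = 1 := by
    rw [hm, withDensity_apply _ MeasurableSet.univ, setLIntegral_univ, lintegral_ofReal_mollifier]
  have : IsProbabilityMeasure m := ⟨hm1⟩
  have hpt : ∀ x, ‖mollify n u x‖ₑ ^ 2 ≤ ∫⁻ t, ‖u (x - t)‖ₑ ^ 2 ∂m := by
    intro x
    have h1 : ‖mollify n u x‖ₑ ≤ ∫⁻ t, ‖u (x - t)‖ₑ * 1 ∂m := by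
      refine (enorm_integral_le_lintegral_enorm _).trans (le_of_eq ?_)
      simp only [mul_one]
      rw [hm, lintegral_withDensity_eq_lintegral_mul _ hρ (by fun_prop)]
      refine lintegral_congr fun t => ?_
      change ‖mollifier n t • u (x - t)‖ₑ = ENNReal.ofReal (mollifier n t) * ‖u (x - t)‖ₑ
      rw [enorm_smul, Real.enorm_of_nonneg (mollifier_nonneg n t)]
    calc ‖mollify n u x‖ₑ ^ 2 ≤ (∫⁻ t, ‖u (x - t)‖ₑ * 1 ∂m) ^ 2 := by gcongr
      _ ≤ (∫⁻ t, ‖u (x - t)‖ₑ ^ 2 ∂m) * ∫⁻ t, 1 ^ 2 ∂m :=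
          sq_lintegral_mul_le (by fun_prop) (by fun_prop)
      _ = _ := by simp
  calc ∫⁻ x, ‖mollify n u x‖ₑ ^ 2 ≤ ∫⁻ x, ∫⁻ t, ‖u (x - t)‖ₑ ^ 2 ∂m := lintegral_mono hpt
    _ = ∫⁻ t, (∫⁻ x, ‖u (x - t)‖ₑ ^ 2) ∂m :=
        lintegral_lintegral_swap
          (Measurable.aemeasurable (by simp only [Function.uncurry_def]; fun_prop))
    _ = ∫⁻ _, (∫⁻ x, ‖u x‖ₑ ^ 2) ∂m := by
        refine lintegral_congr fun t => ?_
        exact lintegral_sub_right_eq_self (fun x => ‖u x‖ₑ ^ 2) t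
    _ = ∫⁻ x, ‖u x‖ₑ ^ 2 := by simp

theorem locallyIntegrable_L2 (u : L2) : LocallyIntegrable u volume :=
  (Lp.memLp u).locallyIntegrable (by norm_num)

theorem measurable_L2 (u : L2) : Measurable u := (Lp.stronglyMeasurable u).measurable

/-- Mollification commutes with weak derivatives. -/
theorem IsWeakPartial.classicalPartial_mollify {j : Fin 3} {f g : L2} (h : IsWeakPartial j f g)
    (n : ℕ) (x : E3) : classicalPartial j (mollify n f) x = mollify n g x := by
  have hρ := contDiff_mollifier n
  have hc := hasCompactSupport_mollifier n
  have hd := hc.hasFDerivAt_convolution_left (ContinuousLinearMap.lsmul ℝ ℝ)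
    (hρ.of_le (by exact_mod_cast le_top)) (locallyIntegrable_L2 f) x
  have hex : ConvolutionExistsAt (fderiv ℝ (mollifier n)) f x
      ((ContinuousLinearMap.lsmul ℝ ℝ : ℝ →L[ℝ] ℂ →L[ℝ] ℂ).precompL E3) volume :=
    (hc.fderiv ℝ).convolutionExists_left _ (hρ.continuous_fderiv (by norm_num))
      (locallyIntegrable_L2 f) x
  -- The reflected and translated mollifier is the test function in the definition of the weak
  -- derivative; the reflection supplies the sign.
  set ψ : E3 → ℂ := fun y => (mollifier n (x - y) : ℂ) with hψ
  have hψt : IsTest ψ := by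
    refine ⟨Complex.ofRealCLM.contDiff.comp (hρ.comp (contDiff_const.sub contDiff_id)), ?_⟩
    have : HasCompactSupport fun y => mollifier n (x - y) :=
      hc.comp_homeomorph (Homeomorph.subLeft x)
    exact this.comp_left (g := fun r : ℝ => (r : ℂ)) rfl
  have hψd : ∀ y, classicalPartial j ψ y = -((fderiv ℝ (mollifier n) (x - y) (basisVec j) : ℝ) : ℂ) := by
    intro y
    have h1 : HasFDerivAt (fun y => mollifier n (x - y))
        ((fderiv ℝ (mollifier n) (x - y)).comp (-ContinuousLinearMap.id ℝ E3)) y :=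
      ((hρ.differentiable (by norm_num)) (x - y)).hasFDerivAt.comp y
        ((hasFDerivAt_id y).const_sub x)
    have h2 := Complex.ofRealCLM.hasFDerivAt.comp y h1
    rw [classicalPartial, hψ]
    erw [h2.fderiv]
    simp
  have key := h ψ hψt
  simp only [hψd] at key
  rw [classicalPartial, mollify, hd.fderiv, convolution_def, ContinuousLinearMap.integral_apply hex,
    mollify, convolution_def]
  rw [← integral_sub_left_eq_self (fun t => (ContinuousLinearMap.precompL E3
      (ContinuousLinearMap.lsmul ℝ ℝ) (fderiv ℝ (mollifier n) t) ((f : E3 → ℂ) (x - t)))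
      (basisVec j)) volume x,
    ← integral_sub_left_eq_self (fun t => ContinuousLinearMap.lsmul ℝ ℝ (mollifier n t)
      ((g : E3 → ℂ) (x - t))) volume x]
  simp only [sub_sub_cancel]
  have e1 : ∫ y, (f : E3 → ℂ) y * -((fderiv ℝ (mollifier n) (x - y) (basisVec j) : ℝ) : ℂ) =
      -∫ y, ((ContinuousLinearMap.precompL E3 (ContinuousLinearMap.lsmul ℝ ℝ))
        (fderiv ℝ (mollifier n) (x - y)) (f y)) (basisVec j) := by
    rw [← integral_neg]
    refine integral_congr_ae (ae_of_all _ fun y => ?_)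
    simp [ContinuousLinearMap.precompL_apply, mul_comm]
  rw [e1] at key
  rw [neg_injective key]
  refine integral_congr_ae (ae_of_all _ fun y => ?_)
  simp [hψ, mul_comm]

/-- Cauchy–Schwarz in coordinates: it passes from the operator norm of the derivative in the trace
inequality to the partial derivatives in the H¹ norm. -/
theorem enorm_sq_clm_le (L : E3 →L[ℝ] ℂ) : ‖L‖ₑ ^ 2 ≤ ∑ j, ‖L (basisVec j)‖ₑ ^ 2 := by
  have h : ‖L‖ ≤ Real.sqrt (∑ j, ‖L (basisVec j)‖ ^ 2) := by
    refine L.opNorm_le_bound (Real.sqrt_nonneg _) fun v => ?_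
    have hv : v = ∑ j, v j • basisVec j := by
      ext i
      simp [basisVec, Finset.sum_apply, Pi.single_apply]
    calc ‖L v‖ = ‖∑ j, v j • L (basisVec j)‖ := by
          conv_lhs => rw [hv]
          simp
      _ ≤ ∑ j, ‖L (basisVec j)‖ * ‖v j‖ := by
          refine (norm_sum_le _ _).trans (le_of_eq ?_)
          exact Finset.sum_congr rfl fun j _ => by rw [norm_smul, mul_comm]
      _ ≤ Real.sqrt (∑ j, ‖L (basisVec j)‖ ^ 2) * Real.sqrt (∑ j, ‖v j‖ ^ 2) :=
          Real.sum_mul_le_sqrt_mul_sqrt _ _ _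
      _ = _ := by rw [EuclideanSpace.norm_eq v]
  have h2 : ‖L‖ ^ 2 ≤ ∑ j, ‖L (basisVec j)‖ ^ 2 := by
    rw [← Real.sq_sqrt (Finset.sum_nonneg fun j _ => sq_nonneg ‖L (basisVec j)‖)]
    gcongr
  rw [← ofReal_norm, ← ENNReal.ofReal_pow (norm_nonneg _)]
  refine (ENNReal.ofReal_le_ofReal h2).trans (le_of_eq ?_)
  rw [ENNReal.ofReal_sum_of_nonneg fun j _ => sq_nonneg _]
  exact Finset.sum_congr rfl fun j _ => by rw [← ofReal_norm, ENNReal.ofReal_pow (norm_nonneg _)]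

/-- The form bound for the large part of a periodic potential. -/
theorem lintegral_largePart_mul_sq_le_of_mem_H1 {V : E3 → ℝ} (hV : LocallyIntegrable V volume)
    (hper : IsLatticePeriodic V) {N ε : ℝ} (hε : 0 < ε)
    (hK : kermanSawyerNorm (cell.indicator (largePart V N)) ≤ ENNReal.ofReal ε)
    {f : L2} {g : Fin 3 → L2} (hg : ∀ j, IsWeakPartial j f (g j)) :
    ∫⁻ x, ‖largePart V N x‖ₑ * ‖f x‖ₑ ^ 2 ≤ ENNReal.ofReal (25165824 * ε) *
      ((∫⁻ x, ‖f x‖ₑ ^ 2) + ∑ j, ∫⁻ x, ‖g j x‖ₑ ^ 2) := by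
  have hlp : AEMeasurable (fun x => ‖largePart V N x‖ₑ) volume := by
    have hm := hV.aestronglyMeasurable.aemeasurable
    have hS : NullMeasurableSet {x | N < |V x|} volume := nullMeasurableSet_lt aemeasurable_const hm.norm
    exact (hV.aestronglyMeasurable.indicator₀ hS).enorm
  have hmc : ∀ n, ContDiff ℝ ∞ (mollify n f) := fun n => contDiff_mollify n (locallyIntegrable_L2 f)
  have hlim : ∀ᵐ x, ‖largePart V N x‖ₑ * ‖f x‖ₑ ^ 2 =
      liminf (fun n => ‖largePart V N x‖ₑ * ‖mollify n f x‖ₑ ^ 2) atTop := by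
    filter_upwards [ae_tendsto_mollify (locallyIntegrable_L2 f)] with x hx
    refine (Tendsto.liminf_eq ?_).symm
    exact ENNReal.Tendsto.const_mul
      ((ENNReal.continuous_pow 2).continuousAt.tendsto.comp (hx.enorm)) (Or.inr enorm_ne_top)
  rw [lintegral_congr_ae hlim]
  -- Fatou's lemma along the mollifications; the right-hand side does not grow under mollification.
  refine (lintegral_liminf_le' fun n =>
    hlp.mul ((hmc n).continuous.enorm.measurable.pow_const 2).aemeasurable).trans ?_
  refine liminf_le_of_le (by isBoundedDefault) fun b hb => ?_
  obtain ⟨n, hn⟩ := hb.exists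
  refine hn.trans ((lintegral_largePart_mul_sq_le hV hper hε hK
    ((hmc n).of_le (by exact_mod_cast le_top))).trans ?_)
  refine mul_le_mul_right (add_le_add ?_ ?_) _
  · exact lintegral_mollify_sq_le n (measurable_L2 f)
  · calc ∫⁻ x, ‖fderiv ℝ (mollify n f) x‖ₑ ^ 2 ≤ ∫⁻ x, ∑ j, ‖mollify n (g j) x‖ₑ ^ 2 := by
          refine lintegral_mono fun x => (enorm_sq_clm_le _).trans (le_of_eq ?_)
          refine Finset.sum_congr rfl fun j _ => ?_
          rw [← (hg j).classicalPartial_mollify n x]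
          rfl
      _ = ∑ j, ∫⁻ x, ‖mollify n (g j) x‖ₑ ^ 2 :=
          lintegral_finsetSum _ fun j _ => (contDiff_mollify n
            (locallyIntegrable_L2 (g j))).continuous.enorm.measurable.pow_const 2
      _ ≤ _ := Finset.sum_le_sum fun j _ => lintegral_mollify_sq_le n (measurable_L2 (g j))

end

end PeriodicSchrodinger

/-! ### Density of test functions in H¹. -/

namespace PeriodicSchrodinger

noncomputable section

theorem enorm_add_sq_le (a b : ℂ) : ‖a + b‖ₑ ^ 2 ≤ 4 * (‖a‖ₑ ^ 2 + ‖b‖ₑ ^ 2) :=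
  (pow_le_pow_left₀ zero_le (enorm_add_le a b) 2).trans (ENNReal_add_sq_le _ _)

theorem enorm_sub_sq_le (a b : ℂ) : ‖a - b‖ₑ ^ 2 ≤ 2 * ‖a‖ₑ ^ 2 + 2 * ‖b‖ₑ ^ 2 := by
  have h : ‖a - b‖ ^ 2 ≤ 2 * ‖a‖ ^ 2 + 2 * ‖b‖ ^ 2 := by
    have := parallelogram_law_with_norm ℝ a b
    nlinarith [mul_self_nonneg ‖a + b‖]
  have e : ∀ z : ℂ, ‖z‖ₑ ^ 2 = ENNReal.ofReal (‖z‖ ^ 2) := fun z => by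
    rw [← ofReal_norm, ENNReal.ofReal_pow (norm_nonneg _)]
  rw [e, e, e, ← ENNReal.ofReal_ofNat 2, ← ENNReal.ofReal_mul (by norm_num),
    ← ENNReal.ofReal_mul (by norm_num), ← ENNReal.ofReal_add (by positivity) (by positivity)]
  exact ENNReal.ofReal_le_ofReal h

/-- Almost everywhere convergence without increase of the `L²` norm implies `L²` convergence. -/
theorem tendsto_lintegral_sub_sq_of_ae_tendsto {u : E3 → ℂ} {v : ℕ → E3 → ℂ}
    (hu : Measurable u) (hv : ∀ n, Measurable (v n)) (hfin : ∫⁻ x, ‖u x‖ₑ ^ 2 ≠ ⊤)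
    (hle : ∀ n, ∫⁻ x, ‖v n x‖ₑ ^ 2 ≤ ∫⁻ x, ‖u x‖ₑ ^ 2)
    (hlim : ∀ᵐ x, Tendsto (fun n => v n x) atTop (𝓝 (u x))) :
    Tendsto (fun n => ∫⁻ x, ‖v n x - u x‖ₑ ^ 2) atTop (𝓝 0) := by
  set U := ∫⁻ x, ‖u x‖ₑ ^ 2 with hU
  have h4 : ∀ n x, ‖v n x - u x‖ₑ ^ 2 ≤ 2 * ‖v n x‖ₑ ^ 2 + 2 * ‖u x‖ₑ ^ 2 := fun n x =>
    enorm_sub_sq_le _ _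
  have hint : ∀ n, ∫⁻ x, (2 * ‖v n x‖ₑ ^ 2 + 2 * ‖u x‖ₑ ^ 2) ≤ 4 * U := fun n => by
    rw [lintegral_add_left (by fun_prop), lintegral_const_mul _ (by fun_prop),
      lintegral_const_mul _ (by fun_prop)]
    calc _ ≤ 2 * U + 2 * U := by gcongr; exact hle n
      _ = 4 * U := by ring
  have hd : ∀ n, ∫⁻ x, ‖v n x - u x‖ₑ ^ 2 ≤ 4 * U := fun n => (lintegral_mono (h4 n)).trans (hint n)
  have h4U : 4 * U ≠ ⊤ := ENNReal.mul_ne_top (by simp) hfin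
  -- Fatou's lemma for the nonnegative functions 2|v|² + 2|u|² - |v - u|², which converge to 4|u|²
  -- while the first two terms integrate to at most 4U. Hence ∫|v - u|² must tend to zero.
  have fatou : 4 * U ≤ liminf (fun n => 4 * U - ∫⁻ x, ‖v n x - u x‖ₑ ^ 2) atTop := by
    calc 4 * U = ∫⁻ x, 4 * ‖u x‖ₑ ^ 2 := (lintegral_const_mul _ (by fun_prop)).symm
      _ = ∫⁻ x, liminf (fun n => 2 * ‖v n x‖ₑ ^ 2 + 2 * ‖u x‖ₑ ^ 2 - ‖v n x - u x‖ₑ ^ 2)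
            atTop := by
          refine lintegral_congr_ae ?_
          filter_upwards [hlim] with x hx
          refine (Tendsto.liminf_eq ?_).symm
          have c2 := (ENNReal.continuous_pow 2)
          have t1 : Tendsto (fun n => ‖v n x‖ₑ ^ 2) atTop (𝓝 (‖u x‖ₑ ^ 2)) :=
            c2.continuousAt.tendsto.comp hx.enorm
          have t2 : Tendsto (fun n => ‖v n x - u x‖ₑ ^ 2) atTop (𝓝 (‖u x - u x‖ₑ ^ 2)) :=
            c2.continuousAt.tendsto.comp (hx.sub_const (u x)).enorm
          have t3 := (ENNReal.Tendsto.const_mul (a := 2) t1 (Or.inr (by simp))).add_const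
            (2 * ‖u x‖ₑ ^ 2)
          have t4 := ENNReal.Tendsto.sub t3 t2 (Or.inr (by simp))
          convert t4 using 2
          simp
          ring
      _ ≤ liminf (fun n => ∫⁻ x, (2 * ‖v n x‖ₑ ^ 2 + 2 * ‖u x‖ₑ ^ 2 - ‖v n x - u x‖ₑ ^ 2))
            atTop := lintegral_liminf_le fun n => by fun_prop
      _ ≤ _ := by
          refine liminf_le_liminf (Eventually.of_forall fun n => ?_)
          rw [lintegral_sub (by fun_prop) (ne_top_of_le_ne_top h4U (hd n))
            (ae_of_all _ (h4 n))]
          exact tsub_le_tsub_right (hint n) _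
  rw [ENNReal.tendsto_nhds_zero]
  intro δ hδ
  rcases eq_or_ne (4 * U) 0 with h0 | h0
  · exact Eventually.of_forall fun n => ((hd n).trans h0.le).trans zero_le
  have hlt : 4 * U - δ < 4 * U := ENNReal.sub_lt_self h4U h0 hδ.ne'
  filter_upwards [eventually_lt_of_lt_liminf (hlt.trans_le fatou)] with n hn
  by_contra hcon
  exact absurd hn (not_lt.2 (tsub_le_tsub_left (not_le.1 hcon).le _))

/-- The bump function from which the cutoff functions are made by scaling. -/
def cutoffBump : ContDiffBump (0 : E3) where
  rIn := 1
  rOut := 2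
  rIn_pos := by norm_num
  rIn_lt_rOut := by norm_num

/-- A smooth cutoff function, equal to one on the ball of radius `n + 1`. -/
def cutoff (n : ℕ) (x : E3) : ℝ := cutoffBump (((n : ℝ) + 1)⁻¹ • x)

theorem contDiff_cutoff (n : ℕ) : ContDiff ℝ ∞ (cutoff n) :=
  cutoffBump.contDiff.comp (contDiff_id.const_smul _)

theorem hasCompactSupport_cutoff (n : ℕ) : HasCompactSupport (cutoff n) :=
  cutoffBump.hasCompactSupport.comp_smul (by positivity)

theorem abs_cutoff_le (n : ℕ) (x : E3) : ‖cutoff n x‖ ≤ 1 := by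
  rw [cutoff, Real.norm_of_nonneg cutoffBump.nonneg]
  exact cutoffBump.le_one

theorem tendsto_cutoff (x : E3) : Tendsto (fun n => cutoff n x) atTop (𝓝 1) := by
  refine tendsto_const_nhds.congr' ?_
  obtain ⟨m, hm⟩ := exists_nat_ge ‖x‖
  filter_upwards [eventually_ge_atTop m] with n hn
  refine (cutoffBump.one_of_mem_closedBall ?_).symm
  rw [mem_closedBall_zero_iff, norm_smul, norm_inv, Real.norm_of_nonneg (by positivity),
    inv_mul_le_iff₀ (by positivity)]
  have : (m : ℝ) ≤ n := by exact_mod_cast hn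
  simp only [cutoffBump]
  linarith

/-- Scaling: the gradient of the cutoff decays like 1/(n + 1), which removes the Leibniz term in the
density argument. -/
theorem exists_norm_fderiv_cutoff_le :
    ∃ B : ℝ, 0 ≤ B ∧ ∀ n x, ‖fderiv ℝ (cutoff n) x‖ ≤ B / ((n : ℝ) + 1) := by
  have hχ : ContDiff ℝ ∞ cutoffBump := cutoffBump.contDiff
  obtain ⟨B, hB⟩ := (cutoffBump.hasCompactSupport.fderiv ℝ).exists_bound_of_continuous
    (hχ.continuous_fderiv (by norm_num))
  refine ⟨B, (norm_nonneg _).trans (hB 0), fun n x => ?_⟩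
  have h : fderiv ℝ (cutoff n) x =
      ((n : ℝ) + 1)⁻¹ • fderiv ℝ cutoffBump (((n : ℝ) + 1)⁻¹ • x) := by
    exact fderiv_comp_smul _
  rw [h, norm_smul, norm_inv, Real.norm_of_nonneg (by positivity), div_eq_inv_mul]
  gcongr
  exact hB _

theorem lintegral_L2_ne_top (u : L2) : ∫⁻ x, ‖u x‖ₑ ^ 2 ≠ ⊤ := by
  have := (Lp.memLp u).2
  rw [eLpNorm_lt_top_iff_lintegral_rpow_enorm_lt_top (by norm_num) (by norm_num)] at this
  simpa using this.ne

theorem tendsto_cutoff_mul_mollify (u : L2) :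
    Tendsto (fun n => ∫⁻ x, ‖(cutoff n x : ℂ) * mollify n u x - u x‖ₑ ^ 2) atTop (𝓝 0) := by
  have hm : ∀ n, Measurable fun x => (cutoff n x : ℂ) * mollify n u x := fun n =>
    (Complex.measurable_ofReal.comp (contDiff_cutoff n).continuous.measurable).mul
      (contDiff_mollify n (locallyIntegrable_L2 u)).continuous.measurable
  refine tendsto_lintegral_sub_sq_of_ae_tendsto (measurable_L2 u) hm (lintegral_L2_ne_top u)
    (fun n => ?_) ?_
  · refine le_trans (lintegral_mono fun x => ?_) (lintegral_mollify_sq_le n (measurable_L2 u))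
    gcongr
    rw [enorm_mul]
    have : ‖(cutoff n x : ℂ)‖ₑ ≤ 1 := by
      rw [← ofReal_norm, ← ENNReal.ofReal_one, Complex.norm_real]
      exact ENNReal.ofReal_le_ofReal (abs_cutoff_le n x)
    calc _ ≤ 1 * ‖mollify n u x‖ₑ := by gcongr
      _ = _ := one_mul _
  · filter_upwards [ae_tendsto_mollify (locallyIntegrable_L2 u)] with x hx
    have h1 : Tendsto (fun n => (cutoff n x : ℂ)) atTop (𝓝 1) := by
      have := (Complex.continuous_ofReal.tendsto 1).comp (tendsto_cutoff x)
      simpa [Function.comp_def] using this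
    simpa using h1.mul hx

theorem classicalPartial_mul {j : Fin 3} {a b : E3 → ℂ} {x : E3} (ha : DifferentiableAt ℝ a x)
    (hb : DifferentiableAt ℝ b x) : classicalPartial j (fun x => a x * b x) x =
      a x * classicalPartial j b x + classicalPartial j a x * b x := by
  simp only [classicalPartial]
  rw [fderiv_fun_mul ha hb]
  simp [mul_comm]

/-- Test functions are dense in the graph of the weak gradient. -/
theorem exists_isTest_tendsto {f : L2} {g : Fin 3 → L2} (hg : ∀ j, IsWeakPartial j f (g j)) :
    ∃ φ : ℕ → E3 → ℂ, (∀ n, IsTest (φ n)) ∧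
      Tendsto (fun n => ∫⁻ x, ‖φ n x - f x‖ₑ ^ 2) atTop (𝓝 0) ∧
      ∀ j, Tendsto (fun n => ∫⁻ x, ‖classicalPartial j (φ n) x - g j x‖ₑ ^ 2) atTop (𝓝 0) := by
  have hmf : ∀ n, ContDiff ℝ ∞ (mollify n f) := fun n => contDiff_mollify n (locallyIntegrable_L2 f)
  have hmg : ∀ n j, ContDiff ℝ ∞ (mollify n (g j)) := fun n j =>
    contDiff_mollify n (locallyIntegrable_L2 (g j))
  have hcd : ∀ n, ContDiff ℝ ∞ fun x => (cutoff n x : ℂ) := fun n =>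
    Complex.ofRealCLM.contDiff.comp (contDiff_cutoff n)
  refine ⟨fun n x => (cutoff n x : ℂ) * mollify n f x, fun n => ⟨(hcd n).mul (hmf n), ?_⟩,
    tendsto_cutoff_mul_mollify f, fun j => ?_⟩
  · exact HasCompactSupport.mul_right
      ((hasCompactSupport_cutoff n).comp_left (g := fun r : ℝ => (r : ℂ)) rfl)
  obtain ⟨B, hB0, hB⟩ := exists_norm_fderiv_cutoff_le
  have hcp : ∀ n x, ‖classicalPartial j (fun x => (cutoff n x : ℂ)) x‖ₑ ≤
      ENNReal.ofReal (B / ((n : ℝ) + 1)) := by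
    intro n x
    have h1 : classicalPartial j (fun x => (cutoff n x : ℂ)) x =
        ((fderiv ℝ (cutoff n) x (basisVec j) : ℝ) : ℂ) := by
      have := Complex.ofRealCLM.hasFDerivAt.comp x
        (((contDiff_cutoff n).differentiable (by norm_num)) x).hasFDerivAt
      rw [classicalPartial]
      erw [this.fderiv]
      simp
    rw [h1, ← ofReal_norm, Complex.norm_real]
    refine ENNReal.ofReal_le_ofReal (((fderiv ℝ (cutoff n) x).le_opNorm _).trans ?_)
    have : ‖basisVec j‖ = 1 := by simp [basisVec]
    rw [this, mul_one]
    exact hB n x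
  have hbound : ∀ n, ∫⁻ x, ‖classicalPartial j (fun x => (cutoff n x : ℂ) * mollify n f x) x -
      g j x‖ₑ ^ 2 ≤ 4 * ((∫⁻ x, ‖(cutoff n x : ℂ) * mollify n (g j) x - g j x‖ₑ ^ 2) +
        ENNReal.ofReal (B / ((n : ℝ) + 1)) ^ 2 * ∫⁻ x, ‖f x‖ₑ ^ 2) := by
    intro n
    calc _ ≤ ∫⁻ x, 4 * (‖(cutoff n x : ℂ) * mollify n (g j) x - g j x‖ₑ ^ 2 +
          ENNReal.ofReal (B / ((n : ℝ) + 1)) ^ 2 * ‖mollify n f x‖ₑ ^ 2) := by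
          refine lintegral_mono fun x => ?_
          rw [classicalPartial_mul (((hcd n).differentiable (by norm_num)) x)
            (((hmf n).differentiable (by norm_num)) x), (hg j).classicalPartial_mollify]
          rw [add_sub_right_comm]
          refine (enorm_add_sq_le _ _).trans ?_
          gcongr
          rw [enorm_mul, mul_pow]
          gcongr
          exact hcp n x
      _ = 4 * ((∫⁻ x, ‖(cutoff n x : ℂ) * mollify n (g j) x - g j x‖ₑ ^ 2) +
            ENNReal.ofReal (B / ((n : ℝ) + 1)) ^ 2 * ∫⁻ x, ‖mollify n f x‖ₑ ^ 2) := by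
          have m1 : Measurable fun x => ‖mollify n f x‖ₑ ^ 2 :=
            (hmf n).continuous.enorm.measurable.pow_const 2
          have m2 : Measurable fun x => ‖(cutoff n x : ℂ) * mollify n (g j) x - g j x‖ₑ ^ 2 :=
            (((hcd n).continuous.measurable.mul (hmg n j).continuous.measurable).sub
              (measurable_L2 (g j))).enorm.pow_const 2
          rw [lintegral_const_mul' _ _ (by simp), lintegral_add_left m2,
            lintegral_const_mul _ m1]
      _ ≤ _ := by
          refine mul_le_mul_right (add_le_add le_rfl (mul_le_mul_right ?_ _)) _
          exact lintegral_mollify_sq_le n (measurable_L2 f)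
  refine tendsto_of_tendsto_of_tendsto_of_le_of_le tendsto_const_nhds ?_ (fun n => zero_le) hbound
  have t1 : Tendsto (fun n : ℕ => ENNReal.ofReal (B / ((n : ℝ) + 1)) ^ 2) atTop (𝓝 0) := by
    have h1 : Tendsto (fun n : ℕ => B / ((n : ℝ) + 1)) atTop (𝓝 0) :=
      tendsto_const_nhds.div_atTop (tendsto_atTop_add_const_right _ _ tendsto_natCast_atTop_atTop)
    have h2 := (ENNReal.continuous_pow 2).continuousAt.tendsto.comp (ENNReal.tendsto_ofReal h1)
    simpa [Function.comp_def] using h2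
  have t2 := ENNReal.Tendsto.mul_const (b := ∫⁻ x, ‖f x‖ₑ ^ 2) t1 (Or.inr (lintegral_L2_ne_top f))
  have t3 := ENNReal.Tendsto.const_mul (a := 4) ((tendsto_cutoff_mul_mollify (g j)).add t2)
    (Or.inr (by simp))
  simpa using t3

end

end PeriodicSchrodinger

/-! ### Hilbert space lemmas: coercivity, self-adjointness, Lax–Milgram. -/

namespace PeriodicSchrodinger

section Abstract

variable {H : Type*} [NormedAddCommGroup H] [InnerProductSpace ℂ H]

/-- Used for an orthogonal U twice: with d the eigenvalues it gives the quadratic form of A, and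
with d = 1 the sum of the squared norms. -/
theorem sum_mul_norm_sq_eq (U : Matrix (Fin 3) (Fin 3) ℝ) (d : Fin 3 → ℝ) (w : Fin 3 → H) :
    ((∑ i, d i * ‖∑ j, (U j i : ℂ) • w j‖ ^ 2 : ℝ) : ℂ) =
      ∑ j, ∑ k, ((∑ i, U j i * d i * U k i : ℝ) : ℂ) * inner ℂ (w k) (w j) := by
  push_cast
  have : ∀ i, ((‖∑ j, (U j i : ℂ) • w j‖ : ℝ) : ℂ) ^ 2 =
      ∑ j, ∑ k, ((U j i : ℂ) * U k i) * inner ℂ (w k) (w j) := by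
    intro i
    have h : inner ℂ (∑ j, (U j i : ℂ) • w j) (∑ j, (U j i : ℂ) • w j) =
        ((‖∑ j, (U j i : ℂ) • w j‖ : ℝ) : ℂ) ^ 2 := inner_self_eq_norm_sq_to_K _
    rw [← h, inner_sum]
    refine Finset.sum_congr rfl fun j _ => ?_
    rw [sum_inner]
    refine Finset.sum_congr rfl fun k _ => ?_
    rw [inner_smul_left, inner_smul_right, Complex.conj_ofReal]
    ring
  simp only [this, Finset.mul_sum, Finset.sum_mul]
  rw [Finset.sum_comm]
  refine Finset.sum_congr rfl fun j _ => ?_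
  rw [Finset.sum_comm]
  refine Finset.sum_congr rfl fun k _ => Finset.sum_congr rfl fun i _ => ?_
  ring

/-- A positive definite matrix is coercive on tuples of vectors of a Hilbert space. -/
theorem exists_coercive_of_posDef {A : Matrix (Fin 3) (Fin 3) ℝ} (hA : A.PosDef) :
    ∃ c : ℝ, 0 < c ∧ ∀ w : Fin 3 → H,
      c * ∑ j, ‖w j‖ ^ 2 ≤ (∑ j, ∑ k, (A j k : ℂ) * inner ℂ (w k) (w j)).re := by
  set U : Matrix (Fin 3) (Fin 3) ℝ := hA.1.eigenvectorUnitary.1 with hU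
  set d := hA.1.eigenvalues with hd
  have hAe : ∀ j k, A j k = ∑ i, U j i * d i * U k i := by
    intro j k
    have h := congrFun (congrFun hA.1.spectral_theorem j) k
    rw [h]
    simp [Unitary.conjStarAlgAut_apply, Matrix.mul_apply, Matrix.diagonal_apply, hU, hd]
  have hUe : ∀ j k, ∑ i, U j i * 1 * U k i = if j = k then (1 : ℝ) else 0 := by
    intro j k
    have h : U * star U = 1 := Unitary.coe_mul_star_self hA.1.eigenvectorUnitary
    have := congrFun (congrFun h j) k
    simpa [Matrix.mul_apply, Matrix.one_apply] using this
  obtain ⟨i₀, -, hi₀⟩ := Finset.exists_min_image Finset.univ d Finset.univ_nonempty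
  refine ⟨d i₀, hA.eigenvalues_pos i₀, fun w => ?_⟩
  have h1 : ∑ j, ‖w j‖ ^ 2 = ∑ i, ‖∑ j, (U j i : ℂ) • w j‖ ^ 2 := by
    have h := sum_mul_norm_sq_eq U (fun _ => 1) w
    have h2 : ∑ j, ∑ k, ((∑ i, U j i * 1 * U k i : ℝ) : ℂ) * inner ℂ (w k) (w j) =
        ((∑ j, ‖w j‖ ^ 2 : ℝ) : ℂ) := by
      rw [Complex.ofReal_sum]
      refine Finset.sum_congr rfl fun j _ => ?_
      simp only [hUe, Complex.ofReal_pow]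
      rw [Finset.sum_eq_single j (fun b _ hb => by simp [Ne.symm hb]) (by simp)]
      simp
    rw [h2] at h
    have := Complex.ofReal_injective h
    simpa using this.symm
  have h2 := sum_mul_norm_sq_eq U d w
  simp only [← hAe] at h2
  rw [← h2, Complex.ofReal_re, h1, Finset.mul_sum]
  gcongr with i
  exact hi₀ i (Finset.mem_univ _)

variable [CompleteSpace H]

/-- A symmetric operator `T` such that `T + c` is onto for some real `c` is self-adjoint. -/
theorem isSelfAdjoint_of_symmetric_of_surjective {T : H →ₗ.[ℂ] H}
    (hs : ∀ x y : T.domain, inner ℂ (T x) (y : H) = inner ℂ (x : H) (T y)) (c : ℝ)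
    (hc : ∀ h : H, ∃ x : T.domain, T x + (c : ℂ) • (x : H) = h) : IsSelfAdjoint T := by
  have hs' : ∀ x y : T.domain, inner ℂ (T x + (c : ℂ) • (x : H)) (y : H) =
      inner ℂ (x : H) (T y + (c : ℂ) • (y : H)) := fun x y => by
    rw [inner_add_left, inner_add_right, hs, inner_smul_left, inner_smul_right, Complex.conj_ofReal]
  -- For u orthogonal to the domain, solve (T + c)w = u and (T + c)z = w. Then ⟨w, w⟩ = ⟨z, u⟩ = 0,
  -- so w = 0 and u = 0.
  have hd : Dense (T.domain : Set H) := by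
    rw [Submodule.dense_iff_topologicalClosure_eq_top, Submodule.topologicalClosure_eq_top_iff,
      Submodule.eq_bot_iff]
    intro u hu
    rw [Submodule.mem_orthogonal] at hu
    obtain ⟨w, hw⟩ := hc u
    obtain ⟨z, hz⟩ := hc w
    have h1 : inner ℂ (w : H) (w : H) = 0 := by
      calc inner ℂ (w : H) (w : H) = inner ℂ (T z + (c : ℂ) • (z : H)) (w : H) := by rw [hz]
        _ = 0 := by rw [hs', hw]; exact hu z z.2
    have h2 : (w : H) = 0 := inner_self_eq_zero.1 h1
    have h3 : w = 0 := Subtype.ext h2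
    rw [← hw, h3]; simp
  rw [LinearPMap.isSelfAdjoint_def]
  have hle : T ≤ T.adjoint := LinearPMap.IsFormalAdjoint.le_adjoint hd hs
  refine (LinearPMap.eq_of_le_of_domain_eq hle (le_antisymm hle.1 fun u hu => ?_)).symm
  have hfa := LinearPMap.adjoint_isFormalAdjoint hd
  -- With (T + c)z = (T* + c)u, the vector u - z is orthogonal to the range of T + c, which is
  -- everything; so u = z lies in the domain of T.
  obtain ⟨z, hz⟩ := hc (T.adjoint ⟨u, hu⟩ + (c : ℂ) • u)
  obtain ⟨y, hy⟩ := hc (u - z)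
  have h1 : ∀ x : T.domain, inner ℂ (u - (z : H)) (T x + (c : ℂ) • (x : H)) = 0 := by
    intro x
    have e1 := hfa ⟨u, hu⟩ x
    simp only at e1
    rw [inner_sub_left, ← hs', hz, inner_add_right, inner_add_left, ← e1, inner_smul_left,
      inner_smul_right, Complex.conj_ofReal, sub_self]
  have h2 := h1 y
  rw [hy, inner_self_eq_zero, sub_eq_zero] at h2
  rw [h2]
  exact z.2

/-- A self-adjoint operator has no proper symmetric extension. -/
theorem eq_of_isSelfAdjoint_of_le {T T' : H →ₗ.[ℂ] H} (h' : IsSelfAdjoint T')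
    (hs : ∀ x y : T.domain, inner ℂ (T x) (y : H) = inner ℂ (x : H) (T y)) (hle : T' ≤ T) :
    T' = T := by
  refine LinearPMap.eq_of_le_of_domain_eq hle (le_antisymm hle.1 fun u hu => ?_)
  have h2 : u ∈ T'.adjoint.domain := by
    refine LinearPMap.mem_adjoint_domain_of_exists _ ⟨T ⟨u, hu⟩, fun x => ?_⟩
    rw [hle.2 (x := x) (y := ⟨x, hle.1 x.2⟩) rfl]
    exact hs ⟨u, hu⟩ ⟨x, hle.1 x.2⟩
  rwa [LinearPMap.isSelfAdjoint_def.1 h'] at h2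

/-- The Lax–Milgram theorem for a bounded coercive form, linear in the first and conjugate-linear in
the second argument. -/
theorem exists_form_eq_of_coercive {B : H → H → ℂ}
    (addl : ∀ u u' v, B (u + u') v = B u v + B u' v) (addr : ∀ u v v', B u (v + v') = B u v + B u v')
    (smull : ∀ (a : ℂ) u v, B (a • u) v = a * B u v)
    (smulr : ∀ (a : ℂ) u v, B u (a • v) = conj a * B u v)
    {M : ℝ} (hM : ∀ u v, ‖B u v‖ ≤ M * ‖u‖ * ‖v‖) {c : ℝ} (hc : 0 < c)
    (hcoer : ∀ u, c * ‖u‖ ^ 2 ≤ (B u u).re) (w : H) :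
    ∃ u, ∀ v, B u v = inner ℂ v w := by
  -- Lax–Milgram is applied to the real part of B on the underlying real Hilbert space; testing with
  -- i v afterwards recovers the imaginary part.
  let _ : InnerProductSpace ℝ H := InnerProductSpace.rclikeToReal ℂ H
  have hinner : ∀ x y : H, inner ℝ x y = (inner ℂ x y).re := fun x y => rfl
  let B₀ : H →ₗ[ℝ] H →ₗ[ℝ] ℝ := LinearMap.mk₂ ℝ (fun u v => (B u v).re)
    (fun u u' v => by rw [addl, Complex.add_re])
    (fun a u v => by
      rw [← Complex.coe_smul, smull]; simp)
    (fun u v v' => by rw [addr, Complex.add_re])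
    (fun a u v => by
      rw [← Complex.coe_smul, smulr]; simp)
  let B₁ : H →L[ℝ] H →L[ℝ] ℝ := B₀.mkContinuous₂ M fun u v =>
    (Complex.abs_re_le_norm _).trans (hM u v)
  have hB₁ : ∀ u v, B₁ u v = (B u v).re := fun u v => rfl
  have hco : IsCoercive B₁ := ⟨c, hc, fun u => by
    rw [hB₁, mul_assoc, ← sq]; exact hcoer u⟩
  refine ⟨hco.continuousLinearEquivOfBilin.symm w, fun v => ?_⟩
  set u := hco.continuousLinearEquivOfBilin.symm w with hu
  have hre : ∀ v, (B u v).re = (inner ℂ v w).re := fun v => by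
    have := hco.continuousLinearEquivOfBilin_apply u v
    rw [hu, ContinuousLinearEquiv.apply_symm_apply, ← hu, hB₁, hinner] at this
    rw [← this, ← inner_conj_symm, Complex.conj_re]
  refine Complex.ext (hre v) ?_
  have := hre (Complex.I • v)
  rw [smulr, inner_smul_left] at this
  simpa using this

end Abstract

end PeriodicSchrodinger

/-! ### H¹ as a Hilbert space. -/

namespace PeriodicSchrodinger

noncomputable section

theorem L2_inner_eq (f g : L2) : inner ℂ f g = ∫ x, g x * conj (f x) :=
  integral_congr_ae (ae_of_all _ fun x => by simp [RCLike.inner_apply])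

theorem lintegral_L2_eq (f : L2) : ∫⁻ x, ‖f x‖ₑ ^ 2 = ENNReal.ofReal (‖f‖ ^ 2) := by
  have h : ‖f‖ₑ = (∫⁻ x, ‖f x‖ₑ ^ 2) ^ (1 / 2 : ℝ) := by
    rw [Lp.enorm_def, eLpNorm_eq_lintegral_rpow_enorm_toReal (by norm_num) (by norm_num)]
    simp
  rw [ENNReal.ofReal_pow (norm_nonneg _), ofReal_norm, h, ← ENNReal.rpow_natCast,
    ← ENNReal.rpow_mul]
  norm_num

namespace IsTest

variable {φ : E3 → ℂ}

theorem memLp (h : IsTest φ) : MemLp φ 2 (volume : Measure E3) :=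
  h.1.continuous.memLp_of_hasCompactSupport h.2

theorem star (h : IsTest φ) : IsTest fun x => conj (φ x) :=
  ⟨Complex.conjCLE.contDiff.comp h.1, h.2.comp_left (g := fun z : ℂ => conj z) (map_zero _)⟩

theorem partial_ (h : IsTest φ) (j : Fin 3) : IsTest (classicalPartial j φ) :=
  ⟨(h.1.fderiv_right (by norm_num)).clm_apply contDiff_const, h.2.fderiv_apply ℝ _⟩

/-- A test function as an element of `L²`. -/
def toL2 (h : IsTest φ) : L2 := h.memLp.toLp φ

theorem coe_toL2 (h : IsTest φ) : (h.toL2 : E3 → ℂ) =ᵐ[volume] φ := h.memLp.coeFn_toLp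

end IsTest

theorem integral_mul_test_eq {φ : E3 → ℂ} (h : IsTest φ) (f : L2) :
    ∫ x, f x * φ x = inner ℂ h.star.toL2 f := by
  rw [L2_inner_eq]
  refine integral_congr_ae ?_
  filter_upwards [h.star.coe_toL2] with x hx
  rw [hx]
  simp

/-- As an identity between inner products the condition is visibly linear and continuous in (f, g),
which makes the graph of the gradient a closed subspace. -/
theorem isWeakPartial_iff {j : Fin 3} {f g : L2} : IsWeakPartial j f g ↔
    ∀ (φ : E3 → ℂ) (h : IsTest φ),
      inner ℂ (h.partial_ j).star.toL2 f + inner ℂ h.star.toL2 g = 0 := by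
  refine forall_congr' fun φ => forall_congr' fun h => ?_
  rw [integral_mul_test_eq h, integral_mul_test_eq (h.partial_ j), add_eq_zero_iff_eq_neg]

theorem classicalPartial_conj {φ : E3 → ℂ} (h : IsTest φ) (j : Fin 3) (x : E3) :
    classicalPartial j (fun x => conj (φ x)) x = conj (classicalPartial j φ x) := by
  have h1 := Complex.conjCLE.toContinuousLinearMap.hasFDerivAt.comp x
    ((h.1.differentiable (by norm_num)) x).hasFDerivAt
  rw [classicalPartial]
  erw [h1.fderiv]
  rfl

/-- The classical partial derivative of a test function is its weak partial derivative. -/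
theorem IsTest.isWeakPartial {φ : E3 → ℂ} (h : IsTest φ) (j : Fin 3) :
    IsWeakPartial j h.toL2 (h.partial_ j).toL2 := by
  intro ψ hψ
  have e1 : ∫ x, h.toL2 x * classicalPartial j ψ x = ∫ x, φ x * classicalPartial j ψ x :=
    integral_congr_ae (by filter_upwards [h.coe_toL2] with x hx; rw [hx])
  have e2 : ∫ x, (h.partial_ j).toL2 x * ψ x = ∫ x, classicalPartial j φ x * ψ x :=
    integral_congr_ae (by filter_upwards [(h.partial_ j).coe_toL2] with x hx; rw [hx])
  rw [e1, e2]
  have int : ∀ {a b : E3 → ℂ}, IsTest a → IsTest b → Integrable fun x => a x * b x :=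
    fun ha hb => (ha.1.continuous.mul hb.1.continuous).integrable_of_hasCompactSupport
      (ha.2.mul_right)
  exact integral_mul_fderiv_eq_neg_fderiv_mul_of_integrable (int (h.partial_ j) hψ)
    (int h (hψ.partial_ j)) (int h hψ) (fun x _ => (h.1.differentiable (by norm_num)) x)
    (fun x _ => (hψ.1.differentiable (by norm_num)) x)

/-- The graph of the weak gradient, a closed subspace of `(L²)⁴`. -/
def gradSpace : Submodule ℂ (PiLp 2 fun _ : Fin 4 => L2) where
  carrier := {u | ∀ j : Fin 3, IsWeakPartial j (u 0) (u j.succ)}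
  zero_mem' := fun j => by
    rw [isWeakPartial_iff]; intro φ h; simp
  add_mem' := fun {u v} hu hv j => by
    have h1 := isWeakPartial_iff.1 (hu j)
    have h2 := isWeakPartial_iff.1 (hv j)
    rw [isWeakPartial_iff]
    intro φ h
    rw [PiLp.add_apply, PiLp.add_apply, inner_add_right, inner_add_right, add_add_add_comm,
      h1 φ h, h2 φ h, add_zero]
  smul_mem' := fun a u hu j => by
    have h1 := isWeakPartial_iff.1 (hu j)
    rw [isWeakPartial_iff]
    intro φ h
    rw [PiLp.smul_apply, PiLp.smul_apply, inner_smul_right, inner_smul_right, ← mul_add, h1 φ h,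
      mul_zero]

theorem isClosed_gradSpace : IsClosed (gradSpace : Set (PiLp 2 fun _ : Fin 4 => L2)) := by
  have : (gradSpace : Set (PiLp 2 fun _ : Fin 4 => L2)) = ⋂ (j : Fin 3) (φ : E3 → ℂ)
      (h : IsTest φ), {u | inner ℂ (h.partial_ j).star.toL2 (u 0) +
        inner ℂ h.star.toL2 (u j.succ) = 0} := by
    ext u
    simp only [Set.mem_iInter]
    exact forall_congr' fun j => isWeakPartial_iff
  rw [this]
  refine isClosed_iInter fun j => isClosed_iInter fun φ => isClosed_iInter fun h => ?_
  exact isClosed_eq (by fun_prop) continuous_const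

/-- The Sobolev space `H¹` as a Hilbert space, realized as the graph of the weak gradient. -/
abbrev GradSpace : Type := gradSpace

instance : CompleteSpace GradSpace := isClosed_gradSpace.completeSpace_coe

namespace GradSpace

/-- The function of an element of the graph of the weak gradient. -/
def fn (u : GradSpace) : L2 := u.1 0

/-- The partial derivatives of an element of the graph of the weak gradient. -/
def part (u : GradSpace) (j : Fin 3) : L2 := u.1 j.succ

theorem isWeakPartial (u : GradSpace) (j : Fin 3) : IsWeakPartial j u.fn (u.part j) := u.2 j

theorem fn_mem_H1 (u : GradSpace) : u.fn ∈ H1 := fun j => ⟨_, u.isWeakPartial j⟩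

theorem weakPartial_fn (u : GradSpace) (j : Fin 3) : weakPartial j u.fn = u.part j :=
  (isWeakPartial_weakPartial u.fn_mem_H1 j).unique (u.isWeakPartial j)

theorem norm_sq_eq (u : GradSpace) : ‖u‖ ^ 2 = ‖u.fn‖ ^ 2 + ∑ j, ‖u.part j‖ ^ 2 := by
  have h : ‖u‖ ^ 2 = ∑ i, ‖u.1 i‖ ^ 2 := PiLp.norm_sq_eq_of_L2 _ u.1
  rw [h, Fin.sum_univ_succ]
  rfl

theorem norm_fn_le (u : GradSpace) : ‖u.fn‖ ≤ ‖u‖ := PiLp.norm_apply_le u.1 0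

theorem norm_part_le (u : GradSpace) (j : Fin 3) : ‖u.part j‖ ≤ ‖u‖ := PiLp.norm_apply_le u.1 _

theorem fn_add (u v : GradSpace) : (u + v).fn = u.fn + v.fn := rfl

theorem fn_smul (a : ℂ) (u : GradSpace) : (a • u).fn = a • u.fn := rfl

theorem part_add (u v : GradSpace) (j : Fin 3) : (u + v).part j = u.part j + v.part j := rfl

theorem part_smul (a : ℂ) (u : GradSpace) (j : Fin 3) : (a • u).part j = a • u.part j := rfl

/-- The element of the graph of the weak gradient with given function and derivatives. -/
def mk (f : L2) (g : Fin 3 → L2) (hg : ∀ j, IsWeakPartial j f (g j)) : GradSpace :=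
  ⟨WithLp.toLp 2 (Fin.cons f g : Fin 4 → L2), hg⟩

theorem fn_mk {f : L2} {g : Fin 3 → L2} (hg : ∀ j, IsWeakPartial j f (g j)) :
    (mk f g hg).fn = f := rfl

theorem part_mk {f : L2} {g : Fin 3 → L2} (hg : ∀ j, IsWeakPartial j f (g j)) (j : Fin 3) :
    (mk f g hg).part j = g j := rfl

/-- An element of `H¹` together with its weak gradient. -/
def ofH1 {f : L2} (hf : f ∈ H1) : GradSpace := mk f (fun j => weakPartial j f)
  (isWeakPartial_weakPartial hf)

theorem fn_ofH1 {f : L2} (hf : f ∈ H1) : (ofH1 hf).fn = f := rfl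

/-- A test function together with its gradient. -/
def ofTest {φ : E3 → ℂ} (h : IsTest φ) : GradSpace := mk h.toL2 (fun j => (h.partial_ j).toL2)
  h.isWeakPartial

theorem norm_sq_toL2_sub {φ : E3 → ℂ} (h : IsTest φ) (f : L2) :
    ENNReal.ofReal (‖h.toL2 - f‖ ^ 2) = ∫⁻ x, ‖φ x - f x‖ₑ ^ 2 := by
  rw [← lintegral_L2_eq]
  refine lintegral_congr_ae ?_
  filter_upwards [Lp.coeFn_sub h.toL2 f, h.coe_toL2] with x h1 h2
  rw [h1, Pi.sub_apply, h2]

/-- Test functions are dense in the graph of the weak gradient. -/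
theorem exists_tendsto_ofTest (u : GradSpace) : ∃ (φ : ℕ → E3 → ℂ) (h : ∀ n, IsTest (φ n)),
    Tendsto (fun n => ofTest (h n)) atTop (𝓝 u) := by
  obtain ⟨φ, h, h0, hj⟩ := exists_isTest_tendsto u.isWeakPartial
  refine ⟨φ, h, ?_⟩
  have conv : ∀ (s : ℕ → L2) (f : L2), Tendsto (fun n => ENNReal.ofReal (‖s n - f‖ ^ 2)) atTop (𝓝 0) →
      Tendsto (fun n => ‖s n - f‖ ^ 2) atTop (𝓝 0) := fun s f hs => by
    have := (ENNReal.tendsto_toReal ENNReal.zero_ne_top).comp hs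
    simpa [Function.comp_def, ENNReal.toReal_ofReal] using this
  have t0 := conv (fun n => (h n).toL2) u.fn (by simpa only [norm_sq_toL2_sub] using h0)
  have tj := fun j => conv (fun n => ((h n).partial_ j).toL2) (u.part j)
    (by simpa only [norm_sq_toL2_sub] using hj j)
  rw [tendsto_iff_norm_sub_tendsto_zero]
  have hsq : Tendsto (fun n => ‖ofTest (h n) - u‖ ^ 2) atTop (𝓝 0) := by
    have := t0.add (tendsto_finsetSum Finset.univ fun j _ => tj j)
    simp only [Finset.sum_const_zero, add_zero] at this
    refine this.congr fun n => ?_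
    rw [norm_sq_eq]
    rfl
  have := hsq.sqrt
  simpa [Real.sqrt_sq] using this

end GradSpace

end

end PeriodicSchrodinger

/-! ### The quadratic form: boundedness, coercivity, resolvent equation. -/

namespace PeriodicSchrodinger

noncomputable section

/-- The potential energy `∫ |V| |f|²`. -/
def energy (V : E3 → ℝ) (f : L2) : ℝ≥0∞ := ∫⁻ x, ‖V x‖ₑ * ‖f x‖ₑ ^ 2

section Potential

variable {V : E3 → ℝ}

theorem aestronglyMeasurable_potential (hV : AEStronglyMeasurable V volume)
    (f g : L2) :
    AEStronglyMeasurable (fun x => (V x : ℂ) * f x * conj (g x)) volume :=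
  ((Complex.continuous_ofReal.comp_aestronglyMeasurable hV).mul
    (Lp.aestronglyMeasurable f)).mul
    (Complex.continuous_conj.comp_aestronglyMeasurable (Lp.aestronglyMeasurable g))

/-- Cauchy–Schwarz with |V| split as |V|^{1/2} |V|^{1/2} between f and g. -/
theorem sq_lintegral_potential_le (hV : AEStronglyMeasurable V volume)
    (f g : L2) :
    (∫⁻ x, ‖(V x : ℂ) * f x * conj (g x)‖ₑ) ^ 2 ≤ energy V f * energy V g := by
  have hm : AEMeasurable (fun x => ‖V x‖ₑ ^ (1 / 2 : ℝ)) volume := hV.enorm.pow_const _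
  have hsq : ∀ r : ℝ≥0∞, r ^ (1 / 2 : ℝ) * r ^ (1 / 2 : ℝ) = r := fun r => by
    rw [← ENNReal.rpow_add_of_nonneg _ _ (by norm_num) (by norm_num)]; norm_num
  have e1 : ∀ x, ‖(V x : ℂ) * f x * conj (g x)‖ₑ =
      (‖V x‖ₑ ^ (1 / 2 : ℝ) * ‖f x‖ₑ) * (‖V x‖ₑ ^ (1 / 2 : ℝ) * ‖g x‖ₑ) := fun x => by
    have h1 : ‖(V x : ℂ)‖ₑ = ‖V x‖ₑ := by
      rw [← ofReal_norm, ← ofReal_norm, Complex.norm_real]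
    have h2 : ‖conj (g x)‖ₑ = ‖g x‖ₑ := by
      rw [← ofReal_norm, ← ofReal_norm, RCLike.norm_conj]
    rw [enorm_mul, enorm_mul, h1, h2, mul_mul_mul_comm, hsq, mul_assoc]
  have e2 : ∀ u : L2, energy V u = ∫⁻ x, (‖V x‖ₑ ^ (1 / 2 : ℝ) * ‖u x‖ₑ) ^ 2 := fun u => by
    refine lintegral_congr fun x => ?_
    rw [mul_pow, sq (‖V x‖ₑ ^ (1 / 2 : ℝ)), hsq]
  simp only [e1, e2]
  exact sq_lintegral_mul_le (hm.mul (measurable_L2 f).enorm.aemeasurable)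
    (hm.mul (measurable_L2 g).enorm.aemeasurable)

theorem integrable_potential (hV : AEStronglyMeasurable V volume)
    {f g : L2} (hf : energy V f ≠ ⊤) (hg : energy V g ≠ ⊤) :
    Integrable (fun x => (V x : ℂ) * f x * conj (g x)) volume := by
  refine ⟨aestronglyMeasurable_potential hV f g, ?_⟩
  have h := sq_lintegral_potential_le hV f g
  rw [HasFiniteIntegral, lt_top_iff_ne_top]
  intro ht
  rw [ht, ENNReal.top_pow two_ne_zero, top_le_iff] at h
  exact ENNReal.mul_ne_top hf hg h

theorem norm_integral_potential_le (hV : AEStronglyMeasurable V volume)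
    {f g : L2} {b c : ℝ} (hb : 0 ≤ b) (hc : 0 ≤ c)
    (hf : energy V f ≤ ENNReal.ofReal (b ^ 2)) (hg : energy V g ≤ ENNReal.ofReal (c ^ 2)) :
    ‖∫ x, (V x : ℂ) * f x * conj (g x)‖ ≤ b * c := by
  have h : ENNReal.ofReal (‖∫ x, (V x : ℂ) * f x * conj (g x)‖ ^ 2) ≤
      ENNReal.ofReal ((b * c) ^ 2) := by
    calc _ = ‖∫ x, (V x : ℂ) * f x * conj (g x)‖ₑ ^ 2 := by
          rw [ENNReal.ofReal_pow (norm_nonneg _), ofReal_norm]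
      _ ≤ (∫⁻ x, ‖(V x : ℂ) * f x * conj (g x)‖ₑ) ^ 2 := by
          gcongr; exact enorm_integral_le_lintegral_enorm _
      _ ≤ energy V f * energy V g := sq_lintegral_potential_le hV f g
      _ ≤ ENNReal.ofReal (b ^ 2) * ENNReal.ofReal (c ^ 2) := by gcongr
      _ = _ := by rw [← ENNReal.ofReal_mul (by positivity), mul_pow]
  rw [ENNReal.ofReal_le_ofReal_iff (by positivity)] at h
  exact (pow_le_pow_iff_left₀ (norm_nonneg _) (by positivity) two_ne_zero).1 h

end Potential

/-- The form `q` on the graph of the weak gradient. -/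
def gradForm (A : Matrix (Fin 3) (Fin 3) ℝ) (V : E3 → ℝ) (u v : GradSpace) : ℂ :=
  (∑ j, ∑ k, (A j k : ℂ) * inner ℂ (v.part k) (u.part j)) +
    ∫ x, (V x : ℂ) * u.fn x * conj (v.fn x)

theorem integrable_L2_mul_conj (f g : L2) : Integrable (fun x => f x * conj (g x)) volume := by
  have := L2.integrable_inner (𝕜 := ℂ) g f
  refine this.congr (ae_of_all _ fun x => ?_)
  simp [RCLike.inner_apply]

theorem form_eq_gradForm {A : Matrix (Fin 3) (Fin 3) ℝ} {V : E3 → ℝ} {u v : GradSpace}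
    (h : Integrable (fun x => (V x : ℂ) * u.fn x * conj (v.fn x)) volume) :
    form A V u.fn v.fn = gradForm A V u v := by
  have hD : ∀ (w : GradSpace) j, ∀ᵐ x, weakD j w.fn x = -Complex.I * w.part j x := fun w j => by
    rw [weakD, w.weakPartial_fn]
    filter_upwards [Lp.coeFn_smul (-Complex.I) (w.part j)] with x hx
    rw [hx]; rfl
  have hae : ∀ᵐ x, ((∑ k, (∑ j, weakD j u.fn x * (A j k : ℂ)) * conj (weakD k v.fn x))
      + (V x : ℂ) * u.fn x * conj (v.fn x)) =
      (∑ j, ∑ k, (A j k : ℂ) * (u.part j x * conj (v.part k x))) +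
        (V x : ℂ) * u.fn x * conj (v.fn x) := by
    filter_upwards [ae_all_iff.2 (hD u), ae_all_iff.2 (hD v)] with x h1 h2
    congr 1
    simp only [h1, h2, Finset.sum_mul]
    rw [Finset.sum_comm]
    refine Finset.sum_congr rfl fun j _ => Finset.sum_congr rfl fun k _ => ?_
    rw [map_mul, map_neg, Complex.conj_I]
    linear_combination (-(A j k : ℂ) * u.part j x * conj (v.part k x)) * Complex.I_mul_I
  have hint : ∀ j k, Integrable (fun x => (A j k : ℂ) * (u.part j x * conj (v.part k x))) volume :=
    fun j k => (integrable_L2_mul_conj _ _).const_mul _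
  rw [form, integral_congr_ae hae, integral_add _ h, gradForm]
  · congr 1
    rw [integral_finsetSum _ fun j _ => integrable_finsetSum _ fun k _ => hint j k]
    refine Finset.sum_congr rfl fun j _ => ?_
    rw [integral_finsetSum _ fun k _ => hint j k]
    refine Finset.sum_congr rfl fun k _ => ?_
    rw [integral_const_mul, L2_inner_eq]
  · exact integrable_finsetSum _ fun j _ => integrable_finsetSum _ fun k _ => hint j k

theorem gradForm_conj {A : Matrix (Fin 3) (Fin 3) ℝ} (hA : ∀ j k, A j k = A k j) {V : E3 → ℝ}
    (u v : GradSpace) : conj (gradForm A V u v) = gradForm A V v u := by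
  simp only [gradForm, map_add, map_sum, map_mul, Complex.conj_ofReal, inner_conj_symm]
  congr 1
  · rw [Finset.sum_comm]
    exact Finset.sum_congr rfl fun j _ => Finset.sum_congr rfl fun k _ => by rw [hA]
  · rw [← integral_conj]
    refine integral_congr_ae (ae_of_all _ fun x => ?_)
    simp only [map_mul, Complex.conj_ofReal, Complex.conj_conj]
    ring

/-- The property that the form of the potential is bounded on `H¹`, with relative bound `a`. -/
structure FormBound (V : E3 → ℝ) (a N : ℝ) : Prop where
  aestronglyMeasurable : AEStronglyMeasurable V volume
  nonneg_left : 0 ≤ a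
  nonneg_right : 0 ≤ N
  energy_le : ∀ u : GradSpace, energy V u.fn ≤ ENNReal.ofReal (a * ‖u‖ ^ 2 + N * ‖u.fn‖ ^ 2)

namespace FormBound

variable {A : Matrix (Fin 3) (Fin 3) ℝ} {V : E3 → ℝ} {a N : ℝ}

theorem integrable (hb : FormBound V a N)
    (u v : GradSpace) :
    Integrable (fun x => (V x : ℂ) * u.fn x * conj (v.fn x)) volume :=
  integrable_potential hb.aestronglyMeasurable
    (ne_top_of_le_ne_top ENNReal.ofReal_ne_top (hb.energy_le u))
    (ne_top_of_le_ne_top ENNReal.ofReal_ne_top (hb.energy_le v))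

theorem gradForm_add_left (hb : FormBound V a N)
    (u u' v : GradSpace) :
    gradForm A V (u + u') v = gradForm A V u v + gradForm A V u' v := by
  have h : ∫ x, (V x : ℂ) * (u + u').fn x * conj (v.fn x) =
      (∫ x, (V x : ℂ) * u.fn x * conj (v.fn x)) + ∫ x, (V x : ℂ) * u'.fn x * conj (v.fn x) := by
    rw [← integral_add (hb.integrable u v) (hb.integrable u' v)]
    refine integral_congr_ae ?_
    filter_upwards [Lp.coeFn_add u.fn u'.fn] with x hx
    rw [GradSpace.fn_add, hx, Pi.add_apply]
    ring
  simp only [gradForm, h, GradSpace.part_add, inner_add_right, mul_add, Finset.sum_add_distrib]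
  ring

theorem gradForm_smul_left (c : ℂ) (u v : GradSpace) :
    gradForm A V (c • u) v = c * gradForm A V u v := by
  have h : ∫ x, (V x : ℂ) * (c • u).fn x * conj (v.fn x) =
      c * ∫ x, (V x : ℂ) * u.fn x * conj (v.fn x) := by
    rw [← integral_const_mul]
    refine integral_congr_ae ?_
    filter_upwards [Lp.coeFn_smul c u.fn] with x hx
    rw [GradSpace.fn_smul, hx, Pi.smul_apply, smul_eq_mul]
    ring
  simp only [gradForm, h, GradSpace.part_smul, inner_smul_right, mul_add, Finset.mul_sum]
  congr 1
  exact Finset.sum_congr rfl fun j _ => Finset.sum_congr rfl fun k _ => by ring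

theorem gradForm_add_right (hb : FormBound V a N)
    (hA : ∀ j k, A j k = A k j) (u v v' : GradSpace) :
    gradForm A V u (v + v') = gradForm A V u v + gradForm A V u v' := by
  rw [← gradForm_conj hA, hb.gradForm_add_left, map_add, gradForm_conj hA, gradForm_conj hA]

theorem gradForm_smul_right (hA : ∀ j k, A j k = A k j) (c : ℂ) (u v : GradSpace) :
    gradForm A V u (c • v) = conj c * gradForm A V u v := by
  rw [← gradForm_conj hA, gradForm_smul_left, map_mul, gradForm_conj hA]

theorem norm_gradForm_le (hb : FormBound V a N)
    (u v : GradSpace) :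
    ‖gradForm A V u v‖ ≤ ((∑ j, ∑ k, |A j k|) + (a + N)) * ‖u‖ * ‖v‖ := by
  have ha := hb.nonneg_left
  have hN := hb.nonneg_right
  have hE : ∀ u : GradSpace, energy V u.fn ≤ ENNReal.ofReal ((Real.sqrt (a + N) * ‖u‖) ^ 2) := by
    intro u
    refine (hb.energy_le u).trans (ENNReal.ofReal_le_ofReal ?_)
    rw [mul_pow, Real.sq_sqrt (by positivity), add_mul]
    have := pow_le_pow_left₀ (norm_nonneg _) u.norm_fn_le 2
    gcongr
  have h1 := norm_integral_potential_le hb.aestronglyMeasurable (by positivity) (by positivity)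
    (hE u) (hE v)
  have h2 : ‖∑ j, ∑ k, (A j k : ℂ) * inner ℂ (v.part k) (u.part j)‖ ≤
      (∑ j, ∑ k, |A j k|) * (‖u‖ * ‖v‖) := by
    rw [Finset.sum_mul]
    refine (norm_sum_le _ _).trans (Finset.sum_le_sum fun j _ => ?_)
    rw [Finset.sum_mul]
    refine (norm_sum_le _ _).trans (Finset.sum_le_sum fun k _ => ?_)
    rw [norm_mul, Complex.norm_real, Real.norm_eq_abs]
    gcongr
    refine (norm_inner_le_norm _ _).trans ?_
    rw [mul_comm]
    exact mul_le_mul (u.norm_part_le j) (v.norm_part_le k) (norm_nonneg _) (norm_nonneg _)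
  calc ‖gradForm A V u v‖ ≤ _ + _ := norm_add_le _ _
    _ ≤ (∑ j, ∑ k, |A j k|) * (‖u‖ * ‖v‖) + Real.sqrt (a + N) * ‖u‖ * (Real.sqrt (a + N) * ‖v‖) :=
        add_le_add h2 h1
    _ = (∑ j, ∑ k, |A j k|) * (‖u‖ * ‖v‖) +
          (Real.sqrt (a + N) * Real.sqrt (a + N)) * (‖u‖ * ‖v‖) := by ring
    _ = _ := by rw [Real.mul_self_sqrt (by positivity)]; ring

/-- A Gårding inequality: the potential can take away at most a‖u‖² + N‖u.fn‖² from the elliptic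
part, which controls the gradient with constant c. For a < c a shift by c + N makes the form
coercive. -/
theorem gradForm_coercive (hb : FormBound V a N)
    {c : ℝ} (hc : ∀ w : Fin 3 → L2,
    c * ∑ j, ‖w j‖ ^ 2 ≤ (∑ j, ∑ k, (A j k : ℂ) * inner ℂ (w k) (w j)).re) (u : GradSpace) :
    (c - a) * ‖u‖ ^ 2 ≤ (gradForm A V u u).re + (c + N) * ‖u.fn‖ ^ 2 := by
  have ha := hb.nonneg_left
  have hN := hb.nonneg_right
  have h1 := hc u.part
  set t := Real.sqrt (a * ‖u‖ ^ 2 + N * ‖u.fn‖ ^ 2) with ht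
  have ht2 : t * t = a * ‖u‖ ^ 2 + N * ‖u.fn‖ ^ 2 := Real.mul_self_sqrt (by positivity)
  have hE : energy V u.fn ≤ ENNReal.ofReal (t ^ 2) := by
    rw [sq, ht2]; exact hb.energy_le u
  have h2 := norm_integral_potential_le hb.aestronglyMeasurable (Real.sqrt_nonneg _)
    (Real.sqrt_nonneg _) hE hE
  rw [← ht, ht2] at h2
  have h3 := (abs_le.1 ((Complex.abs_re_le_norm _).trans h2)).1
  have h4 := u.norm_sq_eq
  rw [gradForm, Complex.add_re]
  have h5 : ∑ j, ‖u.part j‖ ^ 2 = ‖u‖ ^ 2 - ‖u.fn‖ ^ 2 := by linarith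
  rw [h5] at h1
  linarith

end FormBound

namespace GradSpace

/-- The embedding of `H¹` into `L²`. -/
def fnL : GradSpace →L[ℂ] L2 :=
  LinearMap.mkContinuous ⟨⟨fn, fn_add⟩, fn_smul⟩ 1 fun u => by
    rw [one_mul]; exact u.norm_fn_le

theorem fnL_apply (u : GradSpace) : fnL u = u.fn := rfl

/-- A function in `L²` that is orthogonal to `H¹` vanishes. -/
theorem eq_zero_of_inner_fn_eq_zero {h : L2} (hh : ∀ v : GradSpace, inner ℂ v.fn h = 0) :
    h = 0 := by
  have key : ∀ᵐ x ∂(volume : Measure E3), (h : E3 → ℂ) x = 0 := by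
    refine ae_eq_zero_of_integral_contDiff_smul_eq_zero (locallyIntegrable_L2 h) ?_
    intro ρ hρ hc
    have ht : IsTest (fun x => (ρ x : ℂ)) :=
      ⟨Complex.ofRealCLM.contDiff.comp hρ, hc.comp_left (g := fun r : ℝ => (r : ℂ)) rfl⟩
    have := hh (ofTest ht.star)
    rw [ofTest, fn_mk, ← integral_mul_test_eq ht] at this
    rw [← this]
    exact integral_congr_ae (ae_of_all _ fun x => by simp [mul_comm])
  exact (Lp.eq_zero_iff_ae_eq_zero).2 key

/-- Weak derivatives are unique, so an element of the graph is determined by its function. -/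
theorem fn_injective : Function.Injective fn := by
  intro u v h
  refine Subtype.ext (PiLp.ext fun i => ?_)
  refine Fin.cases h (fun j => ?_) i
  have hu := u.weakPartial_fn j
  have hv := v.weakPartial_fn j
  rw [h, hv] at hu
  exact hu.symm

end GradSpace

namespace FormBound

variable {A : Matrix (Fin 3) (Fin 3) ℝ} {V : E3 → ℝ} {a N : ℝ}

/-- The resolvent equation of the form. -/
theorem exists_gradForm_add_eq (hb : FormBound V a N)
    (hA : ∀ j k, A j k = A k j) {c : ℝ} (hac : a < c)
    (hc : ∀ w : Fin 3 → L2,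
      c * ∑ j, ‖w j‖ ^ 2 ≤ (∑ j, ∑ k, (A j k : ℂ) * inner ℂ (w k) (w j)).re) (h : L2) :
    ∃ u : GradSpace, ∀ v : GradSpace,
      gradForm A V u v + ((c + N : ℝ) : ℂ) * inner ℂ v.fn u.fn = inner ℂ v.fn h := by
  have hN := hb.nonneg_right
  have hc0 : 0 < c := hb.nonneg_left.trans_lt hac
  obtain ⟨u, hu⟩ := exists_form_eq_of_coercive
    (B := fun u v : GradSpace => gradForm A V u v + ((c + N : ℝ) : ℂ) * inner ℂ v.fn u.fn)
    (fun u u' v => by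
      rw [hb.gradForm_add_left, GradSpace.fn_add, inner_add_right]; ring)
    (fun u v v' => by
      rw [hb.gradForm_add_right hA, GradSpace.fn_add, inner_add_left]; ring)
    (fun r u v => by
      rw [gradForm_smul_left, GradSpace.fn_smul, inner_smul_right]; ring)
    (fun r u v => by
      rw [gradForm_smul_right hA, GradSpace.fn_smul, inner_smul_left]; ring)
    (M := ((∑ j, ∑ k, |A j k|) + (a + N)) + (c + N))
    (fun u v => by
      have h1 := hb.norm_gradForm_le (A := A) u v
      have h2 : ‖((c + N : ℝ) : ℂ) * inner ℂ v.fn u.fn‖ ≤ (c + N) * (‖u‖ * ‖v‖) := by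
        rw [norm_mul, Complex.norm_real, Real.norm_of_nonneg (by positivity)]
        gcongr
        refine (norm_inner_le_norm _ _).trans ?_
        rw [mul_comm]
        exact mul_le_mul u.norm_fn_le v.norm_fn_le (norm_nonneg _) (norm_nonneg _)
      refine (norm_add_le _ _).trans ((add_le_add h1 h2).trans (le_of_eq (by ring))))
    (c := c - a) (sub_pos.2 hac)
    (fun u => by
      have h1 := hb.gradForm_coercive hc u
      have h2 : (((c + N : ℝ) : ℂ) * inner ℂ u.fn u.fn).re = (c + N) * ‖u.fn‖ ^ 2 := by
        rw [Complex.re_ofReal_mul, ← inner_self_eq_norm_sq (𝕜 := ℂ)]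
        rfl
      rw [Complex.add_re, h2]
      exact h1)
    -- Lax–Milgram represents functionals by the H¹ inner product; the adjoint of the embedding
    -- turns v ↦ ⟨v.fn, h⟩ into this form.
    (ContinuousLinearMap.adjoint GradSpace.fnL h)
  refine ⟨u, fun v => ?_⟩
  rw [hu v, ContinuousLinearMap.adjoint_inner_right, GradSpace.fnL_apply]

/-- The graph of the operator of the form. -/
def operatorGraph (A : Matrix (Fin 3) (Fin 3) ℝ) (hb : FormBound V a N) : Submodule ℂ (L2 × L2) where
  carrier := {p | ∃ u : GradSpace, u.fn = p.1 ∧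
    ∀ v : GradSpace, gradForm A V u v = inner ℂ v.fn p.2}
  zero_mem' := ⟨0, rfl, fun v => by
    have := gradForm_smul_left (A := A) (V := V) 0 0 v
    rw [zero_smul, zero_mul] at this
    rw [this]; simp⟩
  add_mem' := by
    rintro p p' ⟨u, hu, h⟩ ⟨u', hu', h'⟩
    refine ⟨u + u', by rw [GradSpace.fn_add, hu, hu']; rfl, fun v => ?_⟩
    rw [hb.gradForm_add_left, h, h', ← inner_add_right]; rfl
  smul_mem' := by
    rintro r p ⟨u, hu, h⟩
    refine ⟨r • u, by rw [GradSpace.fn_smul, hu]; rfl, fun v => ?_⟩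
    rw [gradForm_smul_left, h, ← inner_smul_right]; rfl

end FormBound

end

end PeriodicSchrodinger

/-! ### The operator of the form and its distributional description. -/

namespace PeriodicSchrodinger

noncomputable section

theorem enorm_le_enorm_largePart_add (V : E3 → ℝ) (N : ℝ) (x : E3) :
    ‖V x‖ₑ ≤ ‖largePart V N x‖ₑ + ENNReal.ofReal N := by
  by_cases hx : N < |V x|
  · rw [largePart, Set.indicator_of_mem (by exact hx)]
    exact le_self_add
  · refine le_add_left ?_
    rw [← ofReal_norm]
    exact ENNReal.ofReal_le_ofReal (not_lt.1 hx)

theorem FormBound.of_kermanSawyerNorm_le {V : E3 → ℝ} (hV : LocallyIntegrable V volume)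
    (hper : IsLatticePeriodic V) {N ε : ℝ} (hN : 0 ≤ N) (hε : 0 < ε)
    (hK : kermanSawyerNorm (cell.indicator (largePart V N)) ≤ ENNReal.ofReal ε) :
    FormBound V (25165824 * ε) N where
  aestronglyMeasurable := hV.aestronglyMeasurable
  nonneg_left := by positivity
  nonneg_right := hN
  energy_le u := by
    have h := lintegral_largePart_mul_sq_le_of_mem_H1 hV hper hε hK u.isWeakPartial
    simp only [lintegral_L2_eq] at h
    rw [← ENNReal.ofReal_sum_of_nonneg fun j _ => by positivity,
      ← ENNReal.ofReal_add (by positivity) (by positivity), ← u.norm_sq_eq,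
      ← ENNReal.ofReal_mul (by positivity)] at h
    have hm : Measurable fun x => ‖u.fn x‖ₑ ^ 2 := (measurable_L2 u.fn).enorm.pow_const 2
    calc energy V u.fn
        ≤ ∫⁻ x, (‖largePart V N x‖ₑ * ‖u.fn x‖ₑ ^ 2 + ENNReal.ofReal N * ‖u.fn x‖ₑ ^ 2) := by
          refine lintegral_mono fun x => ?_
          rw [← add_mul]
          gcongr
          exact enorm_le_enorm_largePart_add V N x
      _ = (∫⁻ x, ‖largePart V N x‖ₑ * ‖u.fn x‖ₑ ^ 2) + ENNReal.ofReal (N * ‖u.fn‖ ^ 2) := by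
          rw [lintegral_add_right _ (hm.const_mul _), lintegral_const_mul _ hm, lintegral_L2_eq,
            ← ENNReal.ofReal_mul hN]
      _ ≤ ENNReal.ofReal (25165824 * ε * ‖u‖ ^ 2) + ENNReal.ofReal (N * ‖u.fn‖ ^ 2) := by gcongr
      _ = _ := (ENNReal.ofReal_add (by positivity) (by positivity)).symm

/-- A strict bound on the limsup holds at all large N, and a single N ≥ 0 is enough. -/
theorem SmallLargeParts.exists_formBound {V : E3 → ℝ} {ε : ℝ} (h : SmallLargeParts V ε)
    (hV : LocallyIntegrable V volume) (hper : IsLatticePeriodic V) (hε : 0 < ε) :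
    ∃ N, FormBound V (25165824 * ε) N := by
  obtain ⟨N, h1, h2⟩ := ((eventually_lt_of_limsup_lt h).and (eventually_ge_atTop 0)).exists
  exact ⟨N, .of_kermanSawyerNorm_le hV hper h2 hε h1.le⟩

theorem classicalPartial_const_mul {φ : E3 → ℂ} (h : IsTest φ) (c : ℂ) (j : Fin 3) (x : E3) :
    classicalPartial j (fun x => c * φ x) x = c * classicalPartial j φ x := by
  rw [classicalPartial, fderiv_const_mul ((h.1.differentiable (by norm_num)) x)]
  rfl

theorem classicalD_classicalD {φ : E3 → ℂ} (h : IsTest φ) (j k : Fin 3) (x : E3) :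
    classicalD k (classicalD j φ) x = -classicalPartial k (classicalPartial j φ) x := by
  have e : classicalD j φ = fun x => -Complex.I * classicalPartial j φ x := rfl
  rw [classicalD, e, classicalPartial_const_mul (h.partial_ j)]
  linear_combination classicalPartial k (classicalPartial j φ) x * Complex.I_mul_I

theorem IsTest.toL2_congr {φ ψ : E3 → ℂ} (h : IsTest φ) (h' : IsTest ψ) (e : φ = ψ) :
    h.toL2 = h'.toL2 := by
  subst e; rfl

theorem GradSpace.ofTest_congr {φ ψ : E3 → ℂ} (h : IsTest φ) (h' : IsTest ψ) (e : φ = ψ) :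
    ofTest h = ofTest h' := by
  subst e; rfl

/-- The distribution `(D A Dᵀ + V) u`, tested against `φ`, is the form at `u` and `conj φ`. -/
theorem distribution_eq_gradForm {A : Matrix (Fin 3) (Fin 3) ℝ} (hA : ∀ j k, A j k = A k j)
    (V : E3 → ℝ) (u : GradSpace) {φ : E3 → ℂ} (h : IsTest φ) :
    (∑ j, ∑ k, (A j k : ℂ) * ∫ x, u.fn x * classicalD k (classicalD j φ) x)
      + ∫ x, (V x : ℂ) * u.fn x * φ x = gradForm A V u (GradSpace.ofTest h.star) := by
  rw [gradForm]
  congr 1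
  · rw [Finset.sum_comm]
    refine Finset.sum_congr rfl fun j _ => Finset.sum_congr rfl fun k _ => ?_
    rw [hA k j, GradSpace.ofTest, GradSpace.part_mk]
    congr 1
    -- The two factors -i give -∂_k∂_j. Only one derivative is moved onto u; the other stays on the
    -- test function.
    simp only [classicalD_classicalD h, mul_neg]
    rw [integral_neg, u.isWeakPartial j _ (h.partial_ k), neg_neg,
      integral_mul_test_eq (h.partial_ k)]
    rw [IsTest.toL2_congr (h.partial_ k).star (h.star.partial_ k)
      (funext fun x => (classicalPartial_conj h k x).symm)]
  · refine integral_congr_ae ?_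
    filter_upwards [h.star.coe_toL2] with x hx
    rw [GradSpace.ofTest, GradSpace.fn_mk, hx, Complex.conj_conj]

namespace FormBound

variable {A : Matrix (Fin 3) (Fin 3) ℝ} {V : E3 → ℝ} {a N : ℝ}

/-- Near any point V u coincides with the integrand V u conj(b) of the form, where b is a bump
function equal to one on a ball. -/
theorem locallyIntegrable (hb : FormBound V a N) (u : GradSpace) :
    LocallyIntegrable (fun x => (V x : ℂ) * u.fn x) volume := by
  intro x
  let b : ContDiffBump x := ⟨1, 2, one_pos, one_lt_two⟩
  have ht : IsTest fun y => (b y : ℂ) :=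
    ⟨Complex.ofRealCLM.contDiff.comp b.contDiff,
      b.hasCompactSupport.comp_left (g := fun r : ℝ => (r : ℂ)) rfl⟩
  refine ⟨Metric.closedBall x 1, Metric.closedBall_mem_nhds x one_pos, ?_⟩
  refine (hb.integrable u (GradSpace.ofTest ht)).integrableOn.congr ?_
  filter_upwards [ae_restrict_of_ae ht.coe_toL2,
    ae_restrict_mem Metric.isClosed_closedBall.measurableSet] with y h1 h2
  rw [GradSpace.ofTest, GradSpace.fn_mk, h1, b.one_of_mem_closedBall h2]
  simp

theorem tendsto_gradForm_right (hb : FormBound V a N) (hA : ∀ j k, A j k = A k j)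
    (u : GradSpace) {s : ℕ → GradSpace} {v : GradSpace} (hs : Tendsto s atTop (𝓝 v)) :
    Tendsto (fun n => gradForm A V u (s n)) atTop (𝓝 (gradForm A V u v)) := by
  rw [tendsto_iff_norm_sub_tendsto_zero] at hs ⊢
  refine squeeze_zero (fun n => norm_nonneg _) (fun n => ?_)
    (by simpa using hs.const_mul (((∑ j, ∑ k, |A j k|) + (a + N)) * ‖u‖))
  have h := hb.gradForm_add_right hA u (s n - v) v
  rw [sub_add_cancel] at h
  rw [h, add_sub_cancel_right]
  exact hb.norm_gradForm_le u _

/-- The distributional and the weak formulation agree on `H¹`. -/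
theorem distributionalEq_iff (hb : FormBound V a N) (hA : ∀ j k, A j k = A k j) (u : GradSpace)
    (h : L2) : DistributionalEq A V u.fn h ↔
      ∀ v : GradSpace, gradForm A V u v = inner ℂ v.fn h := by
  constructor
  · rintro ⟨-, hd⟩ v
    obtain ⟨φ, ht, hφ⟩ := v.exists_tendsto_ofTest
    have key : ∀ n, gradForm A V u (GradSpace.ofTest (ht n)) =
        inner ℂ (GradSpace.ofTest (ht n)).fn h := fun n => by
      rw [GradSpace.ofTest_congr (ht n) (ht n).star.star
        (funext fun x => (Complex.conj_conj _).symm), ← distribution_eq_gradForm hA V u (ht n).star,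
        hd _ (ht n).star, integral_mul_test_eq (ht n).star]
      rfl
    have h1 := hb.tendsto_gradForm_right hA u hφ
    have h2 := ((GradSpace.fnL.continuous.tendsto v).comp hφ).inner
      (tendsto_const_nhds (x := h)) (𝕜 := ℂ)
    exact tendsto_nhds_unique (h1.congr key) h2
  · intro hu
    refine ⟨hb.locallyIntegrable u, fun φ ht => ?_⟩
    rw [distribution_eq_gradForm hA V u ht, hu, integral_mul_test_eq ht]
    rfl

/-- The operator of the form. -/
def operator (A : Matrix (Fin 3) (Fin 3) ℝ) (hb : FormBound V a N) : L2 →ₗ.[ℂ] L2 :=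
  (hb.operatorGraph A).toLinearPMap

/-- The relation is single-valued: a pair with first entry zero comes from u = 0, so its second
entry is orthogonal to H¹, which is dense in L². -/
theorem graph_operator (hb : FormBound V a N) : (hb.operator A).graph = hb.operatorGraph A := by
  refine Submodule.toLinearPMap_graph_eq _ ?_
  rintro p ⟨u, hu, h⟩ hp
  have hu0 : u = 0 := GradSpace.fn_injective (hu.trans hp)
  refine GradSpace.eq_zero_of_inner_fn_eq_zero fun v => ?_
  have h0 := gradForm_smul_left (A := A) (V := V) 0 0 v
  rw [zero_smul, zero_mul] at h0
  rw [← h v, hu0, h0]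

theorem exists_gradForm_operator_eq (hb : FormBound V a N) (f : (hb.operator A).domain) :
    ∃ u : GradSpace, u.fn = f ∧
      ∀ v : GradSpace, gradForm A V u v = inner ℂ v.fn (hb.operator A f) := by
  have h := (hb.operator A).mem_graph f
  rwa [graph_operator] at h

theorem exists_operator_eq (hb : FormBound V a N) {u : GradSpace} {h : L2}
    (hu : ∀ v : GradSpace, gradForm A V u v = inner ℂ v.fn h) :
    ∃ f : (hb.operator A).domain, (f : L2) = u.fn ∧ hb.operator A f = h := by
  have : (u.fn, h) ∈ (hb.operator A).graph := by
    rw [graph_operator]; exact ⟨u, rfl, hu⟩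
  exact (LinearPMap.mem_graph_iff _).1 this

theorem operator_symmetric (hb : FormBound V a N) (hA : ∀ j k, A j k = A k j)
    (f g : (hb.operator A).domain) :
    inner ℂ (hb.operator A f) (g : L2) = inner ℂ (f : L2) (hb.operator A g) := by
  obtain ⟨u, hu, h⟩ := hb.exists_gradForm_operator_eq f
  obtain ⟨v, hv, h'⟩ := hb.exists_gradForm_operator_eq g
  rw [← hu, ← h', ← gradForm_conj hA, h, hv, inner_conj_symm]

/-- The resolvent equation at the real shift c + N makes the shifted symmetric operator onto. -/
theorem isSelfAdjoint_operator (hb : FormBound V a N) (hA : ∀ j k, A j k = A k j) {c : ℝ}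
    (hac : a < c) (hc : ∀ w : Fin 3 → L2,
      c * ∑ j, ‖w j‖ ^ 2 ≤ (∑ j, ∑ k, (A j k : ℂ) * inner ℂ (w k) (w j)).re) :
    IsSelfAdjoint (hb.operator A) := by
  refine isSelfAdjoint_of_symmetric_of_surjective (hb.operator_symmetric hA) (c + N) fun h => ?_
  obtain ⟨u, hu⟩ := hb.exists_gradForm_add_eq hA hac hc h
  obtain ⟨f, hf, hf'⟩ := hb.exists_operator_eq (A := A) (u := u)
    (h := h - ((c + N : ℝ) : ℂ) • u.fn) fun v => by
      rw [inner_sub_right, inner_smul_right, ← hu v, add_sub_cancel_right]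
  exact ⟨f, by rw [hf, hf', sub_add_cancel]⟩

/-- The relation contains every pair allowed by the form identity, so any operator representing the
form is a restriction of `operator`. -/
theorem form_eq_inner_iff (hb : FormBound V a N) {f h : L2} :
    (f ∈ H1 ∧ ∀ g ∈ H1, form A V f g = ∫ x, h x * conj (g x)) ↔ (f, h) ∈ hb.operatorGraph A := by
  constructor
  · rintro ⟨hf, hg⟩
    refine ⟨.ofH1 hf, rfl, fun v => ?_⟩
    rw [← form_eq_gradForm (hb.integrable _ _), L2_inner_eq]
    exact hg _ v.fn_mem_H1
  · rintro ⟨u, rfl, hu⟩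
    refine ⟨u.fn_mem_H1, fun g hg => ?_⟩
    rw [← L2_inner_eq, ← GradSpace.fn_ofH1 hg, form_eq_gradForm (hb.integrable _ _)]
    exact hu _

end FormBound

end

end PeriodicSchrodinger

/-! ### Existence, uniqueness, action and domain of the operator. -/

open PeriodicSchrodinger in
theorem theorem1p1 (A : Matrix (Fin 3) (Fin 3) ℝ) (hA : A.PosDef) :
    ∃ ε : ℝ, 0 < ε ∧ ∀ V : E3 → ℝ,
      LocallyIntegrable V volume → IsLatticePeriodic V → SmallLargeParts V ε →
      (∀ f ∈ H1, ∀ g ∈ H1, Integrable (fun x => (V x : ℂ) * f x * conj (g x)) volume) ∧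
      ∃ T : L2 →ₗ.[ℂ] L2,
        IsSelfAdjointOperatorOfForm A V T ∧
        (∀ T' : L2 →ₗ.[ℂ] L2, IsSelfAdjointOperatorOfForm A V T' → T' = T) ∧
        (∀ f : T.domain, DistributionalEq A V f (T f)) ∧
        (T.domain : Set L2) = {f | f ∈ H1 ∧ ∃ h : L2, DistributionalEq A V f h} := by
  obtain ⟨c, hc0, hc⟩ := exists_coercive_of_posDef (H := L2) hA
  have hsymm : ∀ j k, A j k = A k j := fun j k => by
    simpa using (hA.isHermitian.apply j k).symm
  -- This ε makes the relative bound of the potential c/2, strictly below the ellipticity constant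
  -- c.
  refine ⟨c / (2 * 25165824), by positivity, fun V hV hper hs => ?_⟩
  obtain ⟨N, hb⟩ := hs.exists_formBound hV hper (by positivity)
  have hac : 25165824 * (c / (2 * 25165824)) < c := by linarith
  refine ⟨fun f hf g hg => hb.integrable (.ofH1 hf) (.ofH1 hg), hb.operator A,
    ⟨hb.isSelfAdjoint_operator hsymm hac hc, ?_, ?_⟩, ?_, ?_, ?_⟩
  · intro f hf
    obtain ⟨u, hu, -⟩ := hb.exists_gradForm_operator_eq ⟨f, hf⟩
    rw [← show u.fn = f from hu]
    exact u.fn_mem_H1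
  · intro f
    refine (hb.form_eq_inner_iff.2 ?_).2
    rw [← hb.graph_operator]
    exact (hb.operator A).mem_graph f
  · rintro T' ⟨h1, h2, h3⟩
    refine eq_of_isSelfAdjoint_of_le h1 (hb.operator_symmetric hsymm)
      (LinearPMap.le_of_le_graph ?_)
    rintro ⟨f, h⟩ hfh
    obtain ⟨f', rfl, rfl⟩ := (LinearPMap.mem_graph_iff _).1 hfh
    rw [hb.graph_operator]
    exact hb.form_eq_inner_iff.1 ⟨h2 f'.2, h3 f'⟩
  · intro f
    obtain ⟨u, hu, h⟩ := hb.exists_gradForm_operator_eq f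
    rw [← hu]
    exact (hb.distributionalEq_iff hsymm u _).2 h
  · ext f
    constructor
    · intro hf
      obtain ⟨u, hu, h⟩ := hb.exists_gradForm_operator_eq ⟨f, hf⟩
      rw [← show u.fn = f from hu]
      exact ⟨u.fn_mem_H1, _, (hb.distributionalEq_iff hsymm u _).2 h⟩
    · rintro ⟨hf, h, hd⟩
      obtain ⟨f', hf', -⟩ := hb.exists_operator_eq
        ((hb.distributionalEq_iff hsymm (.ofH1 hf) h).1 hd)
      rw [← GradSpace.fn_ofH1 hf, ← hf']
      exact f'.2
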